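/- Let $B$ be a $\sigma$-unital $C^*$-algebra. For a (right) Hilbert $C^*$-module $X$ over $B$ let $\mathbb{L}(X)$ and $\mathbb{K}(X)$ denote the bounded adjointable and the compact operators on $X$. An even unbounded Kasparov module over $B$ is a pair $(X,D)$ where $X$ is a countably generated Hilbert $C^*$-module over $B$ with a grading operator $\gamma=\gamma^*=\gamma^{-1}\in\mathbb{L}(X)$, and $D:\mathrm{Dom}(D)\to X$ is a selfadjoint and regular unbounded operator which is odd ($D\gamma=-\gamma D$) and satisfies $(i+D)^{-1}\in\mathbb{K}(X)$. Fix such a pair with $X\neq\{0\}$. Let $H\in\mathbb{L}(X)$ be selfadjoint, invertible and even ($H\gamma=\gamma H$), and assume that $H$ is Lipschitz with respect to $D$, i.e. $H$ preserves $\mathrm{Dom}(D)$ and $[D,H]$ extends to an operator $d(H)\in\mathbb{L}(X)$. A localizing function is an even continuous $L^1$-function $\phi:\mathbb{R}\to[0,1]$ which has support in $[-1,1]$, equals $1$ on $[-1/2,1/2]$, is non-increasing on $[0,\infty)$, and for which $p\,\widehat\phi(p)$ is in $L^1(\mathbb{R})$, where $\widehat\phi(p)=\frac{1}{\sqrt{2\pi}}\int\phi(x)e^{-ixp}\,dx$;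 put $c_\phi=2\|p\,\widehat\phi(p)\|_1/\sqrt{2\pi}$. A pair $(\kappa,\rho)$ of strictly positive numbers is admissible with respect to $(H,D,\phi)$ if $$\Big(\kappa+\frac{c_\phi\|H\|}{\rho}\Big)\|d(H)\|<\min\Big\{\|H^{-1}\|^{-2},\ \frac{\kappa^2\rho^2}{4}\Big\}.$$ With $\Phi_\rho:=\phi(D/\rho)$, the spectral localizer is $$L_{\kappa,\rho}(H,D,\phi):=\Phi_\rho\gamma H\Phi_\rho+\kappa\,\Phi_{2\rho}D\Phi_{2\rho}-(1-\Phi_{2\rho}^4)^{1/2}\gamma .$$ Let $D(\mathbb{L}(X),\mathbb{K}(X))=\{(x,y)\in\mathbb{L}(X)\oplus\mathbb{L}(X) : x-y\in\mathbb{K}(X)\}$, and let $K_0^{\mathrm{inv}}(\mathbb{L}(X),\mathbb{K}(X))$ be the set of selfadjoint invertible elements of the matrix algebras $M_n(D(\mathbb{L}(X),\mathbb{K}(X)))$, $n\geq1$, modulo stable homotopy: $H_0\sim H_1$ if, for some selfadjoint invertible matrices $G_0,G_1$ over $\mathbb{L}(X)$ (possibly of size $0$), the block sums $H_0\oplus(G_0,G_0)$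 and $H_1\oplus(G_1,G_1)$ have the same size and are joined by a norm-continuous path of selfadjoint invertible matrices over $D(\mathbb{L}(X),\mathbb{K}(X))$. The spectral localizer class $L(H,D)\in K_0^{\mathrm{inv}}(\mathbb{L}(X),\mathbb{K}(X))$ is the class of $(-\gamma,L_{\kappa,\rho}(H,D,\phi))$ for any localizing function $\phi$ and any pair $(\kappa,\rho)$ that is admissible with respect to $(H,D,\phi)$. Let $T\in\mathbb{L}(X)$ be selfadjoint and odd ($T\gamma=-\gamma T$). Then $(X,D+T)$, with $D+T$ defined on $\mathrm{Dom}(D)$ and with the same grading operator $\gamma$, is an even unbounded Kasparov module over $B$, and $H$ is Lipschitz with respect to $D+T$. Both $L(H,D)$ and $L(H,D+T)$ are well defined (for each of $D$ and $D+T$, an admissible pair exists for some localizing function, and for every localizing function and every admissible pair the element $(-\gamma,L_{\kappa,\rho})$ belongs to $D(\mathbb{L}(X),\mathbb{K}(X))$ and is invertible, and its class does not depend on the choices), and $$L(H,D+T)=L(H,D)\quad\text{in } K_0^{\mathrm{inv}}(\mathbb{L}(X),\mathbb{K}(X)).$$ -/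

import Mathlib

open Complex Filter Topology

set_option linter.unusedSectionVars false

/-! ## Adjointable operators on a Hilbert C⋆-module

Mathlib's `CStarModule A X` puts the scalars on the left, `⟪x, a • y⟫ = a * ⟪x, y⟫`.  A right
Hilbert C⋆-module over `B` is therefore precisely a `CStarModule Bᵐᵒᵖ X`: with
`x · b := op b • x` one has `⟪x, y · b⟫ = ⟪x, y⟫ b` in `B`. -/

section Adjointable

variable (A : Type*) {X : Type*} [NonUnitalCStarAlgebra A] [PartialOrder A] [StarOrderedRing A]
  [SMul A X] [NormedAddCommGroup X] [NormedSpace ℂ X] [CStarModule A X]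

theorem CStarModule.ext_inner_left {x y : X} (h : ∀ z : X, inner A z x = inner A z y) : x = y := by
  rw [← sub_eq_zero, ← CStarModule.inner_self (A := A), CStarModule.inner_sub_right, h, sub_self]

theorem CStarModule.ext_inner_right {x y : X} (h : ∀ z : X, inner A x z = inner A y z) : x = y := by
  refine CStarModule.ext_inner_left A fun z => ?_
  rw [← CStarModule.star_inner x z, ← CStarModule.star_inner y z, h]

variable (X)

/-- The algebra of bounded adjointable operators on `X`, inside the bounded operators. -/
def adjointableSubalgebra : Subalgebra ℂ (X →L[ℂ] X) where
  carrier := {T | ∃ S : X →L[ℂ] X, ∀ x y : X, inner A (T x) y = inner A x (S y)}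
  mul_mem' := by
    rintro T₁ T₂ ⟨S₁, h₁⟩ ⟨S₂, h₂⟩
    exact ⟨S₂ * S₁, fun x y => by simp [h₁, h₂]⟩
  add_mem' := by
    rintro T₁ T₂ ⟨S₁, h₁⟩ ⟨S₂, h₂⟩
    exact ⟨S₁ + S₂, fun x y => by simp [h₁, h₂]⟩
  algebraMap_mem' z := ⟨(star z) • 1, fun x y => by simp [Algebra.algebraMap_eq_smul_one]⟩

/-- `𝓛(X)`, the bounded adjointable operators on the Hilbert C⋆-module `X`. -/
def Adjointable : Type _ := adjointableSubalgebra A X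

noncomputable instance : NormedRing (Adjointable A X) :=
  inferInstanceAs (NormedRing (adjointableSubalgebra A X))

noncomputable instance : NormedAlgebra ℂ (Adjointable A X) :=
  inferInstanceAs (NormedAlgebra ℂ (adjointableSubalgebra A X))

variable {A X}

namespace Adjointable

/-- The underlying bounded operator. -/
def op (T : Adjointable A X) : X →L[ℂ] X := T.1

theorem ext' {S T : Adjointable A X} (h : ∀ x, S.op x = T.op x) : S = T :=
  Subtype.ext (ContinuousLinearMap.ext h)

theorem adj_mem {T S : X →L[ℂ] X} (h : ∀ x y : X, inner A (T x) y = inner A x (S y)) (x y : X) :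
    inner A (S x) y = inner A x (T y) := by
  rw [← CStarModule.star_inner, ← h, CStarModule.star_inner]

/-- The adjoint operator. -/
noncomputable instance : Star (Adjointable A X) where
  star T := ⟨T.2.choose, T.1, adj_mem T.2.choose_spec⟩

theorem inner_op_left (T : Adjointable A X) (x y : X) :
    inner A (T.op x) y = inner A x ((star T).op y) := T.2.choose_spec x y

theorem inner_op_right (T : Adjointable A X) (x y : X) :
    inner A x (T.op y) = inner A ((star T).op x) y := (adj_mem T.2.choose_spec x y).symm

theorem eq_star {T S : Adjointable A X}
    (h : ∀ x y : X, inner A (T.op x) y = inner A x (S.op y)) : star T = S :=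
  ext' fun y => CStarModule.ext_inner_left A fun x => by rw [← h, inner_op_left]

noncomputable instance : StarRing (Adjointable A X) where
  star_involutive T := eq_star fun x y => by rw [inner_op_right T]
  star_mul S T := eq_star fun x y => by
    change inner A (S.op (T.op x)) y = inner A x ((star T).op ((star S).op y))
    rw [inner_op_left, inner_op_left]
  star_add S T := eq_star fun x y => by
    change inner A (S.op x + T.op x) y = inner A x ((star S).op y + (star T).op y)
    simp [inner_op_left]

instance : StarModule ℂ (Adjointable A X) where
  star_smul z T := eq_star fun x y => by
    change inner A (z • T.op x) y = inner A x (star z • (star T).op y)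
    simp [inner_op_left]

theorem norm_def (T : Adjointable A X) : ‖T‖ = ‖T.op‖ := rfl

instance : CStarRing (Adjointable A X) where
  norm_mul_self_le T := by
    have key : ‖T.op‖ ≤ √‖(star T * T).op‖ := by
      refine T.op.opNorm_le_bound (Real.sqrt_nonneg _) fun x => ?_
      refine abs_le_of_sq_le_sq' ?_ (by positivity) |>.2
      rw [CStarModule.norm_sq_eq A, inner_op_left, mul_pow, Real.sq_sqrt (norm_nonneg _)]
      calc ‖inner A x ((star T * T).op x)‖ ≤ ‖x‖ * ‖(star T * T).op x‖ :=
            CStarModule.norm_inner_le X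
        _ ≤ ‖x‖ * (‖(star T * T).op‖ * ‖x‖) := by gcongr; exact ContinuousLinearMap.le_opNorm _ _
        _ = _ := by ring
    calc ‖T‖ * ‖T‖ = ‖T.op‖ ^ 2 := by rw [norm_def, sq]
      _ ≤ (√‖(star T * T).op‖) ^ 2 := by gcongr
      _ = ‖star T * T‖ := by rw [Real.sq_sqrt (norm_nonneg _), norm_def]

theorem isClosed_adjointableSubalgebra [CompleteSpace X] :
    IsClosed (adjointableSubalgebra A X : Set (X →L[ℂ] X)) := by
  refine IsSeqClosed.isClosed fun T T₀ hT hlim => ?_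
  let T' : ℕ → Adjointable A X := fun n => ⟨T n, hT n⟩
  have hc : CauchySeq fun n => (star (T' n)).op := by
    have h := hlim.cauchySeq
    rw [Metric.cauchySeq_iff] at h ⊢
    intro ε hε
    obtain ⟨N, hN⟩ := h ε hε
    refine ⟨N, fun m hm n hn => ?_⟩
    have := hN m hm n hn
    rw [dist_eq_norm] at this ⊢
    change ‖star (T' m) - star (T' n)‖ < ε
    rw [← star_sub, norm_star]
    exact this
  obtain ⟨S, hS⟩ := cauchySeq_tendsto_of_complete hc
  refine ⟨S, fun x y => ?_⟩
  have h1 : Tendsto (fun n => inner A (T n x) y) atTop (𝓝 (inner A (T₀ x) y)) := by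
    have : Tendsto (fun n => T n x) atTop (𝓝 (T₀ x)) :=
      ((ContinuousLinearMap.apply ℂ X x).continuous.tendsto T₀).comp hlim
    exact (CStarModule.continuous_inner (A := A) (E := X)).tendsto (T₀ x, y) |>.comp
      (this.prodMk_nhds tendsto_const_nhds)
  have h2 : Tendsto (fun n => inner A x ((star (T' n)).op y)) atTop (𝓝 (inner A x (S y))) := by
    have : Tendsto (fun n => (star (T' n)).op y) atTop (𝓝 (S y)) :=
      ((ContinuousLinearMap.apply ℂ X y).continuous.tendsto S).comp hS
    exact (CStarModule.continuous_inner (A := A) (E := X)).tendsto (x, S y) |>.comp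
      (tendsto_const_nhds.prodMk_nhds this)
  refine tendsto_nhds_unique h1 (h2.congr fun n => ?_)
  exact (inner_op_left (T' n) x y).symm

noncomputable instance [CompleteSpace X] : CStarAlgebra (Adjointable A X) where
  complete := (completeSpace_coe_iff_isComplete.2
    (isClosed_adjointableSubalgebra (A := A) (X := X)).isComplete).complete

end Adjointable

end Adjointable

/-! ## Closed ideals, relative K-theory through selfadjoint invertibles -/

/-- A norm-closed `*`-ideal of a unital C⋆-algebra. -/
structure CStarIdeal (L : Type*) [CStarAlgebra L] extends Submodule ℂ L where
  mul_mem_left : ∀ (x : L) {y : L}, y ∈ carrier → x * y ∈ carrier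
  mul_mem_right : ∀ {x : L} (y : L), x ∈ carrier → x * y ∈ carrier
  star_mem : ∀ {x : L}, x ∈ carrier → star x ∈ carrier
  isClosed : IsClosed carrier

section KTheory

variable {L : Type*} [CStarAlgebra L]

/-- `D(L, J) = {(x, y) ∈ L ⊕ L ∣ x - y ∈ J}`. -/
def relDouble (J : CStarIdeal L) : StarSubalgebra ℂ (L × L) where
  carrier := {p | p.1 - p.2 ∈ J.toSubmodule}
  mul_mem' := by
    rintro ⟨a, b⟩ ⟨c, d⟩ (h₁ : a - b ∈ J.toSubmodule) (h₂ : c - d ∈ J.toSubmodule)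
    change a * c - b * d ∈ J.toSubmodule
    have : a * c - b * d = a * (c - d) + (a - b) * d := by noncomm_ring
    rw [this]
    exact J.toSubmodule.add_mem (J.mul_mem_left a h₂) (J.mul_mem_right d h₁)
  add_mem' := by
    rintro ⟨a, b⟩ ⟨c, d⟩ (h₁ : a - b ∈ J.toSubmodule) (h₂ : c - d ∈ J.toSubmodule)
    change a + c - (b + d) ∈ J.toSubmodule
    rw [add_sub_add_comm]
    exact J.toSubmodule.add_mem h₁ h₂
  algebraMap_mem' z := by
    change algebraMap ℂ L z - algebraMap ℂ L z ∈ J.toSubmodule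
    rw [sub_self]; exact J.toSubmodule.zero_mem
  star_mem' := by
    rintro ⟨a, b⟩ (h : a - b ∈ J.toSubmodule)
    change star a - star b ∈ J.toSubmodule
    rw [← star_sub]
    exact J.star_mem h

/-- The diagonal embedding `Δ : L → D(L, J)`. -/
def relDiag (J : CStarIdeal L) (x : L) : relDouble J :=
  ⟨(x, x), by change x - x ∈ J.toSubmodule; rw [sub_self]; exact J.toSubmodule.zero_mem⟩

/-- `W_n(L, J)`: the selfadjoint invertible elements of `M_n(D(L, J))`.  Matrices carry the entrywise
topology, which is the topology of the C⋆-norm on `M_n(D(L, J))`. -/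
def relW (J : CStarIdeal L) (n : ℕ) : Set (Matrix (Fin n) (Fin n) (relDouble J)) :=
  {H | IsSelfAdjoint H ∧ IsUnit H}

/-- The block sum `H ⊕ Δ(G)` of `H ∈ M_n(D(L, J))` and `G ∈ M_i(L)`, an element of
`M_k(D(L, J))` where `k = n + i`. -/
def relStabilize (J : CStarIdeal L) {n i k : ℕ} (h : n + i = k)
    (H : Matrix (Fin n) (Fin n) (relDouble J)) (G : Matrix (Fin i) (Fin i) L) :
    Matrix (Fin k) (Fin k) (relDouble J) :=
  (Matrix.fromBlocks H 0 0 (G.map (relDiag J))).reindex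
    (finSumFinEquiv.trans (finCongr h)) (finSumFinEquiv.trans (finCongr h))

/-- `W(L, J)`: the disjoint union of the sets `W_n(L, J)` over `n ≥ 1`. -/
structure RelW (J : CStarIdeal L) where
  /-- the matrix size -/
  n : ℕ
  n_pos : 0 < n
  /-- the selfadjoint invertible matrix -/
  mat : Matrix (Fin n) (Fin n) (relDouble J)
  mem : mat ∈ relW J n

/-- Stable homotopy: after adding blocks `Δ(G₀)` and `Δ(G₁)` with `G₀`, `G₁` selfadjoint invertible
matrices over `L`, the two elements are joined by a continuous path in `W_k(L, J)`. -/
def StablyHomotopic (J : CStarIdeal L) (H₀ H₁ : RelW J) : Prop :=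
  ∃ (k i₀ i₁ : ℕ) (h₀ : H₀.n + i₀ = k) (h₁ : H₁.n + i₁ = k)
    (G₀ : Matrix (Fin i₀) (Fin i₀) L) (G₁ : Matrix (Fin i₁) (Fin i₁) L),
    IsSelfAdjoint G₀ ∧ IsUnit G₀ ∧ IsSelfAdjoint G₁ ∧ IsUnit G₁ ∧
    JoinedIn (relW J k) (relStabilize J h₀ H₀.mat G₀) (relStabilize J h₁ H₁.mat G₁)

/-- `K₀^inv(L, J)`: the quotient of `W(L, J)` by stable homotopy.  (Stable homotopy is already an
equivalence relation, so that generating one changes nothing.) -/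
def K0Inv (J : CStarIdeal L) : Type _ := Quot (StablyHomotopic J)

/-- The class in `K₀^inv(L, J)` of an element of `W(L, J)`. -/
def K0Inv.mk {J : CStarIdeal L} (H : RelW J) : K0Inv J := Quot.mk _ H

theorem one_mem_relW (J : CStarIdeal L) :
    (1 : Matrix (Fin 1) (Fin 1) (relDouble J)) ∈ relW J 1 :=
  ⟨IsSelfAdjoint.one _, isUnit_one⟩

/-- `E₁ = (1, 1)` represents the neutral element of `K₀^inv(L, J)`. -/
instance (J : CStarIdeal L) : Nonempty (K0Inv J) :=
  ⟨K0Inv.mk ⟨1, one_pos, 1, one_mem_relW J⟩⟩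

end KTheory

/-! ## Compact operators, unbounded operators, functional calculus -/

section Operators

variable {A X : Type*} [NonUnitalCStarAlgebra A] [PartialOrder A] [StarOrderedRing A]
  [SMul A X] [NormedAddCommGroup X] [NormedSpace ℂ X] [CStarModule A X]

theorem CStarModule.norm_op_smul_le (a : A) (x : X) : ‖a • x‖ ≤ ‖a‖ * ‖x‖ := by
  refine abs_le_of_sq_le_sq' ?_ (by positivity) |>.2
  rw [CStarModule.norm_sq_eq A, mul_pow, CStarModule.norm_sq_eq A (x := x)]
  simp only [CStarModule.inner_op_smul_right, CStarModule.inner_op_smul_left]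
  calc ‖a * (inner A x x * star a)‖ ≤ ‖a‖ * (‖inner A x x‖ * ‖star a‖) :=
        (norm_mul_le _ _).trans (by gcongr; exact norm_mul_le _ _)
    _ = _ := by rw [norm_star]; ring

/-- The rank one operator `θ_{x,y}(z) = x · ⟨y, z⟩` as a bounded operator. -/
noncomputable def rankOneCLM (A : Type*) {X : Type*} [NonUnitalCStarAlgebra A] [PartialOrder A]
    [StarOrderedRing A] [SMul A X] [NormedAddCommGroup X] [NormedSpace ℂ X] [CStarModule A X]
    (x y : X) : X →L[ℂ] X :=
  LinearMap.mkContinuous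
    { toFun := fun z => (inner A y z : A) • x
      map_add' := fun z w => CStarModule.ext_inner_left A fun v => by simp [add_mul]
      map_smul' := fun c z => CStarModule.ext_inner_left A fun v => by simp [smul_mul_assoc] }
    (‖y‖ * ‖x‖) fun z => by
      calc ‖(inner A y z : A) • x‖ ≤ ‖(inner A y z : A)‖ * ‖x‖ := CStarModule.norm_op_smul_le _ _
        _ ≤ (‖y‖ * ‖z‖) * ‖x‖ := by gcongr; exact CStarModule.norm_inner_le X
        _ = _ := by ring

theorem inner_rankOneCLM (x y z w : X) :
    inner A (rankOneCLM A x y z) w = inner A z (rankOneCLM A y x w) := by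
  change inner A ((inner A y z : A) • x) w = inner A z ((inner A x w : A) • y)
  simp

/-- The rank one operator `θ_{x,y}(z) = x · ⟨y, z⟩`. -/
noncomputable def rankOne (A : Type*) {X : Type*} [NonUnitalCStarAlgebra A] [PartialOrder A]
    [StarOrderedRing A] [SMul A X] [NormedAddCommGroup X] [NormedSpace ℂ X] [CStarModule A X]
    (x y : X) : Adjointable A X :=
  ⟨rankOneCLM A x y, rankOneCLM A y x, inner_rankOneCLM x y⟩

theorem star_rankOne (x y : X) : star (rankOne A x y) = rankOne A y x :=
  Adjointable.eq_star (inner_rankOneCLM x y)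

theorem mul_rankOne (T : Adjointable A X) (x y : X) :
    T * rankOne A x y = rankOne A (T.op x) y :=
  Adjointable.ext' fun z => CStarModule.ext_inner_left A fun v => by
    change inner A v (T.op ((inner A y z : A) • x)) = inner A v ((inner A y z : A) • T.op x)
    simp [Adjointable.inner_op_right]

theorem rankOne_mul (T : Adjointable A X) (x y : X) :
    rankOne A x y * T = rankOne A x ((star T).op y) := by
  rw [← star_star (rankOne A x y * T), star_mul, star_rankOne, mul_rankOne, star_rankOne]

variable (A X) in
/-- The span of the rank one operators. -/
noncomputable def finiteRankOperators : Submodule ℂ (Adjointable A X) :=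
  Submodule.span ℂ {T | ∃ x y : X, T = rankOne A x y}

variable [CompleteSpace X]

variable (A X) in
/-- `𝓚(X)`: the compact operators in the sense of Hilbert C⋆-modules, i.e. the closed linear span
of the rank one operators. -/
noncomputable def compactOperators : CStarIdeal (Adjointable A X) where
  toSubmodule := (finiteRankOperators A X).topologicalClosure
  mul_mem_left T S hS := by
    refine map_mem_closure (continuous_const_mul T) hS fun S hS => ?_
    induction hS using Submodule.span_induction with
    | mem S h =>
      obtain ⟨x, y, rfl⟩ := h
      exact Submodule.subset_span ⟨T.op x, y, mul_rankOne T x y⟩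
    | zero => rw [mul_zero]; exact Submodule.zero_mem _
    | add S₁ S₂ _ _ h₁ h₂ => rw [mul_add]; exact Submodule.add_mem _ h₁ h₂
    | smul c S _ h => rw [mul_smul_comm]; exact Submodule.smul_mem _ c h
  mul_mem_right {S} T hS := by
    refine map_mem_closure (f := fun S => S * T) (continuous_mul_const T) hS fun S hS => ?_
    induction hS using Submodule.span_induction with
    | mem S h =>
      obtain ⟨x, y, rfl⟩ := h
      exact Submodule.subset_span ⟨x, (star T).op y, rankOne_mul T x y⟩
    | zero => simp only [zero_mul]; exact Submodule.zero_mem _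
    | add S₁ S₂ _ _ h₁ h₂ => simp only [add_mul]; exact Submodule.add_mem _ h₁ h₂
    | smul c S _ h => simp only [smul_mul_assoc]; exact Submodule.smul_mem _ c h
  star_mem {S} hS := by
    refine map_mem_closure continuous_star hS fun S hS => ?_
    induction hS using Submodule.span_induction with
    | mem S h =>
      obtain ⟨x, y, rfl⟩ := h
      exact Submodule.subset_span ⟨y, x, star_rankOne x y⟩
    | zero => rw [star_zero]; exact Submodule.zero_mem _
    | add S₁ S₂ _ _ h₁ h₂ => rw [star_add]; exact Submodule.add_mem _ h₁ h₂
    | smul c S _ h => rw [star_smul]; exact Submodule.smul_mem _ _ h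
  isClosed := Submodule.isClosed_topologicalClosure _

/-! ### Selfadjoint and regular unbounded operators -/

variable (A) in
/-- `D` is a selfadjoint and regular unbounded operator on `X`: densely defined on a submodule,
linear over the coefficient algebra, symmetric, with `D + i` and `D - i` onto. -/
structure IsSelfAdjointRegular (D : X →ₗ.[ℂ] X) : Prop where
  dense : Dense (D.domain : Set X)
  smul_mem : ∀ (a : A) {x : X}, x ∈ D.domain → a • x ∈ D.domain
  map_smul : ∀ (a : A) (x : D.domain), D ⟨a • (x : X), smul_mem a x.2⟩ = a • D x
  symm : ∀ x y : D.domain, inner A (D x) (y : X) = inner A (x : X) (D y)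
  surj_add : ∀ y : X, ∃ x : D.domain, D x + I • (x : X) = y
  surj_sub : ∀ y : X, ∃ x : D.domain, D x - I • (x : X) = y

namespace IsSelfAdjointRegular

variable {D : X →ₗ.[ℂ] X}

theorem norm_le_add (hD : IsSelfAdjointRegular A D) (x : D.domain) :
    ‖(x : X)‖ ≤ ‖D x + I • (x : X)‖ := by
  refine abs_le_of_sq_le_sq' ?_ (norm_nonneg _) |>.2
  rw [CStarModule.norm_sq_eq A, CStarModule.norm_sq_eq A]
  have key : inner A (D x + I • (x : X)) (D x + I • (x : X))
      = inner A (D x) (D x) + inner A (x : X) (x : X) := by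
    simp [hD.symm x x, smul_smul]
  rw [key]
  exact CStarAlgebra.norm_le_norm_of_nonneg_of_le CStarModule.inner_self_nonneg
    (le_add_of_nonneg_left CStarModule.inner_self_nonneg)

theorem norm_le_sub (hD : IsSelfAdjointRegular A D) (x : D.domain) :
    ‖(x : X)‖ ≤ ‖D x - I • (x : X)‖ := by
  refine abs_le_of_sq_le_sq' ?_ (norm_nonneg _) |>.2
  rw [CStarModule.norm_sq_eq A, CStarModule.norm_sq_eq A]
  have key : inner A (D x - I • (x : X)) (D x - I • (x : X))
      = inner A (D x) (D x) + inner A (x : X) (x : X) := by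
    simp [hD.symm x x, smul_smul]
    abel
  rw [key]
  exact CStarAlgebra.norm_le_norm_of_nonneg_of_le CStarModule.inner_self_nonneg
    (le_add_of_nonneg_left CStarModule.inner_self_nonneg)

theorem add_injective (hD : IsSelfAdjointRegular A D) {x y : D.domain}
    (h : D x + I • (x : X) = D y + I • (y : X)) : x = y := by
  have := hD.norm_le_add (x - y)
  have h0 : D (x - y) + I • ((x - y : D.domain) : X) = 0 := by
    rw [D.map_sub, Submodule.coe_sub, smul_sub, sub_add_sub_comm, h, sub_self]
  rw [h0, norm_zero, norm_le_zero_iff] at this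
  exact sub_eq_zero.1 (Subtype.ext this)

theorem sub_injective (hD : IsSelfAdjointRegular A D) {x y : D.domain}
    (h : D x - I • (x : X) = D y - I • (y : X)) : x = y := by
  have := hD.norm_le_sub (x - y)
  have h0 : D (x - y) - I • ((x - y : D.domain) : X) = 0 := by
    rw [D.map_sub, Submodule.coe_sub, smul_sub, sub_sub_sub_comm, h, sub_self]
  rw [h0, norm_zero, norm_le_zero_iff] at this
  exact sub_eq_zero.1 (Subtype.ext this)

/-- The inverse of `D + i` as a bounded operator. -/
noncomputable def addInvCLM (hD : IsSelfAdjointRegular A D) : X →L[ℂ] X :=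
  LinearMap.mkContinuous
    { toFun := fun y => ((hD.surj_add y).choose : X)
      map_add' := fun y z => by
        rw [← Submodule.coe_add]
        congr 1
        refine hD.add_injective ?_
        rw [(hD.surj_add (y + z)).choose_spec, D.map_add, Submodule.coe_add, smul_add,
          add_add_add_comm, (hD.surj_add y).choose_spec, (hD.surj_add z).choose_spec]
      map_smul' := fun c y => by
        rw [RingHom.id_apply, ← Submodule.coe_smul]
        congr 1
        refine hD.add_injective ?_
        rw [(hD.surj_add (c • y)).choose_spec, D.map_smul, Submodule.coe_smul, smul_comm I c,
          ← smul_add, (hD.surj_add y).choose_spec] }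
    1 fun y => by
      rw [one_mul]
      have := hD.norm_le_add (hD.surj_add y).choose
      rwa [(hD.surj_add y).choose_spec] at this

/-- The inverse of `D - i` as a bounded operator. -/
noncomputable def subInvCLM (hD : IsSelfAdjointRegular A D) : X →L[ℂ] X :=
  LinearMap.mkContinuous
    { toFun := fun y => ((hD.surj_sub y).choose : X)
      map_add' := fun y z => by
        rw [← Submodule.coe_add]
        congr 1
        refine hD.sub_injective ?_
        rw [(hD.surj_sub (y + z)).choose_spec, D.map_add, Submodule.coe_add, smul_add,
          add_sub_add_comm, (hD.surj_sub y).choose_spec, (hD.surj_sub z).choose_spec]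
      map_smul' := fun c y => by
        rw [RingHom.id_apply, ← Submodule.coe_smul]
        congr 1
        refine hD.sub_injective ?_
        rw [(hD.surj_sub (c • y)).choose_spec, D.map_smul, Submodule.coe_smul, smul_comm I c,
          ← smul_sub, (hD.surj_sub y).choose_spec] }
    1 fun y => by
      rw [one_mul]
      have := hD.norm_le_sub (hD.surj_sub y).choose
      rwa [(hD.surj_sub y).choose_spec] at this

theorem inner_addInvCLM (hD : IsSelfAdjointRegular A D) (y z : X) :
    inner A (hD.addInvCLM y) z = inner A y (hD.subInvCLM z) := by
  change inner A ((hD.surj_add y).choose : X) z = inner A y ((hD.surj_sub z).choose : X)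
  have hy := (hD.surj_add y).choose_spec
  have hz := (hD.surj_sub z).choose_spec
  set u := (hD.surj_add y).choose
  set v := (hD.surj_sub z).choose
  rw [← hy, ← hz]
  simp [hD.symm u v, sub_eq_add_neg]

/-- The resolvent `(D + i)⁻¹`, a bounded adjointable operator with adjoint `(D - i)⁻¹`. -/
noncomputable def resolvent (hD : IsSelfAdjointRegular A D) : Adjointable A X :=
  ⟨hD.addInvCLM, hD.subInvCLM, hD.inner_addInvCLM⟩

theorem resolvent_mem (hD : IsSelfAdjointRegular A D) (y : X) :
    hD.resolvent.op y ∈ D.domain := (hD.surj_add y).choose.2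

theorem apply_resolvent (hD : IsSelfAdjointRegular A D) (y : X) :
    D ⟨hD.resolvent.op y, hD.resolvent_mem y⟩ + I • hD.resolvent.op y = y :=
  (hD.surj_add y).choose_spec

theorem resolvent_apply (hD : IsSelfAdjointRegular A D) (x : D.domain) :
    hD.resolvent.op (D x + I • (x : X)) = x :=
  congrArg Subtype.val (hD.add_injective (hD.apply_resolvent (D x + I • (x : X))))

theorem star_resolvent_apply (hD : IsSelfAdjointRegular A D) (x : D.domain) :
    (star hD.resolvent).op (D x - I • (x : X)) = x := by
  have h : star hD.resolvent = ⟨hD.subInvCLM, hD.addInvCLM, Adjointable.adj_mem hD.inner_addInvCLM⟩ :=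
    Adjointable.eq_star hD.inner_addInvCLM
  rw [h]
  exact congrArg Subtype.val
    (hD.sub_injective (hD.surj_sub (D x - I • (x : X))).choose_spec)

/-- The Cayley transform `C_D = (D - i)(D + i)⁻¹ = 1 - 2i (D + i)⁻¹`. -/
noncomputable def cayley (hD : IsSelfAdjointRegular A D) : Adjointable A X :=
  1 - (2 * I) • hD.resolvent

theorem cayley_apply (hD : IsSelfAdjointRegular A D) (x : D.domain) :
    hD.cayley.op (D x + I • (x : X)) = D x - I • (x : X) := by
  change (D x + I • (x : X)) - (2 * I) • hD.resolvent.op (D x + I • (x : X)) = _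
  rw [hD.resolvent_apply, mul_smul, two_smul]
  abel

theorem star_cayley_apply (hD : IsSelfAdjointRegular A D) (x : D.domain) :
    (star hD.cayley).op (D x - I • (x : X)) = D x + I • (x : X) := by
  have h : star hD.cayley = 1 + (2 * I) • star hD.resolvent := by
    simp [cayley]
  rw [h]
  change (D x - I • (x : X)) + (2 * I) • (star hD.resolvent).op (D x - I • (x : X)) = _
  rw [hD.star_resolvent_apply, mul_smul, two_smul]
  abel

theorem cayley_mem_unitary (hD : IsSelfAdjointRegular A D) :
    hD.cayley ∈ unitary (Adjointable A X) := by
  constructor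
  · refine Adjointable.ext' fun y => ?_
    obtain ⟨x, rfl⟩ := hD.surj_add y
    change (star hD.cayley).op (hD.cayley.op _) = _
    rw [hD.cayley_apply, hD.star_cayley_apply]
    rfl
  · refine Adjointable.ext' fun y => ?_
    obtain ⟨x, rfl⟩ := hD.surj_sub y
    change hD.cayley.op ((star hD.cayley).op _) = _
    rw [hD.star_cayley_apply, hD.cayley_apply]
    rfl

instance isStarNormal_cayley (hD : IsSelfAdjointRegular A D) : IsStarNormal hD.cayley :=
  ⟨by rw [commute_iff_eq, hD.cayley_mem_unitary.1, hD.cayley_mem_unitary.2]⟩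

end IsSelfAdjointRegular

/-- The inverse `c⁻¹(μ) = -i (μ + 1) (μ - 1)⁻¹` of the homeomorphism
`c : ℝ → S¹ \ {1}`, `c(t) = (t - i)(t + i)⁻¹` (it is real valued on the circle). -/
noncomputable def cayleyInv (μ : ℂ) : ℝ := (-I * (μ + 1) * (μ - 1)⁻¹).re

/-- Transport of a function on `ℝ` to the circle along `c`, extended by `0` at the point `1`. -/
noncomputable def onCircle (f : ℝ → ℂ) (μ : ℂ) : ℂ := if μ = 1 then 0 else f (cayleyInv μ)

namespace IsSelfAdjointRegular

variable {D : X →ₗ.[ℂ] X}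

/-- The functional calculus `f(D)` for continuous functions `f : ℝ → ℂ` which vanish at infinity,
obtained from the continuous functional calculus of the unitary `C_D`. -/
noncomputable def fc (hD : IsSelfAdjointRegular A D) (f : ℝ → ℂ) : Adjointable A X :=
  cfc (onCircle f) hD.cayley

end IsSelfAdjointRegular

theorem cayleyInv_eq {μ : ℂ} (hμ : ‖μ‖ = 1) (h1 : μ ≠ 1) :
    (cayleyInv μ : ℂ) = -I * (μ + 1) * (μ - 1)⁻¹ := by
  rw [cayleyInv, ← Complex.conj_eq_iff_re]
  have hc : (starRingEnd ℂ) μ = μ⁻¹ := by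
    rw [Complex.inv_def, Complex.normSq_eq_norm_sq, hμ]; simp
  have h0 : μ ≠ 0 := by rintro rfl; simp at hμ
  have h2 : μ - 1 ≠ 0 := sub_ne_zero.2 h1
  have h3 : 1 - μ ≠ 0 := sub_ne_zero.2 (Ne.symm h1)
  have h4 : μ⁻¹ - 1 ≠ 0 := by
    rw [sub_ne_zero]; intro h; exact h1 (by rw [← inv_inv μ, h, inv_one])
  simp only [map_mul, map_neg, Complex.conj_I, map_add, map_one, map_inv₀, map_sub, hc]
  have h5 : μ⁻¹ - 1 = -(μ - 1) * μ⁻¹ := by field_simp; ring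
  rw [h5]
  field_simp
  ring

theorem one_sub_mul_cayleyInv {μ : ℂ} (hμ : ‖μ‖ = 1) (h1 : μ ≠ 1) :
    (1 - μ) * (cayleyInv μ + I) = 2 * I := by
  rw [cayleyInv_eq hμ h1]
  have h2 : μ - 1 ≠ 0 := sub_ne_zero.2 h1
  field_simp
  ring

theorem continuousOn_onCircle {f : ℝ → ℂ} (hf : Continuous f)
    (h0 : Tendsto f (cocompact ℝ) (𝓝 0)) : ContinuousOn (onCircle f) (Metric.sphere (0 : ℂ) 1) := by
  intro μ hμ
  by_cases h1 : μ = 1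
  · subst h1
    rw [ContinuousWithinAt, Metric.tendsto_nhds]
    intro ε hε
    have hf0 : ∀ᶠ t in cocompact ℝ, dist (f t) 0 < ε := Metric.tendsto_nhds.1 h0 ε hε
    rw [← Metric.cobounded_eq_cocompact, ← comap_norm_atTop, eventually_comap,
      eventually_atTop] at hf0
    obtain ⟨M, hM⟩ := hf0
    have hnear : ∀ᶠ μ : ℂ in 𝓝 1, ‖μ - 1‖ * (|M| + 1) < 2 := by
      have : Tendsto (fun μ : ℂ => ‖μ - 1‖ * (|M| + 1)) (𝓝 1) (𝓝 (‖(1 : ℂ) - 1‖ * (|M| + 1))) :=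
        Continuous.tendsto (by fun_prop) 1
      rw [sub_self, norm_zero, zero_mul] at this
      exact this.eventually (gt_mem_nhds two_pos)
    filter_upwards [self_mem_nhdsWithin, mem_nhdsWithin_of_mem_nhds hnear] with ν hν hν'
    have hν1 : ‖ν‖ = 1 := by simpa using hν
    simp only [onCircle, if_true]
    split_ifs with h
    · simpa using hε
    · refine hM _ ?_ _ rfl
      have hpos : 0 < ‖ν - 1‖ := norm_pos_iff.2 (sub_ne_zero.2 h)
      have key : ‖ν - 1‖ * ‖(cayleyInv ν : ℂ) + I‖ = 2 := by
        have := congrArg norm (one_sub_mul_cayleyInv hν1 h)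
        rw [norm_mul, norm_sub_rev] at this
        rw [this]; simp
      have h3 : ‖ν - 1‖ * (|M| + 1) < ‖ν - 1‖ * (‖(cayleyInv ν : ℂ)‖ + 1) := by
        refine hν'.trans_le ?_
        rw [← key]
        gcongr
        exact (norm_add_le _ _).trans (by simp)
      have h4 := lt_of_mul_lt_mul_left h3 hpos.le
      rw [Complex.norm_real] at h4
      linarith [le_abs_self M]
  · have hc : ContinuousAt (onCircle f) μ := by
      have : onCircle f =ᶠ[𝓝 μ] fun ν => f (cayleyInv ν) := by
        filter_upwards [isOpen_ne.mem_nhds h1] with ν hν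
        simp only [onCircle, if_neg hν]
      rw [continuousAt_congr this]
      refine hf.continuousAt.comp ?_
      refine Complex.continuous_re.continuousAt.comp ?_
      have h2 : μ - 1 ≠ 0 := sub_ne_zero.2 h1
      fun_prop (disch := assumption)
    exact hc.continuousWithinAt

namespace IsSelfAdjointRegular

variable {D : X →ₗ.[ℂ] X}

theorem spectrum_cayley_subset (hD : IsSelfAdjointRegular A D) :
    spectrum ℂ hD.cayley ⊆ Metric.sphere (0 : ℂ) 1 :=
  spectrum.subset_circle_of_unitary hD.cayley_mem_unitary

/-- For compactly supported `f` one has `f(D) = (D + i)⁻¹ ((t + i) f)(D)`. -/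
theorem fc_eq_resolvent_mul (hD : IsSelfAdjointRegular A D) {f : ℝ → ℂ} (hf : Continuous f)
    (hc : HasCompactSupport f) :
    hD.fc f = hD.resolvent * hD.fc (fun t => ((t : ℂ) + I) * f t) := by
  have hg : Continuous fun t : ℝ => ((t : ℂ) + I) * f t := by fun_prop
  have hgc : HasCompactSupport fun t : ℝ => ((t : ℂ) + I) * f t := hc.mul_left
  have hR : hD.resolvent = cfc (fun μ : ℂ => (2 * I)⁻¹ * (1 - μ)) hD.cayley := by
    rw [cfc_const_mul (2 * I)⁻¹ (fun μ : ℂ => 1 - μ) hD.cayley,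
      cfc_sub (fun _ : ℂ => 1) (fun μ : ℂ => μ) hD.cayley, cfc_const_one ℂ hD.cayley,
      cfc_id' ℂ hD.cayley, cayley, sub_sub_cancel, smul_smul, inv_mul_cancel₀ (by simp), one_smul]
  rw [fc, fc, hR, ← cfc_mul _ _ _ (by fun_prop)
    ((continuousOn_onCircle hg hgc.is_zero_at_infty).mono hD.spectrum_cayley_subset)]
  refine cfc_congr fun μ hμ => ?_
  have hμ1 : ‖μ‖ = 1 := by simpa using hD.spectrum_cayley_subset hμ
  simp only [onCircle]
  split_ifs with h
  · simp
  · rw [mul_assoc, ← mul_assoc (1 - μ), one_sub_mul_cayleyInv hμ1 h, ← mul_assoc,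
      inv_mul_cancel₀ (by simp), one_mul]

theorem fc_mem_domain (hD : IsSelfAdjointRegular A D) {f : ℝ → ℂ} (hf : Continuous f)
    (hc : HasCompactSupport f) (x : X) : (hD.fc f).op x ∈ D.domain := by
  rw [hD.fc_eq_resolvent_mul hf hc]
  exact hD.resolvent_mem _

/-- `D f(D) = (t f)(D)` for compactly supported `f`. -/
theorem apply_fc (hD : IsSelfAdjointRegular A D) {f : ℝ → ℂ} (hf : Continuous f)
    (hc : HasCompactSupport f) (x : X) :
    D ⟨(hD.fc f).op x, hD.fc_mem_domain hf hc x⟩ = (hD.fc fun t => (t : ℂ) * f t).op x := by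
  have h1 : D ⟨(hD.fc f).op x, hD.fc_mem_domain hf hc x⟩ + I • (hD.fc f).op x
      = (hD.fc fun t => ((t : ℂ) + I) * f t).op x := by
    have e : (hD.fc f).op x
        = hD.resolvent.op ((hD.fc fun t => ((t : ℂ) + I) * f t).op x) := by
      conv_lhs => rw [hD.fc_eq_resolvent_mul hf hc]
      rfl
    have := hD.apply_resolvent ((hD.fc fun t => ((t : ℂ) + I) * f t).op x)
    simp only [← e] at this
    exact this
  have h2 : (hD.fc fun t => ((t : ℂ) + I) * f t) = (hD.fc fun t => (t : ℂ) * f t) + I • hD.fc f := by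
    have hg : Continuous fun t : ℝ => (t : ℂ) * f t := by fun_prop
    have hgc : HasCompactSupport fun t : ℝ => (t : ℂ) * f t := hc.mul_left
    have k1 := (continuousOn_onCircle hg hgc.is_zero_at_infty).mono hD.spectrum_cayley_subset
    have k2 := (continuousOn_onCircle hf hc.is_zero_at_infty).mono hD.spectrum_cayley_subset
    rw [fc, fc, fc, ← cfc_smul I _ _ k2, ← cfc_add hD.cayley _ (fun μ => I • onCircle f μ) k1
      (k2.const_smul I)]
    refine cfc_congr fun μ _ => ?_
    simp only [onCircle, smul_eq_mul]
    split_ifs <;> ring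
  rw [h2] at h1
  exact add_right_cancel h1

end IsSelfAdjointRegular

/-! ## Even unbounded Kasparov modules and Lipschitz operators -/

/-- A C⋆-algebra is `σ`-unital if it has a countable approximate unit (an increasing sequence of
positive contractions). -/
def IsSigmaUnital (B : Type*) [NonUnitalCStarAlgebra B] [PartialOrder B] : Prop :=
  ∃ u : ℕ → B, Monotone u ∧ (∀ n, 0 ≤ u n ∧ ‖u n‖ ≤ 1) ∧
    ∀ b : B, Tendsto (fun n => u n * b) atTop (𝓝 b) ∧ Tendsto (fun n => b * u n) atTop (𝓝 b)

/-- `X` is countably generated: the submodule generated by some countable set is dense. -/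
def IsCountablyGenerated (A X : Type*) [SMul A X] [NormedAddCommGroup X] [NormedSpace ℂ X] : Prop :=
  ∃ s : Set X, s.Countable ∧ Dense (Submodule.span ℂ {y : X | ∃ a : A, ∃ x ∈ s, y = a • x} : Set X)

variable (A) in
/-- `(X, D)` is an even unbounded Kasparov module, with grading operator `γ`. -/
structure IsEvenUnboundedKasparovModule (γ : Adjointable A X) (D : X →ₗ.[ℂ] X) : Prop where
  countablyGenerated : IsCountablyGenerated A X
  grading_selfAdjoint : IsSelfAdjoint γ
  grading_sq : γ * γ = 1
  selfAdjointRegular : IsSelfAdjointRegular A D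
  grading_mem : ∀ x : D.domain, γ.op x ∈ D.domain
  odd : ∀ x : D.domain, D ⟨γ.op x, grading_mem x⟩ = -γ.op (D x)
  compact_resolvent : selfAdjointRegular.resolvent ∈ (compactOperators A X).toSubmodule

/-- The sum `D + T : Dom(D) → X` of an unbounded operator and a bounded operator. -/
def boundedPerturbation (D : X →ₗ.[ℂ] X) (T : Adjointable A X) : X →ₗ.[ℂ] X :=
  (T.op : X →ₗ[ℂ] X) +ᵥ D

/-- `T` is a Lipschitz operator with respect to `D`: it preserves the domain and `[D, T]` extends to
a bounded adjointable operator. -/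
def IsLipschitz (D : X →ₗ.[ℂ] X) (T : Adjointable A X) : Prop :=
  ∃ h : ∀ x : D.domain, T.op x ∈ D.domain, ∃ S : Adjointable A X,
    ∀ x : D.domain, D ⟨T.op x, h x⟩ - T.op (D x) = S.op x

/-- The bounded adjointable extension `d(T)` of the commutator `[D, T]`. -/
noncomputable def IsLipschitz.deriv {D : X →ₗ.[ℂ] X} {T : Adjointable A X} (h : IsLipschitz D T) :
    Adjointable A X := h.choose_spec.choose

/-! ## The spectral localizer and its class -/

/-- The Fourier transform `(2π)^{-1/2} ∫ f(x) e^{-ixp} dx`. -/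
noncomputable def unitaryFourier (f : ℝ → ℝ) (p : ℝ) : ℂ :=
  ((√(2 * Real.pi))⁻¹ : ℝ) * ∫ x : ℝ, (f x : ℂ) * Complex.exp (-(I * x * p))

/-- Localizing functions. -/
structure IsLocalizing (φ : ℝ → ℝ) : Prop where
  continuous : Continuous φ
  integrable : MeasureTheory.Integrable φ
  mem_Icc : ∀ x, φ x ∈ Set.Icc (0 : ℝ) 1
  even : ∀ x, φ (-x) = φ x
  tsupport_subset : tsupport φ ⊆ Set.Icc (-1) 1
  eq_one : ∀ x ∈ Set.Icc (-(1 / 2) : ℝ) (1 / 2), φ x = 1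
  antitone : ∀ x₀ x₁ : ℝ, 0 ≤ x₀ → x₀ ≤ x₁ → φ x₁ ≤ φ x₀
  integrable_fourier : MeasureTheory.Integrable fun p : ℝ => (p : ℂ) * unitaryFourier φ p

/-- The constant `c_φ = 2 ‖p · φ̂(p)‖₁ / √(2π)`. -/
noncomputable def localizingConst (φ : ℝ → ℝ) : ℝ :=
  2 * (∫ p : ℝ, ‖(p : ℂ) * unitaryFourier φ p‖) / √(2 * Real.pi)

namespace IsSelfAdjointRegular

variable {D : X →ₗ.[ℂ] X}

/-- `Φ_ρ = φ(D/ρ)`. -/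
noncomputable def cutoff (hD : IsSelfAdjointRegular A D) (φ : ℝ → ℝ) (ρ : ℝ) : Adjointable A X :=
  hD.fc fun t => (φ (t / ρ) : ℂ)

/-- The bounded operator `D Φ_ρ = (t φ(t/ρ))(D)`; see `apply_cutoff`. -/
noncomputable def dCutoff (hD : IsSelfAdjointRegular A D) (φ : ℝ → ℝ) (ρ : ℝ) : Adjointable A X :=
  hD.fc fun t => (t : ℂ) * (φ (t / ρ) : ℂ)

theorem hasCompactSupport_cutoff {φ : ℝ → ℝ} (hφ : IsLocalizing φ) {ρ : ℝ} (hρ : 0 < ρ) :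
    HasCompactSupport fun t : ℝ => (φ (t / ρ) : ℂ) := by
  refine HasCompactSupport.intro (isCompact_Icc (a := -ρ) (b := ρ)) fun t ht => ?_
  rw [Complex.ofReal_eq_zero]
  by_contra h
  have := hφ.tsupport_subset (subset_tsupport φ h)
  rw [Set.mem_Icc, le_div_iff₀ hρ, div_le_iff₀ hρ] at this
  exact ht ⟨by linarith [this.1], by linarith [this.2]⟩

theorem continuous_cutoff {φ : ℝ → ℝ} (hφ : IsLocalizing φ) (ρ : ℝ) :
    Continuous fun t : ℝ => (φ (t / ρ) : ℂ) :=
  Complex.continuous_ofReal.comp (hφ.continuous.comp (continuous_id.div_const ρ))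

theorem cutoff_mem_domain (hD : IsSelfAdjointRegular A D) {φ : ℝ → ℝ} (hφ : IsLocalizing φ)
    {ρ : ℝ} (hρ : 0 < ρ) (x : X) : (hD.cutoff φ ρ).op x ∈ D.domain :=
  hD.fc_mem_domain (continuous_cutoff hφ ρ) (hasCompactSupport_cutoff hφ hρ) x

theorem apply_cutoff (hD : IsSelfAdjointRegular A D) {φ : ℝ → ℝ} (hφ : IsLocalizing φ)
    {ρ : ℝ} (hρ : 0 < ρ) (x : X) :
    D ⟨(hD.cutoff φ ρ).op x, hD.cutoff_mem_domain hφ hρ x⟩ = (hD.dCutoff φ ρ).op x :=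
  hD.apply_fc (continuous_cutoff hφ ρ) (hasCompactSupport_cutoff hφ hρ) x

/-- The spectral localizer
`L_{κ,ρ}(H, D, φ) = Φ_ρ γ H Φ_ρ + κ Φ_{2ρ} D Φ_{2ρ} - (1 - Φ_{2ρ}⁴)^{1/2} γ`. -/
noncomputable def localizer (hD : IsSelfAdjointRegular A D) (γ H : Adjointable A X) (φ : ℝ → ℝ)
    (κ ρ : ℝ) : Adjointable A X :=
  hD.cutoff φ ρ * γ * H * hD.cutoff φ ρ
    + (κ : ℂ) • (hD.cutoff φ (2 * ρ) * hD.dCutoff φ (2 * ρ))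
    - cfc Real.sqrt (1 - hD.cutoff φ (2 * ρ) ^ 4) * γ

end IsSelfAdjointRegular

/-- `(κ, ρ)` is admissible with respect to `(H, D, φ)`: with
`C_{κ,ρ} = (κ + c_φ ‖H‖ / ρ) ‖d(H)‖` and the gap `g = ‖H⁻¹‖⁻¹`,
one has `C_{κ,ρ} < min {g², κ² ρ² / 4}`. -/
def IsAdmissible {D : X →ₗ.[ℂ] X} {H : Adjointable A X} (hH : IsLipschitz D H) (φ : ℝ → ℝ)
    (κ ρ : ℝ) : Prop :=
  0 < κ ∧ 0 < ρ ∧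
    (κ + localizingConst φ * ‖H‖ / ρ) * ‖hH.deriv‖
      < min ((‖Ring.inverse H‖⁻¹) ^ 2) (κ ^ 2 * ρ ^ 2 / 4)

/-- `x` is the common class `[(-γ, L_{κ,ρ}(H, D, φ))]` of all spectral localizers: there is a
localizing function with an admissible pair, and for every localizing function `φ` and every
admissible pair `(κ, ρ)` the pair `(-γ, L_{κ,ρ}(H, D, φ))` lies in `W_1(𝓛(X), 𝓚(X))` and has
class `x`. -/
def IsSpectralLocalizerClass (γ : Adjointable A X) {D : X →ₗ.[ℂ] X}
    (hD : IsSelfAdjointRegular A D) {H : Adjointable A X} (hH : IsLipschitz D H)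
    (x : K0Inv (compactOperators A X)) : Prop :=
  (∃ (φ : ℝ → ℝ) (κ ρ : ℝ), IsLocalizing φ ∧ IsAdmissible hH φ κ ρ) ∧
  ∀ (φ : ℝ → ℝ) (κ ρ : ℝ), IsLocalizing φ → IsAdmissible hH φ κ ρ →
    ∃ (h : (-γ, hD.localizer γ H φ κ ρ) ∈ relDouble (compactOperators A X))
      (hW : Matrix.of (fun _ _ : Fin 1 => (⟨_, h⟩ : relDouble (compactOperators A X)))
        ∈ relW (compactOperators A X) 1),
      K0Inv.mk ⟨1, one_pos, _, hW⟩ = x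

/-- The spectral localizer class `L(H, D)`: the unique element singled out by
`IsSpectralLocalizerClass`. -/
noncomputable def spectralLocalizerClass (γ : Adjointable A X) {D : X →ₗ.[ℂ] X}
    (hD : IsSelfAdjointRegular A D) {H : Adjointable A X} (hH : IsLipschitz D H) :
    K0Inv (compactOperators A X) :=
  Classical.epsilon (IsSpectralLocalizerClass γ hD hH)

theorem IsSpectralLocalizerClass.unique {γ : Adjointable A X} {D : X →ₗ.[ℂ] X}
    {hD : IsSelfAdjointRegular A D} {H : Adjointable A X} {hH : IsLipschitz D H}
    {x y : K0Inv (compactOperators A X)} (hx : IsSpectralLocalizerClass γ hD hH x)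
    (hy : IsSpectralLocalizerClass γ hD hH y) : x = y := by
  obtain ⟨⟨φ, κ, ρ, hφ, ha⟩, hx⟩ := hx
  obtain ⟨_, _, rfl⟩ := hx φ κ ρ hφ ha
  obtain ⟨_, _, rfl⟩ := hy.2 φ κ ρ hφ ha
  rfl

end Operators

/-! ### Functional calculus of `D` for functions vanishing at infinity -/

section FunctionalCalculus

/-! The operators `D + sT`, `0 ≤ s ≤ 1`, share one domain and one grading, and `[D + sT, H] = d(H) +
s[T, H]` is bounded by `‖d(H)‖ + ‖[T, H]‖` for every `s`. Admissibility sees the unbounded operator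
only through this norm, so one `φ` and one pair `(κ, ρ)` serve the whole path
(`exists_admissible_of_norm_deriv_le`). The localizers along it are selfadjoint, invertible and
congruent to `-γ` modulo compacts. They are norm-continuous in `s`, because the Cayley transforms of
`D + S` and `D + T` differ by at most `2‖S - T‖` (`norm_cayley_sub_le`) and every part of the
localizer depending on `s` is a fixed continuous function of the Cayley transform. This is a path in
`W_1`, hence an equality of classes (`localizerClass_boundedPerturbation_eq`).

Invertibility is read off from the square. Put `P = Φ_ρ`, `B = D Φ_{2ρ}²`, `S = (1 -
Φ_{2ρ}⁴)^{1/2}`. The symbol of `Φ_{2ρ}` is `1` wherever that of `Φ_ρ` is nonzero, so `PS = 0` and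
`PB = DP`. The grading removes the other cross terms and `L² = (PHP)² + κγ[PHP, B] + κ²B² + S²`
(`localizer_sq`). Here `(PHP)²` differs from `P²H²P²` by a term `P(·)P` whose middle factor is
bounded by `2‖H‖‖[P, H]‖`, and `[PHP, B] = -P d(H) P`. Since `H² ≥ g²`, this gives `L² ≥ g²P⁴ -
C_{κ,ρ}P² + κ²B² + S²`. The right side is a function of `D` alone, and admissibility makes its
symbol uniformly positive (`symbol_lower_bound`).

The analytic input is `‖[Φ_ρ, H]‖ ≤ c_φ‖d(H)‖/(2ρ)` (`norm_commutator_cutoff_le`). For a bounded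
selfadjoint `a` in place of `D/ρ` it follows from Fourier inversion and `‖[e^{ita}, h]‖ ≤ |t|‖[a,
h]‖`. The unbounded case is the limit `η → 0` of `a = D(1 + η²D²)⁻¹/ρ`.

The class does not depend on the choices: enlarging `ρ` preserves admissibility, and at a large
common `ρ` both `κ` and `φ` can be interpolated linearly (`localizerClass_eq`). -/

/-- Continuous functions on `ℝ` which vanish at infinity. -/
structure IsC0 (f : ℝ → ℂ) : Prop where
  continuous : Continuous f
  tendsto : Tendsto f (cocompact ℝ) (𝓝 0)

namespace IsC0

variable {f g : ℝ → ℂ}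

theorem sub (hf : IsC0 f) (hg : IsC0 g) : IsC0 fun t => f t - g t :=
  ⟨hf.1.sub hg.1, by simpa using hf.2.sub hg.2⟩

theorem mul (hf : IsC0 f) (hg : IsC0 g) : IsC0 fun t => f t * g t :=
  ⟨hf.1.mul hg.1, by simpa using hf.2.mul hg.2⟩

theorem const_mul (c : ℂ) (hf : IsC0 f) : IsC0 fun t => c * f t :=
  ⟨hf.1.const_mul c, by simpa using hf.2.const_mul c⟩

theorem of_hasCompactSupport (hf : Continuous f) (hc : HasCompactSupport f) : IsC0 f :=
  ⟨hf, hc.is_zero_at_infty⟩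

theorem of_norm_le (hf : Continuous f) (C : ℝ) (h : ∀ t, ‖f t‖ * |t| ≤ C) : IsC0 f := by
  refine ⟨hf, ?_⟩
  have h1 : Tendsto (fun t : ℝ => C / ‖t‖) (cocompact ℝ) (𝓝 0) :=
    (tendsto_norm_cocompact_atTop (E := ℝ)).const_div_atTop C
  refine squeeze_zero_norm' ?_ h1
  filter_upwards [(tendsto_norm_cocompact_atTop (E := ℝ)).eventually_gt_atTop 0] with t ht
  rw [le_div_iff₀ ht]
  exact h t

end IsC0

theorem isC0_inv_add_I : IsC0 fun t : ℝ => ((t : ℂ) + I)⁻¹ := by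
  have hne : ∀ t : ℝ, (t : ℂ) + I ≠ 0 := fun t h => by
    simpa using congrArg Complex.im h
  refine IsC0.of_norm_le (by fun_prop (disch := exact hne _)) 1 fun t => ?_
  rw [norm_inv, inv_mul_le_one₀ (norm_pos_iff.2 (hne t))]
  simpa using Complex.abs_re_le_norm ((t : ℂ) + I)

variable {A X : Type*} [NonUnitalCStarAlgebra A] [PartialOrder A] [StarOrderedRing A]
  [SMul A X] [NormedAddCommGroup X] [NormedSpace ℂ X] [CStarModule A X] [CompleteSpace X]

namespace IsSelfAdjointRegular

variable {D : X →ₗ.[ℂ] X} (hD : IsSelfAdjointRegular A D) {f g : ℝ → ℂ}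


theorem continuousOn_spectrum_cayley (hD : IsSelfAdjointRegular A D) (hf : IsC0 f) :
    ContinuousOn (onCircle f) (spectrum ℂ hD.cayley) :=
  (continuousOn_onCircle hf.1 hf.2).mono hD.spectrum_cayley_subset

theorem fc_add (hf : IsC0 f) (hg : IsC0 g) :
    hD.fc (fun t => f t + g t) = hD.fc f + hD.fc g := by
  rw [fc, fc, fc, ← cfc_add hD.cayley _ _ (hD.continuousOn_spectrum_cayley hf)
    (hD.continuousOn_spectrum_cayley hg)]
  refine cfc_congr fun μ _ => ?_
  simp only [onCircle]
  split_ifs <;> simp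

theorem fc_sub (hf : IsC0 f) (hg : IsC0 g) :
    hD.fc (fun t => f t - g t) = hD.fc f - hD.fc g := by
  rw [fc, fc, fc, ← cfc_sub _ _ hD.cayley (hD.continuousOn_spectrum_cayley hf)
    (hD.continuousOn_spectrum_cayley hg)]
  refine cfc_congr fun μ _ => ?_
  simp only [onCircle]
  split_ifs <;> simp

theorem fc_mul (hf : IsC0 f) (hg : IsC0 g) :
    hD.fc (fun t => f t * g t) = hD.fc f * hD.fc g := by
  rw [fc, fc, fc, ← cfc_mul _ _ hD.cayley (hD.continuousOn_spectrum_cayley hf)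
    (hD.continuousOn_spectrum_cayley hg)]
  refine cfc_congr fun μ _ => ?_
  simp only [onCircle]
  split_ifs <;> simp

theorem fc_const_mul (c : ℂ) (hf : IsC0 f) :
    hD.fc (fun t => c * f t) = c • hD.fc f := by
  rw [fc, fc, ← cfc_smul c _ _ (hD.continuousOn_spectrum_cayley hf)]
  refine cfc_congr fun μ _ => ?_
  simp only [onCircle]
  split_ifs <;> simp

theorem fc_commute (hf : IsC0 f) (hg : IsC0 g) : hD.fc f * hD.fc g = hD.fc g * hD.fc f := by
  rw [← hD.fc_mul hf hg, ← hD.fc_mul hg hf]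
  simp_rw [mul_comm]

theorem star_fc (f : ℝ → ℂ) : star (hD.fc f) = hD.fc fun t => star (f t) := by
  rw [fc, fc, ← cfc_star]
  refine cfc_congr fun μ _ => ?_
  simp only [onCircle]
  split_ifs <;> simp

theorem isSelfAdjoint_fc (h : ∀ t, star (f t) = f t) : IsSelfAdjoint (hD.fc f) := by
  rw [IsSelfAdjoint, hD.star_fc]
  simp_rw [h]

theorem norm_fc_le {c : ℝ} (hc : 0 ≤ c) (h : ∀ t, ‖f t‖ ≤ c) : ‖hD.fc f‖ ≤ c := by
  refine norm_cfc_le hc fun μ _ => ?_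
  simp only [onCircle]
  split_ifs
  · simpa using hc
  · exact h _

/-- On the circle `(t + i)⁻¹` becomes `(1 - μ)/(2i)`, which vanishes at `μ = 1` as it must. This
lets identities between scalar functions be read as identities involving the resolvent. -/
theorem fc_inv_add_I : hD.fc (fun t => ((t : ℂ) + I)⁻¹) = hD.resolvent := by
  have hR : hD.resolvent = cfc (fun μ : ℂ => (2 * I)⁻¹ * (1 - μ)) hD.cayley := by
    rw [cfc_const_mul (2 * I)⁻¹ (fun μ : ℂ => 1 - μ) hD.cayley,
      cfc_sub (fun _ : ℂ => 1) (fun μ : ℂ => μ) hD.cayley, cfc_const_one ℂ hD.cayley,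
      cfc_id' ℂ hD.cayley, cayley, sub_sub_cancel, smul_smul, inv_mul_cancel₀ (by simp), one_smul]
  rw [fc, hR]
  refine cfc_congr fun μ hμ => ?_
  have hμ1 : ‖μ‖ = 1 := by simpa using hD.spectrum_cayley_subset hμ
  simp only [onCircle]
  split_ifs with h
  · simp [h]
  · have h1 := one_sub_mul_cayleyInv hμ1 h
    have h2 : (cayleyInv μ : ℂ) + I ≠ 0 := fun h0 => by
      rw [h0, mul_zero] at h1
      simp at h1
    rw [← h1, mul_inv, mul_assoc, mul_comm, mul_assoc, mul_inv_cancel₀ (sub_ne_zero.2 (Ne.symm h)),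
      mul_one]

/-- Compactly supported functions give compact operators if the resolvent is compact. -/
theorem fc_mem_compactOperators (hR : hD.resolvent ∈ (compactOperators A X).toSubmodule)
    (hf : Continuous f) (hc : HasCompactSupport f) :
    hD.fc f ∈ (compactOperators A X).toSubmodule := by
  rw [hD.fc_eq_resolvent_mul hf hc]
  exact (compactOperators A X).mul_mem_right _ hR

/-- Since `γDγ = -D`, conjugation by `γ` interchanges `D - i` and `D + i` up to a common sign, hence
inverts the Cayley transform. -/
theorem grading_mul_cayley {γ : Adjointable A X} (hγ : γ * γ = 1)
    (hmem : ∀ x : D.domain, γ.op x ∈ D.domain)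
    (hodd : ∀ x : D.domain, D ⟨γ.op x, hmem x⟩ = -γ.op (D x)) :
    γ * hD.cayley * γ = star hD.cayley := by
  refine Adjointable.ext' fun y => ?_
  obtain ⟨x, rfl⟩ := hD.surj_sub y
  change γ.op (hD.cayley.op (γ.op _)) = _
  have h1 := hD.cayley_apply ⟨γ.op x, hmem x⟩
  have hγ' : ∀ z, γ.op (γ.op z) = z := fun z => congrArg (fun S : Adjointable A X => S.op z) hγ
  rw [hodd] at h1
  rw [hD.star_cayley_apply]
  have h2 : γ.op (D x - I • (x : X)) = -(-γ.op (D x) + I • γ.op x) := by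
    rw [map_sub, _root_.map_smul]; abel
  rw [h2, map_neg, h1, map_neg, map_sub, map_neg, _root_.map_smul, hγ', hγ']
  abel

/-- Conjugation by the unitary `γ` is a continuous `*`-automorphism taking the Cayley transform to
its adjoint, and complex conjugation of the circle corresponds to `t ↦ -t` on the line. Even
functions of `D` therefore commute with `γ` and odd ones anticommute. -/
theorem grading_mul_fc {γ : Adjointable A X} (hγs : IsSelfAdjoint γ) (hγ : γ * γ = 1)
    (hmem : ∀ x : D.domain, γ.op x ∈ D.domain)
    (hodd : ∀ x : D.domain, D ⟨γ.op x, hmem x⟩ = -γ.op (D x)) (hf : IsC0 f) :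
    γ * hD.fc f = hD.fc (fun t => f (-t)) * γ := by
  have hu : γ ∈ unitary (Adjointable A X) := by
    rw [Unitary.mem_iff, hγs.star_eq]; exact ⟨hγ, hγ⟩
  let F := Unitary.conjStarAlgAut ℂ (Adjointable A X) ⟨γ, hu⟩
  have hF : ∀ x, F x = γ * x * γ := fun x => by
    rw [Unitary.conjStarAlgAut_apply]
    change γ * x * star γ = _
    rw [hγs.star_eq]
  have hcont : Continuous F := by
    have : (F : Adjointable A X → Adjointable A X) = fun x => γ * x * γ := funext hF
    rw [this]; fun_prop
  have h1 : F (hD.fc f) = cfc (onCircle f) (star hD.cayley) := by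
    rw [← hD.grading_mul_cayley hγ hmem hodd, ← hF]
    refine StarAlgHomClass.map_cfc F (onCircle f) hD.cayley
      (hD.continuousOn_spectrum_cayley hf) hcont ?_ ?_
    · exact hD.isStarNormal_cayley
    · rw [hF, hD.grading_mul_cayley hγ hmem hodd]; exact inferInstance
  have h2 : cfc (onCircle f) (star hD.cayley) = hD.fc (fun t => f (-t)) := by
    have hc' : ContinuousOn (onCircle f) (star '' spectrum ℂ hD.cayley) := by
      refine (continuousOn_onCircle hf.1 hf.2).mono ?_
      rintro _ ⟨μ, hμ, rfl⟩
      simpa using hD.spectrum_cayley_subset hμ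
    rw [fc, ← cfc_comp_star (onCircle f) hD.cayley hc']
    refine cfc_congr fun μ hμ => ?_
    have hμ1 : ‖μ‖ = 1 := by simpa using hD.spectrum_cayley_subset hμ
    simp only [onCircle]
    by_cases h : μ = 1
    · simp [h]
    · have h' : star μ ≠ 1 := fun h0 => h (by rw [← star_star μ, h0, star_one])
      rw [if_neg h', if_neg h]
      congr 1
      have e1 := cayleyInv_eq (μ := star μ) (by rwa [norm_star]) h'
      have e2 := cayleyInv_eq hμ1 h
      have e3 : (cayleyInv (star μ) : ℂ) = -(cayleyInv μ : ℂ) := by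
        have := congrArg (starRingEnd ℂ) e2
        rw [Complex.conj_ofReal] at this
        rw [this, e1]
        simp
      exact_mod_cast e3
  rw [← h2, ← h1, hF, mul_assoc, hγ, mul_one]

end IsSelfAdjointRegular

end FunctionalCalculus

/-! ### Bounded perturbations of selfadjoint regular operators -/

section BoundedPerturbation

variable {A X : Type*} [NonUnitalCStarAlgebra A] [PartialOrder A] [StarOrderedRing A]
  [SMul A X] [NormedAddCommGroup X] [NormedSpace ℂ X] [CStarModule A X]

namespace Adjointable

theorem op_smul_coeff (T : Adjointable A X) (a : A) (x : X) : T.op (a • x) = a • T.op x :=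
  CStarModule.ext_inner_left A fun v => by simp [inner_op_right]

theorem op_mul (S T : Adjointable A X) (x : X) : (S * T).op x = S.op (T.op x) := rfl

theorem op_add (S T : Adjointable A X) (x : X) : (S + T).op x = S.op x + T.op x := rfl

theorem op_sub (S T : Adjointable A X) (x : X) : (S - T).op x = S.op x - T.op x := rfl

theorem op_smul (c : ℂ) (S : Adjointable A X) (x : X) : (c • S).op x = c • S.op x := rfl

theorem ext_of_dense {S T : Adjointable A X} {s : Set X} (hs : Dense s)
    (h : ∀ x ∈ s, S.op x = T.op x) : S = T :=
  ext' fun x => congrFun (Continuous.ext_on hs S.op.continuous T.op.continuous h) x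

theorem op_of_mul_eq_one {S T : Adjointable A X} (h : S * T = 1) (x : X) : S.op (T.op x) = x :=
  congrArg (fun U : Adjointable A X => U.op x) h

end Adjointable

variable [CompleteSpace X] {D : X →ₗ.[ℂ] X}

theorem boundedPerturbation_add (S T : Adjointable A X) :
    boundedPerturbation (boundedPerturbation D S) T = boundedPerturbation D (S + T) := by
  refine LinearPMap.ext' ?_
  ext x
  change T.op x + (S.op x + D x) = (S.op x + T.op x) + D x
  abel

theorem boundedPerturbation_zero : boundedPerturbation D (0 : Adjointable A X) = D := by
  refine LinearPMap.ext' ?_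
  ext x
  change (0 : X) + D x = D x
  rw [zero_add]

namespace IsSelfAdjointRegular

theorem norm_resolvent_le (hD : IsSelfAdjointRegular A D) : ‖hD.resolvent‖ ≤ 1 := by
  rw [Adjointable.norm_def]
  refine ContinuousLinearMap.opNorm_le_bound _ zero_le_one fun y => ?_
  have := hD.norm_le_add ⟨hD.resolvent.op y, hD.resolvent_mem y⟩
  rw [one_mul]
  exact this.trans_eq (congrArg norm (hD.apply_resolvent y))

theorem star_resolvent_mem (hD : IsSelfAdjointRegular A D) (y : X) :
    ∃ x : D.domain, (x : X) = (star hD.resolvent).op y ∧ D x - I • (x : X) = y := by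
  obtain ⟨x, rfl⟩ := hD.surj_sub y
  exact ⟨x, (hD.star_resolvent_apply x).symm, rfl⟩

/-- One has `D + T ± i = (1 + T(D ± i)⁻¹)(D ± i)`, and the first factor is invertible by a Neumann
series because the resolvents are contractions. -/
theorem boundedPerturbation_of_norm_lt_one (hD : IsSelfAdjointRegular A D) {T : Adjointable A X}
    (hT : IsSelfAdjoint T) (hT1 : ‖T‖ < 1) : IsSelfAdjointRegular A (boundedPerturbation D T) where
  dense := hD.dense
  smul_mem := hD.smul_mem
  map_smul a x := by
    have := hD.map_smul a x
    change T.op (a • (x : X)) + D ⟨a • (x : X), _⟩ = a • (T.op x + D x)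
    rw [this, T.op_smul_coeff]
    exact CStarModule.ext_inner_left A fun v => by simp [mul_add]
  symm x y := by
    have h := hD.symm x y
    change inner A (T.op x + D x) (y : X) = inner A (x : X) (T.op y + D y)
    rw [CStarModule.inner_add_left, CStarModule.inner_add_right, h, T.inner_op_left, hT.star_eq]
  surj_add y := by
    have hu : IsUnit (1 - -(T * hD.resolvent)) := by
      refine isUnit_one_sub_of_norm_lt_one ?_
      rw [norm_neg]
      refine (norm_mul_le _ _).trans_lt (lt_of_le_of_lt ?_ hT1)
      exact mul_le_of_le_one_right (norm_nonneg _) hD.norm_resolvent_le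
    obtain ⟨U, hU⟩ := hu
    have h1 := Adjointable.op_of_mul_eq_one U.mul_inv y
    rw [hU, sub_neg_eq_add, Adjointable.op_add] at h1
    refine ⟨⟨hD.resolvent.op ((↑U⁻¹ : Adjointable A X).op y), hD.resolvent_mem _⟩, ?_⟩
    refine Eq.trans ?_ h1
    have h2 := hD.apply_resolvent ((↑U⁻¹ : Adjointable A X).op y)
    change T.op (hD.resolvent.op ((↑U⁻¹ : Adjointable A X).op y))
      + D ⟨hD.resolvent.op ((↑U⁻¹ : Adjointable A X).op y), hD.resolvent_mem _⟩
      + I • hD.resolvent.op ((↑U⁻¹ : Adjointable A X).op y) = _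
    rw [add_assoc, h2, add_comm]
    rfl
  surj_sub y := by
    have hu : IsUnit (1 - -(T * star hD.resolvent)) := by
      refine isUnit_one_sub_of_norm_lt_one ?_
      rw [norm_neg]
      refine (norm_mul_le _ _).trans_lt (lt_of_le_of_lt ?_ hT1)
      rw [norm_star]
      exact mul_le_of_le_one_right (norm_nonneg _) hD.norm_resolvent_le
    obtain ⟨U, hU⟩ := hu
    have h1 := Adjointable.op_of_mul_eq_one U.mul_inv y
    rw [hU, sub_neg_eq_add, Adjointable.op_add] at h1
    obtain ⟨x, hx, hx'⟩ := hD.star_resolvent_mem ((↑U⁻¹ : Adjointable A X).op y)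
    refine ⟨x, ?_⟩
    refine Eq.trans ?_ h1
    change T.op x + D x - I • (x : X) = _
    rw [add_sub_assoc, hx', hx, add_comm]
    rfl

/-- Bounded selfadjoint perturbations preserve selfadjointness and regularity. -/
theorem boundedPerturbation (hD : IsSelfAdjointRegular A D) {T : Adjointable A X}
    (hT : IsSelfAdjoint T) : IsSelfAdjointRegular A (boundedPerturbation D T) := by
  -- The perturbation is added in `n > ‖T‖` steps `T/n`, each of norm less than one.
  obtain ⟨n, hn⟩ := exists_nat_gt ‖T‖
  have hn0 : (0 : ℝ) < n := (norm_nonneg _).trans_lt hn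
  have hn0' : (n : ℂ) ≠ 0 := by exact_mod_cast hn0.ne'
  have key : ∀ k : ℕ,
      IsSelfAdjointRegular A (_root_.boundedPerturbation D (((k : ℂ) / n) • T)) := by
    intro k
    induction k with
    | zero => simpa [boundedPerturbation_zero] using hD
    | succ k ih =>
      have h1 : IsSelfAdjoint ((1 / n : ℂ) • T) := by
        rw [IsSelfAdjoint, star_smul, hT.star_eq]; simp
      have h2 : ‖(1 / n : ℂ) • T‖ < 1 := by
        rw [norm_smul]
        simp only [one_div, norm_inv, Complex.norm_natCast]
        rwa [inv_mul_lt_one₀ hn0]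
      have := ih.boundedPerturbation_of_norm_lt_one h1 h2
      rw [boundedPerturbation_add, ← add_smul] at this
      rwa [← add_div, ← Nat.cast_succ] at this
  have := key n
  rwa [div_self hn0', one_smul] at this

/-- The second resolvent identity. It serves twice: the perturbed resolvent is compact because `D`
has compact resolvent, and Cayley transforms can be compared in norm. -/
theorem resolvent_boundedPerturbation (hD : IsSelfAdjointRegular A D) {T : Adjointable A X}
    (hDT : IsSelfAdjointRegular A (_root_.boundedPerturbation D T)) :
    hDT.resolvent = hD.resolvent * (1 - T * hDT.resolvent) := by
  refine Adjointable.ext' fun y => ?_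
  have h1 := hDT.apply_resolvent y
  have h2 := hD.resolvent_apply ⟨hDT.resolvent.op y, hDT.resolvent_mem y⟩
  change T.op (hDT.resolvent.op y) + D ⟨hDT.resolvent.op y, hDT.resolvent_mem y⟩
    + I • hDT.resolvent.op y = y at h1
  rw [add_assoc, add_comm, ← eq_sub_iff_add_eq] at h1
  rw [h1] at h2
  exact h2.symm

/-- View `D + S` as the perturbation of `D + T` by `S - T`. As the Cayley transform is `1 - 2i`
times the resolvent, the difference is `2i` times the product of one resolvent, `S - T` and the
other resolvent. -/
theorem norm_cayley_sub_le {S T : Adjointable A X}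
    (hS : IsSelfAdjointRegular A (_root_.boundedPerturbation D S))
    (hT : IsSelfAdjointRegular A (_root_.boundedPerturbation D T)) :
    ‖hS.cayley - hT.cayley‖ ≤ 2 * ‖S - T‖ := by
  have e : _root_.boundedPerturbation D S
      = _root_.boundedPerturbation (_root_.boundedPerturbation D T) (S - T) := by
    rw [boundedPerturbation_add]; congr 1; abel
  have h : hS.resolvent = hT.resolvent * (1 - (S - T) * hS.resolvent) := by
    generalize S - T = U at e
    generalize _root_.boundedPerturbation D S = D' at e hS
    subst e
    exact hT.resolvent_boundedPerturbation hS
  have h' : hS.cayley - hT.cayley = (2 * I) • (hT.resolvent * ((S - T) * hS.resolvent)) := by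
    rw [cayley, cayley, sub_sub_sub_cancel_left, ← smul_sub]
    congr 1
    conv_lhs => rw [h]
    noncomm_ring
  rw [h', norm_smul, norm_mul, Complex.norm_I, Complex.norm_two, mul_one]
  gcongr
  calc _ ≤ ‖hT.resolvent‖ * (‖S - T‖ * ‖hS.resolvent‖) :=
        (norm_mul_le _ _).trans (by gcongr; exact norm_mul_le _ _)
    _ ≤ 1 * (‖S - T‖ * 1) := by
        gcongr
        · exact hT.norm_resolvent_le
        · exact hS.norm_resolvent_le
    _ = _ := by ring

end IsSelfAdjointRegular

theorem IsEvenUnboundedKasparovModule.boundedPerturbation {γ T : Adjointable A X}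
    (hD : IsEvenUnboundedKasparovModule A γ D) (hTodd : T * γ = -(γ * T)) (hT : IsSelfAdjoint T) :
    IsEvenUnboundedKasparovModule A γ (boundedPerturbation D T) where
  countablyGenerated := hD.countablyGenerated
  grading_selfAdjoint := hD.grading_selfAdjoint
  grading_sq := hD.grading_sq
  selfAdjointRegular := hD.selfAdjointRegular.boundedPerturbation hT
  grading_mem := hD.grading_mem
  odd x := by
    have h := hD.odd x
    have h' := congrArg (fun S : Adjointable A X => S.op x) hTodd
    change T.op (γ.op x) = -γ.op (T.op x) at h'
    change T.op (γ.op x) + D ⟨γ.op x, _⟩ = -γ.op (T.op x + D x)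
    rw [h', h, map_add, neg_add]
  compact_resolvent := by
    rw [hD.selfAdjointRegular.resolvent_boundedPerturbation]
    exact (compactOperators A X).mul_mem_right _ hD.compact_resolvent

theorem IsLipschitz.deriv_spec {H : Adjointable A X} (hH : IsLipschitz D H) (x : D.domain) :
    D ⟨H.op x, hH.choose x⟩ - H.op (D x) = hH.deriv.op x := hH.choose_spec.choose_spec x

/-- The domain is dense, so the chosen bounded extension of `[D, H]` is the only one. Every explicit
computation of `d(H)` goes through this. -/
theorem IsLipschitz.deriv_eq (hD : IsSelfAdjointRegular A D) {H : Adjointable A X}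
    (hH : IsLipschitz D H) {S : Adjointable A X}
    (h : ∀ x : D.domain, D ⟨H.op x, hH.choose x⟩ - H.op (D x) = S.op x) : hH.deriv = S :=
  Adjointable.ext_of_dense hD.dense fun x hx => by
    rw [← hH.deriv_spec ⟨x, hx⟩, h ⟨x, hx⟩]

theorem IsLipschitz.boundedPerturbation_aux {H : Adjointable A X} (hH : IsLipschitz D H)
    (T : Adjointable A X) (x : D.domain) :
    (boundedPerturbation D T) ⟨H.op x, hH.choose x⟩ - H.op ((boundedPerturbation D T) x)
      = (hH.deriv + (T * H - H * T)).op x := by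
  change T.op (H.op x) + D ⟨H.op x, _⟩ - H.op (T.op x + D x)
    = hH.deriv.op x + (T.op (H.op x) - H.op (T.op x))
  rw [← hH.deriv_spec, map_add]
  abel

theorem IsLipschitz.boundedPerturbation {H : Adjointable A X} (hH : IsLipschitz D H)
    (T : Adjointable A X) : IsLipschitz (boundedPerturbation D T) H :=
  ⟨hH.choose, _, hH.boundedPerturbation_aux T⟩

theorem IsLipschitz.deriv_boundedPerturbation {H T : Adjointable A X}
    (hH : IsLipschitz D H) (hH' : IsLipschitz (_root_.boundedPerturbation D T) H)
    (hDT : IsSelfAdjointRegular A (_root_.boundedPerturbation D T)) :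
    hH'.deriv = hH.deriv + (T * H - H * T) :=
  hH'.deriv_eq hDT (hH.boundedPerturbation_aux T)

end BoundedPerturbation

/-! ### Commutators with functions of a bounded selfadjoint element -/

section BoundedCommutator

variable {L : Type*} [CStarAlgebra L]

theorem norm_exp_I_smul_le_one {a : L} (ha : IsSelfAdjoint a) (t : ℝ) :
    ‖NormedSpace.exp (t • (I • a))‖ ≤ 1 := by
  let +nondep : NormedAlgebra ℚ L := .restrictScalars ℚ ℂ L
  have : t • (I • a) ∈ skewAdjoint L := by
    rw [skewAdjoint.mem_iff, star_smul, star_smul, ha.star_eq]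
    simp
  have hu := NormedSpace.exp_mem_unitary_of_mem_skewAdjoint this
  rcases subsingleton_or_nontrivial L with _ | _
  · rw [Subsingleton.elim (NormedSpace.exp (t • (I • a))) 0, norm_zero]
    exact zero_le_one
  · exact (CStarRing.norm_of_mem_unitary hu).le

/-- `‖[e^{ita}, h]‖ ≤ |t| ‖[a, h]‖` for selfadjoint `a`. -/
theorem norm_commutator_exp_le {a : L} (ha : IsSelfAdjoint a) (h : L) (t : ℝ) :
    ‖NormedSpace.exp (t • (I • a)) * h - h * NormedSpace.exp (t • (I • a))‖
      ≤ |t| * ‖a * h - h * a‖ := by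
  let +nondep : NormedAlgebra ℚ L := .restrictScalars ℚ ℂ L
  set x : L := I • a with hx
  set E : ℝ → L := fun u => NormedSpace.exp (u • x) with hE
  have hmul : ∀ u, E (-u) * E u = 1 := fun u => by
    simp only [hE]
    rw [neg_smul, ← NormedSpace.exp_add_of_commute (Commute.refl _).neg_left, neg_add_cancel,
      NormedSpace.exp_zero]
  -- The curve `e^{iua} h e^{-iua}` has as derivative a unitary conjugate of `i[a, h]`, so the mean
  -- value inequality bounds its displacement. Multiplying that displacement by `e^{ita}` gives the
  -- commutator.
  have hd : ∀ u, HasDerivAt (fun u => E u * h * E (-u)) (E u * (x * h - h * x) * E (-u)) u := by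
    intro u
    have h1 : HasDerivAt E (E u * x) u := hasDerivAt_exp_smul_const x u
    have h2 : HasDerivAt (fun u => E (-u)) (-(x * E (-u))) u := by
      have h3 : HasDerivAt E (x * E (-u)) (-u) := hasDerivAt_exp_smul_const' x (-u)
      simpa [Function.comp_def] using! h3.scomp u (hasDerivAt_neg u)
    refine ((h1.mul_const h).mul h2).congr_deriv ?_
    noncomm_ring
  have hb : ∀ u, ‖E u * (x * h - h * x) * E (-u)‖ ≤ ‖a * h - h * a‖ := by
    intro u
    have e : x * h - h * x = I • (a * h - h * a) := by
      rw [hx, smul_mul_assoc, mul_smul_comm, smul_sub]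
    calc _ ≤ ‖E u‖ * ‖x * h - h * x‖ * ‖E (-u)‖ :=
          (norm_mul_le _ _).trans (by gcongr; exact norm_mul_le _ _)
      _ ≤ 1 * ‖x * h - h * x‖ * 1 := by
          gcongr <;> exact norm_exp_I_smul_le_one ha _
      _ = _ := by rw [e, norm_smul]; simp
  have hmv := Convex.norm_image_sub_le_of_norm_hasDerivWithin_le
    (fun u _ => (hd u).hasDerivWithinAt) (fun u _ => hb u) convex_univ
    (Set.mem_univ (0 : ℝ)) (Set.mem_univ t)
  have e0 : E 0 = 1 := by simp [hE]
  have e1 : E t * h - h * E t = (E t * h * E (-t) - E 0 * h * E (-0)) * E t := by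
    rw [neg_zero, e0, sub_mul, mul_assoc _ (E (-t)), hmul]
    simp
  change ‖E t * h - h * E t‖ ≤ _
  rw [e1]
  calc _ ≤ ‖E t * h * E (-t) - E 0 * h * E (-0)‖ * ‖E t‖ := norm_mul_le _ _
    _ ≤ (‖a * h - h * a‖ * ‖t - 0‖) * 1 := by
        gcongr
        exact norm_exp_I_smul_le_one ha _
    _ = _ := by rw [sub_zero, Real.norm_eq_abs]; ring

theorem cfc_exp_mul_I {c : L} [IsStarNormal c] {α : ℂ → ℝ}
    (hα : ContinuousOn (fun μ => (α μ : ℂ)) (spectrum ℂ c)) (t : ℝ) :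
    cfc (fun μ => Complex.exp (I * t * α μ)) c
      = NormedSpace.exp (t • (I • cfc (fun μ => (α μ : ℂ)) c)) := by
  have e : t • (I • cfc (fun μ => (α μ : ℂ)) c) = cfc (fun μ => (I * t) * (α μ : ℂ)) c := by
    rw [cfc_const_mul _ _ _ hα, ← Complex.coe_smul, smul_smul, mul_comm]
  rw [e, ← CFC.exp_eq_normedSpace_exp (𝕜 := ℂ), ← Complex.exp_eq_exp_ℂ]
  exact cfc_comp' Complex.exp (fun μ => (I * t) * (α μ : ℂ)) c
    (by fun_prop) (hα.const_smul (I * (t : ℂ)))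

/-- If `f` is the Fourier transform of `w` then `‖[f(a), h]‖ ≤ ‖p w(p)‖₁ ‖[a, h]‖`. -/
theorem norm_commutator_cfc_le {c : L} [IsStarNormal c] {α : ℂ → ℝ}
    (hα : ContinuousOn (fun μ => (α μ : ℂ)) (spectrum ℂ c)) {w f : ℝ → ℂ} (hw : Continuous w)
    (hwi : MeasureTheory.Integrable w) (hpw : MeasureTheory.Integrable fun p : ℝ => (p : ℂ) * w p)
    (hf : ∀ x : ℝ, f x = ∫ p : ℝ, w p * Complex.exp (I * p * x)) (h : L) :
    ‖cfc (fun μ => f (α μ)) c * h - h * cfc (fun μ => f (α μ)) c‖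
      ≤ (∫ p : ℝ, ‖(p : ℂ) * w p‖)
        * ‖cfc (fun μ => (α μ : ℂ)) c * h - h * cfc (fun μ => (α μ : ℂ)) c‖ := by
  set a := cfc (fun μ => (α μ : ℂ)) c with ha_def
  have ha : IsSelfAdjoint a := by
    rw [IsSelfAdjoint, ha_def, ← cfc_star]
    simp
  set F : ℝ → ℂ → ℂ := fun p μ => w p * Complex.exp (I * p * α μ) with hF
  have hcont : ContinuousOn (Function.uncurry F) (Set.univ ×ˢ spectrum ℂ c) := by
    have h1 : ContinuousOn (fun q : ℝ × ℂ => (α q.2 : ℂ)) (Set.univ ×ˢ spectrum ℂ c) :=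
      hα.comp continuousOn_snd fun q hq => hq.2
    have h2 : ContinuousOn (fun q : ℝ × ℂ => w q.1 * Complex.exp (I * q.1 * (α q.2 : ℂ)))
        (Set.univ ×ˢ spectrum ℂ c) := by fun_prop
    exact h2
  have hbound : ∀ p μ, ‖F p μ‖ ≤ ‖w p‖ := fun p μ => by
    have : I * p * α μ = ((p * α μ : ℝ) : ℂ) * I := by push_cast; ring
    simp only [hF]
    rw [norm_mul, this, Complex.norm_exp_ofReal_mul_I, mul_one]
  have hint : MeasureTheory.Integrable (fun p => cfc (F p) c) :=
    integrable_cfc F (fun p => ‖w p‖) c hcont (.of_forall fun p μ _ => hbound p μ)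
      hwi.norm.hasFiniteIntegral
  -- The functional calculus commutes with the integral over `p`, since the exponentials have
  -- modulus one and `‖w p‖` dominates.
  have hcfc : cfc (fun μ => f (α μ)) c = ∫ p, cfc (F p) c := by
    rw [← cfc_integral F (fun p => ‖w p‖) c hcont (.of_forall fun p μ _ => hbound p μ)
      hwi.norm.hasFiniteIntegral]
    simp_rw [hf]
    rfl
  have hFp : ∀ p, cfc (F p) c = w p • NormedSpace.exp (p • (I • a)) := fun p => by
    rw [← cfc_exp_mul_I hα, ← cfc_const_mul _ _ _ ?_]
    exact ContinuousOn.cexp (hα.const_smul (I * (p : ℂ)))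
  rw [hcfc, ← _root_.integral_mul_const_of_integrable hint,
    ← _root_.integral_const_mul_of_integrable hint,
    ← MeasureTheory.integral_sub (hint.mul_const h) (hint.const_mul h),
    ← MeasureTheory.integral_mul_const]
  refine MeasureTheory.norm_integral_le_of_norm_le (hpw.norm.mul_const _) (.of_forall fun p => ?_)
  rw [hFp, smul_mul_assoc, mul_smul_comm, ← smul_sub, norm_smul, norm_mul, Complex.norm_real,
    Real.norm_eq_abs, mul_comm |p|, mul_assoc]
  gcongr
  exact norm_commutator_exp_le ha h p

end BoundedCommutator

/-! ### Fourier inversion for localizing functions -/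

section Fourier

open MeasureTheory FourierTransform

/-- Change of normalisation: `𝓕` has kernel `e^{-2πixq}`, so `q = p/(2π)`. -/
theorem unitaryFourier_eq (φ : ℝ → ℝ) (p : ℝ) :
    unitaryFourier φ p
      = ((√(2 * Real.pi))⁻¹ : ℝ) * 𝓕 (fun x => (φ x : ℂ)) (p / (2 * Real.pi)) := by
  rw [unitaryFourier, Real.fourier_real_eq_integral_exp_smul]
  congr 1
  refine integral_congr_ae (.of_forall fun x => ?_)
  simp only [smul_eq_mul]
  rw [mul_comm]
  congr 2
  push_cast
  have : (Real.pi : ℂ) ≠ 0 := by exact_mod_cast Real.pi_ne_zero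
  field_simp

variable {φ : ℝ → ℝ}

theorem IsLocalizing.continuous_unitaryFourier (hφ : IsLocalizing φ) :
    Continuous (unitaryFourier φ) := by
  have h : Continuous (𝓕 (fun x => (φ x : ℂ))) :=
    VectorFourier.fourierIntegral_continuous Real.continuous_fourierChar
      (by exact continuous_inner) hφ.integrable.ofReal
  have : unitaryFourier φ
      = fun p => ((√(2 * Real.pi))⁻¹ : ℝ) * 𝓕 (fun x => (φ x : ℂ)) (p / (2 * Real.pi)) :=
    funext (unitaryFourier_eq φ)
  rw [this]
  fun_prop

/-- Near zero continuity suffices, and for `|p| > 1` the transform is dominated by the integrable `p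
φ̂(p)`. Integrability is what Fourier inversion requires. -/
theorem IsLocalizing.integrable_unitaryFourier (hφ : IsLocalizing φ) :
    Integrable (unitaryFourier φ) := by
  have hc := hφ.continuous_unitaryFourier
  have h1 : IntegrableOn (unitaryFourier φ) (Set.Icc (-1) 1) :=
    hc.continuousOn.integrableOn_compact isCompact_Icc
  have h2 : IntegrableOn (unitaryFourier φ) (Set.Icc (-1) 1)ᶜ := by
    refine Integrable.mono hφ.integrable_fourier.integrableOn hc.aestronglyMeasurable ?_
    refine (ae_restrict_iff' measurableSet_Icc.compl).2 (.of_forall fun p hp => ?_)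
    rw [norm_mul, Complex.norm_real, Real.norm_eq_abs]
    refine le_mul_of_one_le_left (norm_nonneg _) ?_
    by_contra h
    exact hp (abs_le.1 (not_le.1 h).le)
  have := h1.union h2
  rwa [Set.union_compl_self, integrableOn_univ] at this

theorem IsLocalizing.fourier_inversion (hφ : IsLocalizing φ) (x : ℝ) :
    (φ x : ℂ) = ∫ p : ℝ, ((√(2 * Real.pi))⁻¹ : ℝ) * unitaryFourier φ p
      * Complex.exp (I * p * x) := by
  have hpi : (0 : ℝ) < 2 * Real.pi := by positivity
  have hs : (0 : ℝ) < √(2 * Real.pi) := by positivity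
  have e : 𝓕 (fun x => (φ x : ℂ))
      = fun q => (√(2 * Real.pi) : ℂ) * unitaryFourier φ (q * (2 * Real.pi)) := by
    funext q
    rw [unitaryFourier_eq, mul_div_assoc, div_self hpi.ne', mul_one, ← mul_assoc]
    rw [← Complex.ofReal_mul, mul_inv_cancel₀ hs.ne', Complex.ofReal_one, one_mul]
  have hi : Integrable (𝓕 (fun x => (φ x : ℂ))) := by
    rw [e]
    exact (hφ.integrable_unitaryFourier.comp_mul_right' hpi.ne').const_mul _
  have hinv := congrFun (Continuous.fourierInv_fourier_eq
    (Complex.continuous_ofReal.comp hφ.continuous) hφ.integrable.ofReal hi) x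
  change 𝓕⁻ (𝓕 (fun x => (φ x : ℂ))) x = (φ x : ℂ) at hinv
  rw [← hinv, Real.fourierInv_eq', e]
  have := Measure.integral_comp_mul_right (fun p : ℝ => ((√(2 * Real.pi) : ℝ) : ℂ)
    * unitaryFourier φ p * Complex.exp (I * p * x)) (2 * Real.pi)
  trans ∫ q : ℝ, ((√(2 * Real.pi) : ℝ) : ℂ)
    * unitaryFourier φ (q * (2 * Real.pi)) * Complex.exp (I * (q * (2 * Real.pi) : ℝ) * x)
  · refine integral_congr_ae (.of_forall fun q => ?_)
    simp only [smul_eq_mul]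
    rw [mul_comm]
    congr 2
    simp
    ring
  · rw [this, ← integral_smul]
    refine integral_congr_ae (.of_forall fun p => ?_)
    simp only [Complex.real_smul]
    -- The substitution `p = 2πq` contributes `1/(2π)`, which turns the factor `√(2π)` into
    -- `1/√(2π)`.
    have : ((|(2 * Real.pi)⁻¹| : ℝ) : ℂ) * (√(2 * Real.pi) : ℝ) = ((√(2 * Real.pi))⁻¹ : ℝ) := by
      rw [abs_of_pos (by positivity), ← Complex.ofReal_mul]
      congr 1
      rw [← Real.sq_sqrt hpi.le]
      rw [Real.sqrt_sq hs.le]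
      field_simp
    rw [← mul_assoc, ← mul_assoc, this]

/-- The commutator estimate for a bounded selfadjoint operator and a localizing function. -/
theorem IsLocalizing.norm_commutator_cfc_le {L : Type*} [CStarAlgebra L] (hφ : IsLocalizing φ)
    {c : L} [IsStarNormal c] {α : ℂ → ℝ}
    (hα : ContinuousOn (fun μ => (α μ : ℂ)) (spectrum ℂ c)) (h : L) :
    ‖cfc (fun μ => (φ (α μ) : ℂ)) c * h - h * cfc (fun μ => (φ (α μ) : ℂ)) c‖
      ≤ localizingConst φ / 2
        * ‖cfc (fun μ => (α μ : ℂ)) c * h - h * cfc (fun μ => (α μ : ℂ)) c‖ := by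
  have e : localizingConst φ / 2
      = ∫ p : ℝ, ‖(p : ℂ) * (((√(2 * Real.pi))⁻¹ : ℝ) * unitaryFourier φ p)‖ := by
    rw [localizingConst]
    have : ∀ p : ℝ, ‖(p : ℂ) * (((√(2 * Real.pi))⁻¹ : ℝ) * unitaryFourier φ p)‖
        = (√(2 * Real.pi))⁻¹ * ‖(p : ℂ) * unitaryFourier φ p‖ := fun p => by
      rw [mul_left_comm, norm_mul, Complex.norm_real, Real.norm_of_nonneg (by positivity)]
    simp_rw [this]
    rw [integral_const_mul]
    ring
  rw [e]
  refine _root_.norm_commutator_cfc_le (f := fun x => (φ x : ℂ)) hα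
    (hφ.continuous_unitaryFourier.const_mul _) (hφ.integrable_unitaryFourier.const_mul _) ?_
    hφ.fourier_inversion h
  refine (hφ.integrable_fourier.const_mul ((√(2 * Real.pi))⁻¹ : ℝ)).congr (.of_forall fun p => ?_)
  exact mul_left_comm _ _ _

end Fourier

/-! ### The commutator estimate for unbounded `D` -/

section UnboundedCommutator

variable {A X : Type*} [NonUnitalCStarAlgebra A] [PartialOrder A] [StarOrderedRing A]
  [SMul A X] [NormedAddCommGroup X] [NormedSpace ℂ X] [CStarModule A X] [CompleteSpace X]
  {D : X →ₗ.[ℂ] X} {H : Adjointable A X}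

theorem one_sub_mul_I_ne_zero (η t : ℝ) : (1 : ℂ) - I * η * t ≠ 0 := fun h => by
  simpa using congrArg Complex.re h

theorem one_le_norm_one_sub (η t : ℝ) : 1 ≤ ‖(1 : ℂ) - I * η * t‖ := by
  simpa using Complex.abs_re_le_norm ((1 : ℂ) - I * η * t)

theorem isC0_inv_one_sub {η : ℝ} (hη : 0 < η) : IsC0 fun t : ℝ => ((1 : ℂ) - I * η * t)⁻¹ := by
  refine IsC0.of_norm_le (Continuous.inv₀ (by fun_prop) (one_sub_mul_I_ne_zero η)) (1 / η)
    fun t => ?_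
  rw [norm_inv, inv_mul_le_iff₀ (norm_pos_iff.2 (one_sub_mul_I_ne_zero η t)), mul_one_div,
    le_div_iff₀ hη]
  have := Complex.abs_im_le_norm ((1 : ℂ) - I * η * t)
  have e : ((1 : ℂ) - I * η * t).im = -(η * t) := by simp
  rw [e, abs_neg, abs_mul, abs_of_pos hη] at this
  linarith

theorem isC0_yosida {η : ℝ} (hη : 0 < η) : IsC0 fun t : ℝ => ((t / (1 + η ^ 2 * t ^ 2) : ℝ) : ℂ) := by
  have hne : ∀ t : ℝ, (1 + η ^ 2 * t ^ 2) ≠ 0 := fun t => by positivity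
  refine IsC0.of_norm_le (Complex.continuous_ofReal.comp (by fun_prop (disch := exact hne _)))
    (1 / η ^ 2) fun t => ?_
  have hp : 0 < 1 + η ^ 2 * t ^ 2 := by positivity
  rw [Complex.norm_real, Real.norm_eq_abs, abs_div, abs_of_pos hp, div_mul_eq_mul_div,
    div_le_div_iff₀ hp (by positivity), abs_mul_abs_self]
  nlinarith

/-- The bounded substitute `t/(1 + η²t²)` for `t` is the imaginary part of `(1 - iηt)⁻¹` divided by
`η`, so its commutator with `H` is controlled by resolvent commutators. -/
theorem yosida_eq {η : ℝ} (hη : 0 < η) (t : ℝ) :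
    ((t / (1 + η ^ 2 * t ^ 2) : ℝ) : ℂ)
      = (2 * I * η)⁻¹ * (((1 : ℂ) - I * η * t)⁻¹ - star ((1 : ℂ) - I * η * t)⁻¹) := by
  have h1 := one_sub_mul_I_ne_zero η t
  have h2 : (1 : ℂ) + I * η * t ≠ 0 := by simpa using one_sub_mul_I_ne_zero (-η) t
  have h3 : (1 : ℂ) + η ^ 2 * t ^ 2 = (1 - I * η * t) * (1 + I * η * t) := by
    ring_nf; rw [I_sq]; ring
  have h4 : star ((1 : ℂ) - I * η * t)⁻¹ = ((1 : ℂ) + I * η * t)⁻¹ := by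
    simp
  have h5 : (η : ℂ) ≠ 0 := by exact_mod_cast hη.ne'
  rw [h4]
  push_cast
  rw [h3, inv_sub_inv h1 h2]
  have h6 : (1 : ℂ) + I * η * t - (1 - I * η * t) = 2 * I * η * t := by ring
  have h7 : (2 * I * η : ℂ) ≠ 0 := mul_ne_zero (mul_ne_zero two_ne_zero I_ne_zero) h5
  rw [h6, mul_div_assoc, ← mul_assoc, inv_mul_cancel₀ h7, one_mul]

namespace IsSelfAdjointRegular

/-- Apply the resolvent to `(D + i)HR = H + d(H)R`, where `R = (D + i)⁻¹`. This encodes the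
Lipschitz condition by bounded operators only. -/
theorem mul_resolvent_eq (hD : IsSelfAdjointRegular A D) (hH : IsLipschitz D H) :
    H * hD.resolvent = hD.resolvent * (H + hH.deriv * hD.resolvent) := by
  refine Adjointable.ext' fun y => ?_
  obtain ⟨x, rfl⟩ := hD.surj_add y
  have h := hD.resolvent_apply ⟨H.op x, hH.choose x⟩
  have h1 := hH.deriv_spec x
  simp only [Adjointable.op_mul, Adjointable.op_add, hD.resolvent_apply]
  have h2 : H.op (D x + I • (x : X)) + hH.deriv.op x
      = D ⟨H.op x, hH.choose x⟩ + I • H.op x := by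
    rw [← h1, map_add, _root_.map_smul]; abel
  rw [h2]
  exact h.symm

theorem mul_left_cancel_resolvent (hD : IsSelfAdjointRegular A D) {S : Adjointable A X}
    (h : hD.resolvent * S = 0) : S = 0 := by
  refine Adjointable.ext' fun y => ?_
  have h1 : hD.resolvent.op (S.op y) = 0 := congrArg (fun T : Adjointable A X => T.op y) h
  have h2 := hD.apply_resolvent (S.op y)
  have h3 : D ⟨hD.resolvent.op (S.op y), hD.resolvent_mem (S.op y)⟩ = 0 := by
    have : (⟨hD.resolvent.op (S.op y), hD.resolvent_mem (S.op y)⟩ : D.domain) = 0 := Subtype.ext h1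
    rw [this, D.map_zero]
  rw [h3, h1, smul_zero, add_zero] at h2
  exact h2.symm

theorem dense_range_resolvent (hD : IsSelfAdjointRegular A D) :
    Dense (Set.range fun x => hD.resolvent.op x) :=
  hD.dense.mono fun x hx => ⟨_, hD.resolvent_apply ⟨x, hx⟩⟩

/-- `[(1 - iηD)⁻¹, H] = iη (1 - iηD)⁻¹ d(H) (1 - iηD)⁻¹`. -/
theorem commutator_inv_one_sub (hD : IsSelfAdjointRegular A D) (hH : IsLipschitz D H) {η : ℝ}
    (hη : 0 < η) :
    hD.fc (fun t => ((1 : ℂ) - I * η * t)⁻¹) * H - H * hD.fc (fun t => ((1 : ℂ) - I * η * t)⁻¹)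
      = (I * η : ℂ) • (hD.fc (fun t => ((1 : ℂ) - I * η * t)⁻¹) * hH.deriv
        * hD.fc (fun t => ((1 : ℂ) - I * η * t)⁻¹)) := by
  have hf := isC0_inv_one_sub hη
  -- From `1 - iηt = (1 - η) - iη(t + i)` comes a relation between the two resolvents that involves
  -- only bounded functions of `D`.
  have key : hD.fc (fun t => ((t : ℂ) + I)⁻¹)
      = hD.fc fun t => (1 - η : ℂ) * (((t : ℂ) + I)⁻¹ * ((1 : ℂ) - I * η * t)⁻¹)
        - (I * η) * ((1 : ℂ) - I * η * t)⁻¹ := by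
    congr 1
    funext t
    have h1 := one_sub_mul_I_ne_zero η t
    have h2 : (t : ℂ) + I ≠ 0 := fun h => by simpa using congrArg Complex.im h
    have h3 : (1 - η : ℂ) * ((t : ℂ) + I)⁻¹ - I * η
        = ((1 : ℂ) - I * η * t) * ((t : ℂ) + I)⁻¹ := by
      field_simp
      ring_nf
      rw [I_sq]
      ring
    rw [← mul_assoc, ← sub_mul, h3, mul_right_comm, mul_inv_cancel₀ h1, one_mul]
  rw [hD.fc_sub ((isC0_inv_add_I.mul hf).const_mul _) (hf.const_mul _),
    hD.fc_const_mul _ (isC0_inv_add_I.mul hf), hD.fc_const_mul _ hf,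
    hD.fc_mul isC0_inv_add_I hf, hD.fc_inv_add_I] at key
  have hcomm : hD.fc (fun t => ((1 : ℂ) - I * η * t)⁻¹) * hD.resolvent
      = hD.resolvent * hD.fc (fun t => ((1 : ℂ) - I * η * t)⁻¹) := by
    rw [← hD.fc_inv_add_I]; exact hD.fc_commute hf isC0_inv_add_I
  have hRH := hD.mul_resolvent_eq hH
  set R := hD.resolvent
  set r := hD.fc (fun t => ((1 : ℂ) - I * η * t)⁻¹)
  set d := hH.deriv
  rw [← sub_eq_zero]
  refine hD.mul_left_cancel_resolvent ?_
  set z : ℂ := I * η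
  set u : ℂ := 1 - η
  -- The operator `u R - z` is `(1 - iηD)R`, a bounded stand-in for `1 - iηD` that `r` inverts up to
  -- the factor `R`.
  have k1 : r * (u • R - z • 1) = R := by
    conv_rhs => rw [key]
    rw [mul_sub, mul_smul_comm, mul_smul_comm, mul_one, hcomm]
  have k1' : (u • R - z • 1) * r = R := by
    conv_rhs => rw [key]
    rw [sub_mul, smul_mul_assoc, smul_mul_assoc, one_mul]
  have k2 : (u • R - z • 1) * (r * H - H * r) = z • (R * d * r) := by
    have e1 : (u • R - z • 1) * (r * H - H * r)
        = ((u • R - z • 1) * r) * H - H * ((u • R - z • 1) * r)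
          - u • ((R * H - H * R) * r) := by
      simp only [mul_sub, sub_mul, smul_mul_assoc, mul_smul_comm, one_mul, smul_sub, mul_assoc]
      abel
    have e2 : R * H - H * R = -(R * d * R) := by
      rw [hRH, mul_add]; simp only [mul_assoc]; abel
    have e3 : u • (R * d * R * r) = R * d * R + z • (R * d * r) := by
      have : R * d * R = u • (R * d * (R * r)) - z • (R * d * r) :=
        (congrArg (R * d * ·) key).trans (by simp only [mul_sub, mul_smul_comm])
      rw [mul_assoc (R * d) R r]
      exact eq_add_of_sub_eq this.symm
    rw [e1, k1', e2, neg_mul, smul_neg, e3]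
    abel
  -- The wanted identity is obtained after multiplication by `R` on the left. `R` is injective, so
  -- it can be cancelled.
  have k3 : R * (r * H - H * r) = r * (z • (R * d * r)) := by
    rw [← k2, ← mul_assoc, k1]
  change R * _ = 0
  rw [mul_sub, k3, mul_smul_comm, mul_smul_comm, ← mul_assoc, ← mul_assoc, hcomm]
  simp only [mul_assoc, sub_self]

/-- The commutators of `H` with `(1 - iηD)⁻¹` and with its adjoint have norm at most `η‖d(H)‖` each,
the second by taking adjoints since `H` is selfadjoint. The prefactor `1/(2η)` absorbs both, leaving
a bound independent of `η`. -/
theorem norm_commutator_yosida_le (hD : IsSelfAdjointRegular A D) (hH : IsLipschitz D H)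
    (hHs : IsSelfAdjoint H) {η : ℝ} (hη : 0 < η) :
    ‖hD.fc (fun t => ((t / (1 + η ^ 2 * t ^ 2) : ℝ) : ℂ)) * H
      - H * hD.fc (fun t => ((t / (1 + η ^ 2 * t ^ 2) : ℝ) : ℂ))‖ ≤ ‖hH.deriv‖ := by
  have hf := isC0_inv_one_sub hη
  have hfs : IsC0 fun t : ℝ => star ((1 : ℂ) - I * η * t)⁻¹ :=
    ⟨hf.1.star, by simpa using hf.2.star⟩
  have hc := hD.commutator_inv_one_sub hH hη
  have e : hD.fc (fun t => ((t / (1 + η ^ 2 * t ^ 2) : ℝ) : ℂ))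
      = (2 * I * η : ℂ)⁻¹ • (hD.fc (fun t => ((1 : ℂ) - I * η * t)⁻¹)
        - star (hD.fc (fun t => ((1 : ℂ) - I * η * t)⁻¹))) := by
    simp_rw [yosida_eq hη]
    rw [hD.fc_const_mul _ (hf.sub hfs), hD.fc_sub hf hfs, hD.star_fc]
  have hr : ‖hD.fc (fun t => ((1 : ℂ) - I * η * t)⁻¹)‖ ≤ 1 :=
    hD.norm_fc_le zero_le_one fun t => by
      rw [norm_inv]; exact inv_le_one_of_one_le₀ (one_le_norm_one_sub η t)
  rw [e]
  set r := hD.fc (fun t => ((1 : ℂ) - I * η * t)⁻¹)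
  have hb : ‖r * H - H * r‖ ≤ η * ‖hH.deriv‖ := by
    rw [hc, norm_smul, norm_mul, Complex.norm_I, one_mul, Complex.norm_real,
      Real.norm_of_nonneg hη.le]
    gcongr
    calc _ ≤ ‖r‖ * ‖hH.deriv‖ * ‖r‖ := (norm_mul_le _ _).trans (by gcongr; exact norm_mul_le _ _)
      _ ≤ 1 * ‖hH.deriv‖ * 1 := by gcongr
      _ = _ := by ring
  have hb' : ‖star r * H - H * star r‖ ≤ η * ‖hH.deriv‖ := by
    have : star r * H - H * star r = -star (r * H - H * r) := by
      rw [star_sub, star_mul, star_mul, hHs.star_eq]; abel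
    rwa [this, norm_neg, norm_star]
  have e2 : (2 * I * η : ℂ)⁻¹ • (r - star r) * H - H * ((2 * I * η : ℂ)⁻¹ • (r - star r))
      = (2 * I * η : ℂ)⁻¹ • ((r * H - H * r) - (star r * H - H * star r)) := by
    rw [smul_mul_assoc, mul_smul_comm, ← smul_sub, sub_mul, mul_sub]
    congr 1
    abel
  rw [e2, norm_smul, norm_inv, norm_mul, norm_mul, Complex.norm_I, Complex.norm_two, mul_one,
    Complex.norm_real, Real.norm_of_nonneg hη.le, inv_mul_le_iff₀ (by positivity)]
  refine (norm_sub_le _ _).trans ?_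
  linarith

/-- The bounded estimate for `a = g(D)`. The function `φ ∘ g` tends to `φ 0 = 1` at infinity, not to
`0`, so `φ(g(D))` is written as a continuous function of the Cayley transform rather than through
`fc`. -/
theorem norm_commutator_cfc_comp_le (hD : IsSelfAdjointRegular A D) {φ : ℝ → ℝ}
    (hφ : IsLocalizing φ) {g : ℝ → ℝ} (hg : IsC0 fun t => (g t : ℂ)) (H : Adjointable A X) :
    ‖cfc (fun μ => (φ (onCircle (fun t => (g t : ℂ)) μ).re : ℂ)) hD.cayley * H
      - H * cfc (fun μ => (φ (onCircle (fun t => (g t : ℂ)) μ).re : ℂ)) hD.cayley‖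
      ≤ localizingConst φ / 2 * ‖hD.fc (fun t => (g t : ℂ)) * H - H * hD.fc fun t => (g t : ℂ)‖ := by
  have e : (fun μ => (((onCircle (fun t => (g t : ℂ)) μ).re : ℝ) : ℂ))
      = onCircle (fun t => (g t : ℂ)) := by
    funext μ
    simp only [onCircle]
    split_ifs <;> simp
  have hα : ContinuousOn (fun μ => (((onCircle (fun t => (g t : ℂ)) μ).re : ℝ) : ℂ))
      (spectrum ℂ hD.cayley) := by
    rw [e]; exact hD.continuousOn_spectrum_cayley hg
  have := hφ.norm_commutator_cfc_le hα H
  rwa [e] at this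

end IsSelfAdjointRegular

theorem IsLocalizing.hasCompactSupport {φ : ℝ → ℝ} (hφ : IsLocalizing φ) : HasCompactSupport φ :=
  IsCompact.of_isClosed_subset isCompact_Icc (isClosed_tsupport φ) hφ.tsupport_subset

theorem abs_yosida_sub_le {η t M : ℝ} (ht : |t| ≤ M) :
    |t / (1 + η ^ 2 * t ^ 2) - t| ≤ η ^ 2 * M ^ 3 := by
  have hp : 0 < 1 + η ^ 2 * t ^ 2 := by positivity
  have e : t / (1 + η ^ 2 * t ^ 2) - t = -(η ^ 2 * t ^ 3) / (1 + η ^ 2 * t ^ 2) := by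
    field_simp; ring
  rw [e, abs_div, abs_neg, abs_mul, abs_of_pos hp, abs_pow t, abs_of_nonneg (sq_nonneg η)]
  calc η ^ 2 * |t| ^ 3 / (1 + η ^ 2 * t ^ 2) ≤ η ^ 2 * |t| ^ 3 :=
        div_le_self (by positivity) (by nlinarith [sq_nonneg (η * t)])
    _ ≤ _ := by gcongr

/-- The two cutoffs have different limits at infinity, so they are close only after weighting by the
resolvent. For `|t| ≤ 1/ε` uniform continuity of `φ` gives the bound, and beyond that the weight is
already smaller than `ε`. -/
theorem IsLocalizing.eventually_yosida_le {φ : ℝ → ℝ} (hφ : IsLocalizing φ) {ρ : ℝ} (hρ : 0 < ρ)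
    {ε : ℝ} (hε : 0 < ε) : ∀ᶠ η : ℝ in 𝓝[>] 0, ∀ t : ℝ,
      |φ (t / (1 + η ^ 2 * t ^ 2) / ρ) - φ (t / ρ)| * ‖((t : ℂ) + I)⁻¹‖ ≤ ε := by
  have hu := hφ.hasCompactSupport.uniformContinuous_of_continuous hφ.continuous
  obtain ⟨δ, hδ, hu⟩ := Metric.uniformContinuous_iff.1 hu ε hε
  set M := 1 / ε
  have h1 : Tendsto (fun η : ℝ => η ^ 2 * M ^ 3 / ρ) (𝓝[>] 0) (𝓝 0) := by
    have : Tendsto (fun η : ℝ => η ^ 2 * M ^ 3 / ρ) (𝓝 0) (𝓝 (0 ^ 2 * M ^ 3 / ρ)) :=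
      Continuous.tendsto (by fun_prop) 0
    simp only [ne_eq, OfNat.ofNat_ne_zero, not_false_eq_true, zero_pow, zero_mul, zero_div] at this
    exact this.mono_left nhdsWithin_le_nhds
  filter_upwards [h1.eventually (gt_mem_nhds hδ)] with η hη t
  have hI : ‖((t : ℂ) + I)‖ ≥ 1 := by simpa using Complex.abs_im_le_norm ((t : ℂ) + I)
  have hI' : ‖((t : ℂ) + I)‖ ≥ |t| := by simpa using Complex.abs_re_le_norm ((t : ℂ) + I)
  rw [norm_inv, mul_inv_le_iff₀ (by linarith)]
  by_cases ht : |t| ≤ M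
  · have h2 : dist (t / (1 + η ^ 2 * t ^ 2) / ρ) (t / ρ) < δ := by
      rw [Real.dist_eq, ← sub_div, abs_div, abs_of_pos hρ]
      refine lt_of_le_of_lt ?_ hη
      gcongr
      exact abs_yosida_sub_le ht
    have h3 := hu h2
    rw [Real.dist_eq] at h3
    nlinarith
  · have h4 : |φ (t / (1 + η ^ 2 * t ^ 2) / ρ) - φ (t / ρ)| ≤ 1 := by
      have a := hφ.mem_Icc (t / (1 + η ^ 2 * t ^ 2) / ρ)
      have b := hφ.mem_Icc (t / ρ)
      rw [abs_le]
      constructor <;> linarith [a.1, a.2, b.1, b.2]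
    have h5 : 1 ≤ ε * |t| := by
      have := (div_lt_iff₀' hε).1 (not_le.1 ht)
      linarith
    nlinarith

theorem isC0_cutoff {φ : ℝ → ℝ} (hφ : IsLocalizing φ) {ρ : ℝ} (hρ : 0 < ρ) :
    IsC0 fun t : ℝ => (φ (t / ρ) : ℂ) :=
  IsC0.of_hasCompactSupport (IsSelfAdjointRegular.continuous_cutoff hφ ρ)
    (IsSelfAdjointRegular.hasCompactSupport_cutoff hφ hρ)

namespace IsSelfAdjointRegular

/-- The commutator estimate `‖[Φ_ρ, H]‖ ≤ c_φ ‖d(H)‖ / (2ρ)`. -/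
theorem norm_commutator_cutoff_le (hD : IsSelfAdjointRegular A D) (hH : IsLipschitz D H)
    (hHs : IsSelfAdjoint H) {φ : ℝ → ℝ} (hφ : IsLocalizing φ) {ρ : ℝ} (hρ : 0 < ρ) :
    ‖hD.cutoff φ ρ * H - H * hD.cutoff φ ρ‖ ≤ localizingConst φ / 2 / ρ * ‖hH.deriv‖ := by
  set g : ℝ → ℝ → ℝ := fun η t => t / (1 + η ^ 2 * t ^ 2) / ρ with hg
  have hge : ∀ η, (fun t => (g η t : ℂ))
      = fun t : ℝ => ((ρ⁻¹ : ℝ) : ℂ) * ((t / (1 + η ^ 2 * t ^ 2) : ℝ) : ℂ) := fun η => by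
    funext t
    rw [← Complex.ofReal_mul, mul_comm, ← div_eq_mul_inv]
  have hgc : ∀ η, 0 < η → IsC0 fun t => (g η t : ℂ) := fun η hη => by
    rw [hge]; exact (isC0_yosida hη).const_mul _
  set W : ℝ → Adjointable A X :=
    fun η => cfc (fun μ => (φ (onCircle (fun t => (g η t : ℂ)) μ).re : ℂ)) hD.cayley with hW
  have hφ0 : 0 ≤ localizingConst φ := by
    rw [localizingConst]
    have : 0 ≤ ∫ p : ℝ, ‖(p : ℂ) * unitaryFourier φ p‖ :=
      MeasureTheory.integral_nonneg fun p => norm_nonneg _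
    positivity
  have hWb : ∀ η, 0 < η → ‖W η * H - H * W η‖ ≤ localizingConst φ / 2 / ρ * ‖hH.deriv‖ := by
    intro η hη
    refine (hD.norm_commutator_cfc_comp_le hφ (hgc η hη) H).trans ?_
    rw [hge, hD.fc_const_mul _ (isC0_yosida hη), smul_mul_assoc, mul_smul_comm, ← smul_sub,
      norm_smul, Complex.norm_real, Real.norm_of_nonneg (by positivity), ← mul_assoc,
      ← div_eq_mul_inv]
    gcongr
    exact hD.norm_commutator_yosida_le hH hHs hη
  -- In general `W η` does not converge to `Φ_ρ` in norm; multiplication by the resolvent suppresses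
  -- the discrepancy at infinity.
  have hWR : Tendsto (fun η => W η * hD.resolvent) (𝓝[>] 0) (𝓝 (hD.cutoff φ ρ * hD.resolvent)) := by
    rw [Metric.tendsto_nhds]
    intro ε hε
    filter_upwards [hφ.eventually_yosida_le hρ (half_pos hε), self_mem_nhdsWithin] with η h hη
    have c1 : ContinuousOn (fun μ => (φ (onCircle (fun t => (g η t : ℂ)) μ).re : ℂ))
        (spectrum ℂ hD.cayley) :=
      (Complex.continuous_ofReal.comp (hφ.continuous.comp Complex.continuous_re)).comp_continuousOn
        (hD.continuousOn_spectrum_cayley (hgc η hη))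
    have c2 := hD.continuousOn_spectrum_cayley (isC0_cutoff hφ hρ)
    have c3 := hD.continuousOn_spectrum_cayley isC0_inv_add_I
    have c4 : ContinuousOn (fun μ => (φ (onCircle (fun t => (g η t : ℂ)) μ).re : ℂ)
        - onCircle (fun t => (φ (t / ρ) : ℂ)) μ) (spectrum ℂ hD.cayley) := c1.sub c2
    rw [dist_eq_norm, ← sub_mul, ← hD.fc_inv_add_I, cutoff, fc, fc, hW, ← cfc_sub _ _ _ c1 c2,
      ← cfc_mul _ _ _ c4 c3]
    refine lt_of_le_of_lt (norm_cfc_le (half_pos hε).le fun μ _ => ?_) (half_lt_self hε)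
    simp only [onCircle]
    split_ifs
    · rw [mul_zero, norm_zero]; exact (half_pos hε).le
    · rw [norm_mul, Complex.ofReal_re, ← Complex.ofReal_sub, Complex.norm_real, Real.norm_eq_abs]
      exact h _
  have hlim : Tendsto (fun η => (W η * H - H * W η) * hD.resolvent) (𝓝[>] 0)
      (𝓝 ((hD.cutoff φ ρ * H - H * hD.cutoff φ ρ) * hD.resolvent)) := by
    -- Moving the resolvent to the left of `H` makes it stand next to `S` in both terms, so `hWR`
    -- applies to each.
    have e : ∀ S : Adjointable A X, (S * H - H * S) * hD.resolvent
        = S * hD.resolvent * (H + hH.deriv * hD.resolvent) - H * (S * hD.resolvent) := fun S => by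
      rw [sub_mul, mul_assoc S H, hD.mul_resolvent_eq hH, mul_assoc, mul_assoc]
    simp_rw [e]
    exact (hWR.mul_const _).sub (hWR.const_mul _)
  have hC : 0 ≤ localizingConst φ / 2 / ρ * ‖hH.deriv‖ := by positivity
  set S := hD.cutoff φ ρ * H - H * hD.cutoff φ ρ
  rw [Adjointable.norm_def]
  refine ContinuousLinearMap.opNorm_le_bound _ hC fun x => ?_
  have hclosed : IsClosed {x | ‖S.op x‖ ≤ localizingConst φ / 2 / ρ * ‖hH.deriv‖ * ‖x‖} :=
    isClosed_le (by fun_prop) (by fun_prop)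
  -- The limit is available on the range of the resolvent only. This range is dense and the norm
  -- bound is a closed condition.
  refine hclosed.closure_subset_iff.2 ?_ (hD.dense_range_resolvent x)
  rintro _ ⟨y, rfl⟩
  have hl : Tendsto (fun η => ((W η * H - H * W η) * hD.resolvent).op y) (𝓝[>] 0)
      (𝓝 ((S * hD.resolvent).op y)) := by
    have hcont : Continuous fun T : Adjointable A X => T.op y :=
      (ContinuousLinearMap.apply ℂ X y).continuous.comp continuous_subtype_val
    exact (hcont.tendsto _).comp hlim
  refine le_of_tendsto hl.norm ?_
  filter_upwards [self_mem_nhdsWithin] with η hη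
  refine ((W η * H - H * W η).op.le_opNorm _).trans ?_
  exact mul_le_mul_of_nonneg_right (hWb η hη) (norm_nonneg _)

end IsSelfAdjointRegular

end UnboundedCommutator

/-! ### Lower bound for the square of the localizer -/

section LowerBound

variable {L : Type*} [CStarAlgebra L]

/-- The cross terms of `a` and `S` vanish because `aS = Sa = 0`. Those of `B` and `Sγ` cancel
because `γ` anticommutes with `B` while `S` commutes with it. Only the commutator of `a` and `B`
survives. -/
theorem localizer_sq {a B S γ : L} (κ : ℝ) (hγ : γ * γ = 1) (hγa : γ * a = a * γ)
    (hγB : γ * B = -(B * γ)) (hγS : γ * S = S * γ) (haS : a * S = 0) (hSa : S * a = 0)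
    (hSB : S * B = B * S) :
    (γ * a + (κ : ℂ) • B - S * γ) * (γ * a + (κ : ℂ) • B - S * γ)
      = a * a + (κ : ℂ) • (γ * (a * B - B * a)) + (κ ^ 2 : ℂ) • (B * B) + S * S := by
  have e1 : γ * a * (γ * a) = a * a := by
    rw [mul_assoc, ← mul_assoc a, ← hγa, mul_assoc γ a a, ← mul_assoc γ γ, hγ, one_mul]
  have e2 : B * (γ * a) = -(γ * (B * a)) := by
    rw [← mul_assoc, ← mul_assoc, hγB, neg_mul, neg_neg]
  have e3 : γ * a * (S * γ) = 0 := by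
    rw [mul_assoc, ← mul_assoc a, haS, zero_mul, mul_zero]
  have e4 : S * γ * (γ * a) = 0 := by
    rw [mul_assoc, ← mul_assoc γ, hγ, one_mul, hSa]
  have e5 : S * γ * B = -(B * (S * γ)) := by
    rw [mul_assoc, hγB, mul_neg, ← mul_assoc, hSB, mul_assoc]
  have e6 : S * γ * (S * γ) = S * S := by
    rw [mul_assoc, ← mul_assoc γ, hγS, mul_assoc S, hγ, mul_one]
  simp only [mul_sub, mul_add, sub_mul, add_mul, smul_mul_assoc, mul_smul_comm, e1, e2, e3, e4, e5,
    e6, ← mul_assoc γ a B, smul_add, smul_sub, smul_neg]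
  rw [smul_smul, ← sq (κ : ℂ)]
  abel

/-- Two exchanges of a `P` with an `H`, each costing `‖H‖‖[P, H]‖`. This is the price of replacing
`(PHP)²` by `P²H²P²`. -/
theorem norm_two_sided_commutator_le {P H : L} (hP1 : ‖P‖ ≤ 1) :
    ‖H * P * P * H - P * H * H * P‖ ≤ 2 * ‖H‖ * ‖P * H - H * P‖ := by
  have e : H * P * P * H - P * H * H * P
      = H * P * (P * H - H * P) - (P * H - H * P) * H * P := by noncomm_ring
  rw [e]
  calc _ ≤ ‖H‖ * ‖P‖ * ‖P * H - H * P‖ + ‖P * H - H * P‖ * ‖H‖ * ‖P‖ :=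
        (norm_sub_le _ _).trans (add_le_add
          ((norm_mul_le _ _).trans (by gcongr; exact norm_mul_le _ _))
          ((norm_mul_le _ _).trans (by gcongr; exact norm_mul_le _ _)))
    _ ≤ ‖H‖ * 1 * ‖P * H - H * P‖ + ‖P * H - H * P‖ * ‖H‖ * 1 := by gcongr
    _ = _ := by ring

variable [PartialOrder L] [StarOrderedRing L]

/-- `E` itself need not be selfadjoint. Since `PEP` is, `E` may be replaced by its real part, which
is at least `-C`; conjugation by `P` then preserves the inequality. -/
theorem neg_smul_sq_le_of_isSelfAdjoint {P E : L} (hP : IsSelfAdjoint P)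
    (hx : IsSelfAdjoint (P * E * P)) {C : ℝ} (hE : ‖E‖ ≤ C) : -(C • (P * P)) ≤ P * E * P := by
  set F : L := (2⁻¹ : ℝ) • (E + star E) with hF
  have hFs : IsSelfAdjoint F := by
    rw [IsSelfAdjoint, hF, star_smul, star_add, star_star, add_comm]
    simp
  have e : P * E * P = P * F * P := by
    have h1 : P * star E * P = P * E * P := by
      have := hx.star_eq
      rw [star_mul, star_mul, hP.star_eq, ← mul_assoc] at this
      exact this
    rw [hF, mul_smul_comm, smul_mul_assoc, mul_add, add_mul, h1, ← two_smul ℝ (P * E * P),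
      smul_smul]
    norm_num
  have hFn : ‖F‖ ≤ C := by
    rw [hF, norm_smul]
    have := norm_add_le E (star E)
    rw [norm_star] at this
    simp only [norm_inv, Real.norm_ofNat]
    linarith
  have h2 : -(algebraMap ℝ L C) ≤ F := by
    refine le_trans ?_ hFs.neg_algebraMap_norm_le_self
    rw [neg_le_neg_iff]
    exact algebraMap_mono L hFn
  have h3 := star_left_conjugate_le_conjugate h2 P
  rw [hP.star_eq, Algebra.algebraMap_eq_smul_one] at h3
  rw [e]
  refine le_trans (le_of_eq ?_) h3
  simp

/-- Conjugate `H⁻² ≤ ‖H⁻¹‖²` by `H`. -/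
theorem inv_norm_inverse_sq_smul_one_le {H : L} (hH : IsSelfAdjoint H) (hu : IsUnit H) :
    ((‖Ring.inverse H‖⁻¹) ^ 2) • (1 : L) ≤ H * H := by
  rcases subsingleton_or_nontrivial L with _ | _
  · exact (Subsingleton.elim _ _).le
  have h1 : star (Ring.inverse H) * Ring.inverse H ≤ algebraMap ℝ L (‖Ring.inverse H‖ ^ 2) :=
    CStarAlgebra.star_mul_le_algebraMap_norm_sq
  have h2 := star_left_conjugate_le_conjugate h1 H
  have hs : star (Ring.inverse H) = Ring.inverse H := by
    rw [← Ring.inverse_star, hH.star_eq]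
  have e : star H * (star (Ring.inverse H) * Ring.inverse H) * H = 1 := by
    rw [hs, hH.star_eq, ← mul_assoc, Ring.mul_inverse_cancel _ hu, one_mul,
      Ring.inverse_mul_cancel _ hu]
  rw [e, hH.star_eq, Algebra.algebraMap_eq_smul_one, mul_smul_comm, mul_one, smul_mul_assoc] at h2
  have hpos : 0 < ‖Ring.inverse H‖ := by
    rw [norm_pos_iff]
    intro h0
    have := Ring.mul_inverse_cancel _ hu
    rw [h0, mul_zero] at this
    exact zero_ne_one this
  have h3 := smul_le_smul_of_nonneg_left h2 (sq_nonneg (‖Ring.inverse H‖⁻¹))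
  rwa [smul_smul, ← mul_pow, inv_mul_cancel₀ hpos.ne', one_pow, one_smul] at h3

theorem isUnit_of_smul_one_le_sq {T : L} {δ : ℝ} (hδ : 0 < δ) (h : δ • (1 : L) ≤ T * T) :
    IsUnit T := by
  have h1 : IsUnit (T * T) := by
    refine CStarAlgebra.isUnit_of_le (δ • (1 : L)) h ⟨smul_nonneg hδ.le zero_le_one, ?_⟩
    rw [← Algebra.algebraMap_eq_smul_one]
    exact (isUnit_iff_ne_zero.2 hδ.ne').map (algebraMap ℝ L)
  exact ((Commute.refl T).isUnit_mul_iff.1 h1).1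

/-- The abstract form of the invertibility of the spectral localizer. -/
theorem isUnit_localizer {P B S γ H d : L} {κ C δ : ℝ} (hP : IsSelfAdjoint P) (hP1 : ‖P‖ ≤ 1)
    (hB : IsSelfAdjoint B) (hS : IsSelfAdjoint S) (hH : IsSelfAdjoint H) (hHu : IsUnit H)
    (hγs : IsSelfAdjoint γ) (hγ : γ * γ = 1)
    (hγP : γ * P = P * γ) (hγH : H * γ = γ * H) (hγB : γ * B = -(B * γ)) (hγS : γ * S = S * γ)
    (hPS : P * S = 0) (hSP : S * P = 0) (hSB : S * B = B * S) (hPB : P * B = B * P)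
    (hd : P * B * H * P - P * H * (P * B) = P * d * P) (hκ : 0 < κ) (hδ : 0 < δ)
    (hC : 2 * ‖H‖ * ‖P * H - H * P‖ + κ * ‖d‖ ≤ C)
    (hlow : δ • (1 : L) ≤ ((‖Ring.inverse H‖⁻¹) ^ 2) • (P * P * (P * P)) - C • (P * P)
      + (κ ^ 2) • (B * B) + S * S) :
    IsUnit (P * γ * H * P + (κ : ℂ) • B - S * γ) := by
  set a := P * H * P with ha
  have hγa : γ * a = a * γ := by
    rw [ha, mul_assoc, mul_assoc, ← mul_assoc γ, hγP, mul_assoc, ← mul_assoc γ H, ← hγH, mul_assoc,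
      hγP]
    simp only [mul_assoc]
  have e0 : P * γ * H * P = γ * a := by rw [ha, ← hγP]; simp only [mul_assoc]
  have haS : a * S = 0 := by rw [ha, mul_assoc, hPS, mul_zero]
  have hSa : S * a = 0 := by rw [ha, ← mul_assoc, ← mul_assoc, hSP, zero_mul, zero_mul]
  have hsq := localizer_sq κ hγ hγa hγB hγS haS hSa hSB
  -- The whole error, sandwiched between two factors `P`: one part from `(PHP)² - P²H²P²`, one from
  -- `κγ[PHP, B]`. The sandwich matters, as the error is then charged against `P²` and not against
  -- `1`.
  set E : L := (H * P * P * H - P * H * H * P) - (κ : ℂ) • (γ * d) with hE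
  have hcomm : γ * (a * B - B * a) = -(P * (γ * d) * P) := by
    have h1 : B * a - a * B = P * d * P := by
      rw [← hd, ha, mul_assoc _ P B]
      simp only [← mul_assoc, hPB]
    rw [← neg_sub, h1, mul_neg, ← mul_assoc P, ← hγP]
    simp only [mul_assoc]
  have hsq' : (γ * a + (κ : ℂ) • B - S * γ) * (γ * a + (κ : ℂ) • B - S * γ)
      = P * P * (H * H) * (P * P) + P * E * P + (κ ^ 2 : ℝ) • (B * B) + S * S := by
    rw [hsq, hcomm, hE]
    have h2 : (κ ^ 2 : ℂ) • (B * B) = (κ ^ 2 : ℝ) • (B * B) := by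
      rw [← Complex.coe_smul]; push_cast; rfl
    rw [h2, ha]
    congr 2
    simp only [mul_sub, sub_mul, mul_smul_comm, smul_mul_assoc, mul_assoc, smul_neg]
    abel
  have hn : ‖γ‖ ≤ 1 := by
    have : ‖γ‖ * ‖γ‖ = ‖(1 : L)‖ := by
      rw [← hγ, ← CStarRing.norm_star_mul_self, hγs.star_eq]
    rcases subsingleton_or_nontrivial L with _ | _
    · rw [Subsingleton.elim γ 0, norm_zero]; exact zero_le_one
    · rw [CStarRing.norm_one] at this
      nlinarith [norm_nonneg γ]
  have hEn : ‖E‖ ≤ C := by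
    refine (norm_sub_le _ _).trans (le_trans (add_le_add (norm_two_sided_commutator_le hP1) ?_) hC)
    rw [norm_smul, Complex.norm_real, Real.norm_of_nonneg hκ.le]
    gcongr
    exact (norm_mul_le _ _).trans (mul_le_of_le_one_left (norm_nonneg _) hn)
  have has : IsSelfAdjoint a := by
    rw [IsSelfAdjoint, ha, star_mul, star_mul, hP.star_eq, hH.star_eq, mul_assoc]
  have hLs : IsSelfAdjoint (γ * a + (κ : ℂ) • B - S * γ) := by
    rw [IsSelfAdjoint, star_sub, star_add, star_mul γ, star_mul S, star_smul, hγs.star_eq,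
      has.star_eq, hB.star_eq, hS.star_eq, hγa, hγS]
    simp
  have hPHP : IsSelfAdjoint (P * P * (H * H) * (P * P)) := by
    simp only [IsSelfAdjoint, star_mul, hP.star_eq, hH.star_eq, mul_assoc]
  -- Selfadjointness is inherited from `L²` and the remaining terms, of which `PEP` is the
  -- difference.
  have hPE : IsSelfAdjoint (P * E * P) := by
    have : P * E * P = (γ * a + (κ : ℂ) • B - S * γ) * (γ * a + (κ : ℂ) • B - S * γ)
        - P * P * (H * H) * (P * P) - (κ ^ 2 : ℝ) • (B * B) - S * S := by
      rw [hsq']; abel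
    rw [this]
    have hsqs : ∀ {T : L}, IsSelfAdjoint T → IsSelfAdjoint (T * T) := fun hT => by
      rw [IsSelfAdjoint, star_mul, hT.star_eq]
    exact (((hsqs hLs).sub hPHP).sub ((IsSelfAdjoint.all _).smul (hsqs hB))).sub (hsqs hS)
  rw [e0]
  refine isUnit_of_smul_one_le_sq hδ (hlow.trans ?_)
  rw [hsq', sub_eq_add_neg]
  have hPP : IsSelfAdjoint (P * P) := by rw [IsSelfAdjoint, star_mul, hP.star_eq]
  have h3 := star_left_conjugate_le_conjugate (inv_norm_inverse_sq_smul_one_le hH hHu) (P * P)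
  rw [hPP.star_eq, mul_smul_comm, mul_one, smul_mul_assoc] at h3
  have h4 := neg_smul_sq_le_of_isSelfAdjoint hP hPE hEn
  gcongr

end LowerBound

/-! ### Pointwise estimates and the square root in the localizer -/

section Localizer

theorem IsC0.ofReal_of_hasCompactSupport {f : ℝ → ℝ} (hf : Continuous f)
    (hc : HasCompactSupport f) : IsC0 fun t => (f t : ℂ) :=
  IsC0.of_hasCompactSupport (Complex.continuous_ofReal.comp hf)
    (hc.comp_left (g := fun x : ℝ => (x : ℂ)) Complex.ofReal_zero)

/-- The function `1 - (1 - x⁴)^{1/2}`. -/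
noncomputable def sqrtDefect (x : ℝ) : ℝ := 1 - √(1 - x ^ 4)

theorem sqrtDefect_zero : sqrtDefect 0 = 0 := by simp [sqrtDefect]

theorem sqrtDefect_one : sqrtDefect 1 = 1 := by simp [sqrtDefect]

theorem continuous_sqrtDefect : Continuous sqrtDefect := by
  unfold sqrtDefect; fun_prop

theorem sqrtDefect_le_one (x : ℝ) : sqrtDefect x ≤ 1 := by
  rw [sqrtDefect]; linarith [Real.sqrt_nonneg (1 - x ^ 4)]

theorem one_sub_sqrtDefect_sq {x : ℝ} (hx : x ∈ Set.Icc (0 : ℝ) 1) :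
    (1 - sqrtDefect x) * (1 - sqrtDefect x) = 1 - x ^ 4 := by
  rw [sqrtDefect, sub_sub_cancel, Real.mul_self_sqrt]
  linarith [pow_le_one₀ hx.1 hx.2 (n := 4)]

namespace IsLocalizing

variable {φ : ℝ → ℝ} (hφ : IsLocalizing φ) {ρ : ℝ}

include hφ

/-- The endpoints are included: the open set where `φ ≠ 0` lies in `[-1, 1]`, hence in its interior.
-/
theorem eq_zero_of_le_abs {x : ℝ} (hx : 1 ≤ |x|) : φ x = 0 := by
  by_contra h
  have hopen : IsOpen {x | φ x ≠ 0} := isOpen_ne_fun hφ.continuous continuous_const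
  have hsub : {x | φ x ≠ 0} ⊆ Set.Icc (-1 : ℝ) 1 := (subset_tsupport φ).trans hφ.tsupport_subset
  have hint : x ∈ interior (Set.Icc (-1 : ℝ) 1) := (interior_maximal hsub hopen) h
  rw [interior_Icc] at hint
  exact absurd (abs_lt.2 hint) (not_lt.2 hx)

theorem comp_two_mul_eq_one {t : ℝ} (hρ : 0 < ρ) (ht : |t| ≤ ρ) : φ (t / (2 * ρ)) = 1 := by
  refine hφ.eq_one _ ?_
  rw [Set.mem_Icc, ← abs_le, abs_div, abs_of_pos (by positivity : 0 < 2 * ρ),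
    div_le_iff₀ (by positivity)]
  linarith

theorem comp_div_eq_zero {t : ℝ} (hρ : 0 < ρ) (ht : ρ ≤ |t|) : φ (t / ρ) = 0 := by
  refine hφ.eq_zero_of_le_abs ?_
  rwa [abs_div, abs_of_pos hρ, le_div_iff₀ hρ, one_mul]

theorem comp_div_eq_one {t : ℝ} (hρ : 0 < ρ) (ht : |t| ≤ ρ / 2) : φ (t / ρ) = 1 := by
  refine hφ.eq_one _ ?_
  rw [Set.mem_Icc, ← abs_le, abs_div, abs_of_pos hρ, div_le_iff₀ hρ]
  linarith

/-- The reason for the second scale `2ρ`: `φ(t/ρ)` vanishes for `|t| ≥ ρ`, while `φ(t/(2ρ))` is `1`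
for `|t| ≤ ρ`. -/
theorem mul_comp_two_mul (hρ : 0 < ρ) (t : ℝ) : φ (t / ρ) * φ (t / (2 * ρ)) = φ (t / ρ) := by
  rcases le_total |t| ρ with h | h
  · rw [hφ.comp_two_mul_eq_one hρ h, mul_one]
  · rw [hφ.comp_div_eq_zero hρ h, zero_mul]

theorem mul_sqrtDefect (hρ : 0 < ρ) (t : ℝ) :
    φ (t / ρ) * sqrtDefect (φ (t / (2 * ρ))) = φ (t / ρ) := by
  rcases le_total |t| ρ with h | h
  · rw [hφ.comp_two_mul_eq_one hρ h, sqrtDefect_one, mul_one]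
  · rw [hφ.comp_div_eq_zero hρ h, zero_mul]

theorem hasCompactSupport_comp (hρ : 0 < ρ) : HasCompactSupport fun t => φ (t / ρ) := by
  refine HasCompactSupport.intro (isCompact_Icc (a := -ρ) (b := ρ)) fun t ht => ?_
  refine hφ.comp_div_eq_zero hρ ?_
  by_contra h
  exact ht (abs_le.1 (not_le.1 h).le)

theorem continuous_comp (ρ : ℝ) : Continuous fun t => φ (t / ρ) :=
  hφ.continuous.comp (continuous_id.div_const ρ)

theorem localizingConst_nonneg : 0 ≤ localizingConst φ := by
  rw [localizingConst]
  have : 0 ≤ ∫ p : ℝ, ‖(p : ℂ) * unitaryFourier φ p‖ :=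
    MeasureTheory.integral_nonneg fun p => norm_nonneg _
  positivity

/-- The pointwise lower bound behind the invertibility of the spectral localizer. -/
theorem symbol_lower_bound {κ g C : ℝ} (hκ : 0 < κ) (hρ : 0 < ρ) (hC : 0 ≤ C) (t : ℝ) :
    min (min (g ^ 2) (κ ^ 2 * ρ ^ 2 / 4) - C) (min 1 (κ ^ 2 * ρ ^ 2))
      ≤ g ^ 2 * φ (t / ρ) ^ 4 - C * φ (t / ρ) ^ 2 + κ ^ 2 * (t * φ (t / (2 * ρ)) ^ 2) ^ 2
        + (1 - φ (t / (2 * ρ)) ^ 4) := by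
  set m := min (g ^ 2) (κ ^ 2 * ρ ^ 2 / 4) with hm
  have hm1 : m ≤ g ^ 2 := min_le_left _ _
  have hm2 : m ≤ κ ^ 2 * ρ ^ 2 / 4 := min_le_right _ _
  have hκ2 : 0 < κ ^ 2 := by positivity
  -- Three regions. For `|t| ≤ ρ/2` both cutoffs are `1` and `g² - C` remains. For `ρ/2 ≤ |t| ≤ ρ`
  -- the term `κ²t² ≥ κ²ρ²/4` beats `C`, which explains the `4` in admissibility. For `|t| ≥ ρ` the
  -- cutoff at `ρ` vanishes, and with `q = φ(t/(2ρ))⁴` one is left with at least the convex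
  -- combination `q κ²ρ² + (1 - q)`.
  rcases le_total |t| ρ with h | h
  · rw [hφ.comp_two_mul_eq_one hρ h]
    refine (min_le_left _ _).trans ?_
    rcases le_total |t| (ρ / 2) with h' | h'
    · rw [hφ.comp_div_eq_one hρ h']
      have : 0 ≤ κ ^ 2 * (t * 1 ^ 2) ^ 2 := by positivity
      nlinarith
    · have ha := hφ.mem_Icc (t / ρ)
      have h1 : φ (t / ρ) ^ 2 ≤ 1 := pow_le_one₀ ha.1 ha.2
      have h2 : 0 ≤ g ^ 2 * φ (t / ρ) ^ 4 := by positivity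
      have h3 : ρ ^ 2 / 4 ≤ t ^ 2 := by
        rw [← sq_abs t]; nlinarith
      have h4 : C * φ (t / ρ) ^ 2 ≤ C := mul_le_of_le_one_right hC h1
      have h5 : κ ^ 2 * (ρ ^ 2 / 4) ≤ κ ^ 2 * t ^ 2 := by gcongr
      simp only [one_pow, mul_one, sub_self, add_zero]
      linarith
  · rw [hφ.comp_div_eq_zero hρ h]
    refine (min_le_right _ _).trans ?_
    have ha := hφ.mem_Icc (t / (2 * ρ))
    have h1 : φ (t / (2 * ρ)) ^ 4 ≤ 1 := pow_le_one₀ ha.1 ha.2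
    have h0 : 0 ≤ φ (t / (2 * ρ)) ^ 4 := pow_nonneg ha.1 4
    have h3 : ρ ^ 2 ≤ t ^ 2 := by
      rw [← sq_abs t]; nlinarith
    set q := φ (t / (2 * ρ)) ^ 4 with hq
    have e : (t * φ (t / (2 * ρ)) ^ 2) ^ 2 = t ^ 2 * q := by rw [hq]; ring
    rw [e]
    have h5 : κ ^ 2 * (ρ ^ 2 * q) ≤ κ ^ 2 * (t ^ 2 * q) := by gcongr
    have h6 := min_le_left 1 (κ ^ 2 * ρ ^ 2)
    have h7 := min_le_right 1 (κ ^ 2 * ρ ^ 2)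
    set n := min 1 (κ ^ 2 * ρ ^ 2)
    have h8 : n * q ≤ κ ^ 2 * ρ ^ 2 * q := by gcongr
    have h9 : n * (1 - q) ≤ 1 * (1 - q) := by gcongr
    simp only [ne_eq, OfNat.ofNat_ne_zero, not_false_eq_true, zero_pow, mul_zero, sub_zero,
      zero_add]
    linarith

end IsLocalizing

variable {A X : Type*} [NonUnitalCStarAlgebra A] [PartialOrder A] [StarOrderedRing A]
  [SMul A X] [NormedAddCommGroup X] [NormedSpace ℂ X] [CStarModule A X] [CompleteSpace X]
  {D : X →ₗ.[ℂ] X} {γ H : Adjointable A X}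

namespace IsSelfAdjointRegular

variable (hD : IsSelfAdjointRegular A D)

include hD

/-- The condition `0 ≤ c` accounts for the point `1` of the circle, where the transported function
is `0`. -/
theorem fc_le_smul_one [PartialOrder (Adjointable A X)] [StarOrderedRing (Adjointable A X)]
    {f : ℝ → ℝ} (hf : IsC0 fun t => (f t : ℂ)) {c : ℝ} (hc : 0 ≤ c) (h : ∀ t, f t ≤ c) :
    hD.fc (fun t => (f t : ℂ)) ≤ c • (1 : Adjointable A X) := by
  open scoped ComplexOrder in
  have h1 : 0 ≤ cfc (fun μ => (c : ℂ) - onCircle (fun t => (f t : ℂ)) μ) hD.cayley := by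
    refine cfc_nonneg fun μ _ => ?_
    simp only [onCircle]
    split_ifs
    · rw [sub_zero]; exact_mod_cast hc
    · rw [← Complex.ofReal_sub]; exact_mod_cast sub_nonneg.2 (h _)
  rw [cfc_sub _ _ _ (by fun_prop) (hD.continuousOn_spectrum_cayley hf), cfc_const _ _, sub_nonneg,
    Algebra.algebraMap_eq_smul_one, Complex.coe_smul] at h1
  exact h1

theorem isSelfAdjoint_fc_ofReal (f : ℝ → ℝ) : IsSelfAdjoint (hD.fc fun t => (f t : ℂ)) :=
  hD.isSelfAdjoint_fc fun _ => Complex.conj_ofReal _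

/-- Uniqueness of the positive square root. It places `(1 - Φ⁴)^{1/2}` in the same calculus as the
cutoffs, as `1` minus a function of `D` vanishing at infinity. -/
theorem cfc_sqrt_eq {f : ℝ → ℝ} (hf : IsC0 fun t => (f t : ℂ)) (h1 : ∀ t, f t ≤ 1)
    {T : Adjointable A X}
    (hT : (1 - hD.fc fun t => (f t : ℂ)) * (1 - hD.fc fun t => (f t : ℂ)) = T) :
    cfc Real.sqrt T = 1 - hD.fc fun t => (f t : ℂ) := by
  let _ := CStarAlgebra.spectralOrder (Adjointable A X)
  let _ := CStarAlgebra.spectralOrderedRing (Adjointable A X)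
  set b := 1 - hD.fc fun t => (f t : ℂ)
  have hb : 0 ≤ b := by
    have := hD.fc_le_smul_one hf zero_le_one h1
    rw [one_smul] at this
    exact sub_nonneg.2 this
  have hbs : IsSelfAdjoint b := IsSelfAdjoint.of_nonneg hb
  have e : T = cfc (fun x : ℝ => x ^ 2) b := by
    rw [cfc_pow_id b 2, sq, hT]
  rw [e, ← cfc_comp' Real.sqrt (fun x : ℝ => x ^ 2) b]
  conv_rhs => rw [← cfc_id ℝ b]
  refine cfc_congr fun x hx => ?_
  simp only [id]
  exact Real.sqrt_sq (spectrum_nonneg_of_nonneg hb hx)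

end IsSelfAdjointRegular

end Localizer

/-! ### The localizer is selfadjoint, invertible and equal to `-γ` modulo compacts -/

section LocalizerInvertible

/-- Continuous compactly supported real functions on `ℝ`. -/
structure IsCc (f : ℝ → ℝ) : Prop where
  continuous : Continuous f
  hasCompactSupport : HasCompactSupport f

namespace IsCc

variable {f g : ℝ → ℝ}

theorem isC0 (hf : IsCc f) : IsC0 fun t => (f t : ℂ) :=
  IsC0.ofReal_of_hasCompactSupport hf.1 hf.2

theorem add (hf : IsCc f) (hg : IsCc g) : IsCc fun t => f t + g t :=
  ⟨hf.1.add hg.1, hf.2.add hg.2⟩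

theorem sub (hf : IsCc f) (hg : IsCc g) : IsCc fun t => f t - g t :=
  ⟨hf.1.sub hg.1, hf.2.sub hg.2⟩

theorem mul (hf : Continuous f) (hg : IsCc g) : IsCc fun t => f t * g t :=
  ⟨hf.mul hg.1, hg.2.mul_left⟩

theorem const_mul (c : ℝ) (hg : IsCc g) : IsCc fun t => c * g t :=
  mul continuous_const hg

theorem comp (hf : IsCc f) {ψ : ℝ → ℝ} (hψ : Continuous ψ) (h0 : ψ 0 = 0) : IsCc fun t => ψ (f t) :=
  ⟨hψ.comp hf.1, hf.2.comp_left h0⟩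

end IsCc

theorem IsLocalizing.isCc {φ : ℝ → ℝ} (hφ : IsLocalizing φ) {ρ : ℝ} (hρ : 0 < ρ) :
    IsCc fun t => φ (t / ρ) :=
  ⟨hφ.continuous_comp ρ, hφ.hasCompactSupport_comp hρ⟩

theorem IsLocalizing.isCc_sqrtDefect {φ : ℝ → ℝ} (hφ : IsLocalizing φ) {ρ : ℝ} (hρ : 0 < ρ) :
    IsCc fun t => sqrtDefect (φ (t / ρ)) :=
  (hφ.isCc hρ).comp continuous_sqrtDefect sqrtDefect_zero

theorem IsLocalizing.isCc_mul_sq {φ : ℝ → ℝ} (hφ : IsLocalizing φ) {ρ : ℝ} (hρ : 0 < ρ) :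
    IsCc fun t => t * φ (t / ρ) ^ 2 :=
  IsCc.mul continuous_id' ((hφ.isCc hρ).comp (continuous_pow 2) (by simp))

variable {A X : Type*} [NonUnitalCStarAlgebra A] [PartialOrder A] [StarOrderedRing A]
  [SMul A X] [NormedAddCommGroup X] [NormedSpace ℂ X] [CStarModule A X] [CompleteSpace X]
  {D : X →ₗ.[ℂ] X} {γ H : Adjointable A X}

namespace IsSelfAdjointRegular

/-- The functional calculus for real functions. -/
noncomputable def realFc (hD : IsSelfAdjointRegular A D) (f : ℝ → ℝ) : Adjointable A X :=
  hD.fc fun t => (f t : ℂ)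

variable (hD : IsSelfAdjointRegular A D) {f g : ℝ → ℝ}

include hD

theorem isSelfAdjoint_realFc (f : ℝ → ℝ) : IsSelfAdjoint (hD.realFc f) :=
  hD.isSelfAdjoint_fc_ofReal f

theorem realFc_add (hf : IsCc f) (hg : IsCc g) :
    hD.realFc (fun t => f t + g t) = hD.realFc f + hD.realFc g := by
  simp only [realFc, ← hD.fc_add hf.isC0 hg.isC0, Complex.ofReal_add]

theorem realFc_sub (hf : IsCc f) (hg : IsCc g) :
    hD.realFc (fun t => f t - g t) = hD.realFc f - hD.realFc g := by
  simp only [realFc, ← hD.fc_sub hf.isC0 hg.isC0, Complex.ofReal_sub]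

theorem realFc_mul (hf : IsCc f) (hg : IsCc g) :
    hD.realFc (fun t => f t * g t) = hD.realFc f * hD.realFc g := by
  simp only [realFc, ← hD.fc_mul hf.isC0 hg.isC0, Complex.ofReal_mul]

theorem realFc_const_mul (c : ℝ) (hf : IsCc f) :
    hD.realFc (fun t => c * f t) = c • hD.realFc f := by
  rw [← Complex.coe_smul]
  simp only [realFc, ← hD.fc_const_mul _ hf.isC0, Complex.ofReal_mul]

theorem realFc_commute (hf : IsCc f) (hg : IsCc g) :
    hD.realFc f * hD.realFc g = hD.realFc g * hD.realFc f := hD.fc_commute hf.isC0 hg.isC0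

theorem realFc_mem_compactOperators (hR : hD.resolvent ∈ (compactOperators A X).toSubmodule)
    (hf : IsCc f) : hD.realFc f ∈ (compactOperators A X).toSubmodule :=
  hD.fc_mem_compactOperators hR (Complex.continuous_ofReal.comp hf.1)
    (hf.2.comp_left (g := fun x : ℝ => (x : ℂ)) Complex.ofReal_zero)

theorem dCutoff_eq (φ : ℝ → ℝ) (ρ : ℝ) :
    hD.dCutoff φ ρ = hD.realFc fun t => t * φ (t / ρ) := by
  simp only [dCutoff, realFc, Complex.ofReal_mul]

/-- `fc_ψ(Φ_{2ρ})` with `ψ(x) = 1 - (1 - x⁴)^{1/2}`. -/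
noncomputable def defect (φ : ℝ → ℝ) (ρ : ℝ) : Adjointable A X :=
  hD.realFc fun t => sqrtDefect (φ (t / ρ))

variable {φ : ℝ → ℝ} (hφ : IsLocalizing φ) {ρ : ℝ} (hρ : 0 < ρ)

include hφ hρ

theorem cutoff_mul_dCutoff : hD.cutoff φ ρ * hD.dCutoff φ ρ
    = hD.realFc fun t => t * φ (t / ρ) ^ 2 := by
  rw [dCutoff_eq, cutoff, ← realFc, ← hD.realFc_mul (hφ.isCc hρ) (IsCc.mul continuous_id' (hφ.isCc hρ))]
  congr 1
  funext t
  ring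

theorem one_sub_defect_mul_self :
    (1 - hD.defect φ ρ) * (1 - hD.defect φ ρ) = 1 - hD.realFc fun t => φ (t / ρ) ^ 4 := by
  have hc := hφ.isCc_sqrtDefect hρ
  have : (fun t => φ (t / ρ) ^ 4)
      = fun t => (sqrtDefect (φ (t / ρ)) + sqrtDefect (φ (t / ρ)))
        - sqrtDefect (φ (t / ρ)) * sqrtDefect (φ (t / ρ)) := by
    funext t
    linarith [one_sub_sqrtDefect_sq (hφ.mem_Icc (t / ρ))]
  rw [this, hD.realFc_sub (hc.add hc) (IsCc.mul hc.1 hc), hD.realFc_add hc hc, hD.realFc_mul hc hc,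
    ← defect]
  noncomm_ring

theorem cutoff_pow_four : hD.cutoff φ ρ ^ 4 = hD.realFc fun t => φ (t / ρ) ^ 4 := by
  have hc := hφ.isCc hρ
  have e : (fun t => φ (t / ρ) ^ 4)
      = fun t => φ (t / ρ) * (φ (t / ρ) * (φ (t / ρ) * φ (t / ρ))) := by
    funext t; ring
  rw [e, hD.realFc_mul hc (IsCc.mul hc.1 (IsCc.mul hc.1 hc)),
    hD.realFc_mul hc (IsCc.mul hc.1 hc), hD.realFc_mul hc hc]
  change hD.realFc (fun t => φ (t / ρ)) ^ 4 = _
  noncomm_ring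

theorem cfc_sqrt_one_sub_cutoff_pow :
    cfc Real.sqrt (1 - hD.cutoff φ ρ ^ 4) = 1 - hD.defect φ ρ :=
  hD.cfc_sqrt_eq (hφ.isCc_sqrtDefect hρ).isC0 (fun _ => sqrtDefect_le_one _) (by
    rw [cutoff_pow_four hD hφ hρ]; exact one_sub_defect_mul_self hD hφ hρ)

theorem localizer_eq (γ H : Adjointable A X) (κ : ℝ) : hD.localizer γ H φ κ ρ
    = hD.cutoff φ ρ * γ * H * hD.cutoff φ ρ
      + (κ : ℂ) • (hD.realFc fun t => t * φ (t / (2 * ρ)) ^ 2)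
      - (1 - hD.defect φ (2 * ρ)) * γ := by
  have h2 : 0 < 2 * ρ := by positivity
  rw [localizer, cutoff_mul_dCutoff hD hφ h2, cfc_sqrt_one_sub_cutoff_pow hD hφ h2]

omit hφ hρ in
-- The counterpart of `apply_fc` with `D` on the right. It is checked on the range of the resolvent,
-- where `DR = 1 - iR`.
theorem fc_mul_apply_eq {φ : ℝ → ℝ} (hφ : IsCc φ) (y : D.domain) :
    (hD.realFc φ).op (D y) = (hD.realFc fun t => t * φ t).op y := by
  have hN : IsCc fun t => t * φ t := IsCc.mul continuous_id' hφ
  have e : (hD.realFc fun t => t * φ t) * hD.resolvent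
      = hD.realFc φ - I • (hD.realFc φ * hD.resolvent) := by
    rw [← hD.fc_inv_add_I, realFc, realFc, ← hD.fc_mul hN.isC0 isC0_inv_add_I,
      ← hD.fc_mul hφ.isC0 isC0_inv_add_I, ← hD.fc_const_mul I (hφ.isC0.mul isC0_inv_add_I),
      ← hD.fc_sub hφ.isC0 ((hφ.isC0.mul isC0_inv_add_I).const_mul I)]
    congr 1
    funext t
    have h2 : (t : ℂ) + I ≠ 0 := fun h => by simpa using congrArg Complex.im h
    push_cast
    field_simp
    ring
  have h1 := congrArg (fun T : Adjointable A X => T.op (D y + I • (y : X))) e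
  simp only [Adjointable.op_mul, Adjointable.op_sub, Adjointable.op_smul, hD.resolvent_apply] at h1
  rw [h1, map_add, _root_.map_smul, add_sub_cancel_right]

/-- Formally `PDHP - PHDP = P[D, H]P`. The domains fit because `P` maps into `Dom(D)` and `H`
preserves it. -/
theorem cutoff_mul_deriv_mul_cutoff (hH : IsLipschitz D H) :
    hD.dCutoff φ ρ * H * hD.cutoff φ ρ - hD.cutoff φ ρ * H * hD.dCutoff φ ρ
      = hD.cutoff φ ρ * hH.deriv * hD.cutoff φ ρ := by
  refine Adjointable.ext' fun x => ?_
  have h1 := hD.apply_cutoff hφ hρ x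
  have h2 := hH.deriv_spec ⟨(hD.cutoff φ ρ).op x, hD.cutoff_mem_domain hφ hρ x⟩
  have h3 := hD.fc_mul_apply_eq (hφ.isCc hρ)
    ⟨H.op ((hD.cutoff φ ρ).op x), hH.choose ⟨_, hD.cutoff_mem_domain hφ hρ x⟩⟩
  rw [← dCutoff_eq] at h3
  change (hD.dCutoff φ ρ).op (H.op ((hD.cutoff φ ρ).op x))
    - (hD.cutoff φ ρ).op (H.op ((hD.dCutoff φ ρ).op x))
    = (hD.cutoff φ ρ).op (hH.deriv.op ((hD.cutoff φ ρ).op x))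
  rw [← h2, h1, map_sub]
  exact congrArg (· - _) h3.symm

end IsSelfAdjointRegular

namespace IsEvenUnboundedKasparovModule

variable (hK : IsEvenUnboundedKasparovModule A γ D) {f : ℝ → ℝ}

include hK

theorem grading_mul_realFc_of_even (hf : IsCc f) (h : ∀ t, f (-t) = f t) :
    γ * hK.selfAdjointRegular.realFc f = hK.selfAdjointRegular.realFc f * γ := by
  have := hK.selfAdjointRegular.grading_mul_fc hK.grading_selfAdjoint hK.grading_sq hK.grading_mem
    hK.odd hf.isC0
  simp only [h] at this
  exact this

theorem grading_mul_realFc_of_odd (hf : IsCc f) (h : ∀ t, f (-t) = -f t) :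
    γ * hK.selfAdjointRegular.realFc f = -(hK.selfAdjointRegular.realFc f * γ) := by
  have := hK.selfAdjointRegular.grading_mul_fc hK.grading_selfAdjoint hK.grading_sq hK.grading_mem
    hK.odd hf.isC0
  simp only [h] at this
  rw [IsSelfAdjointRegular.realFc, this, ← neg_mul]
  congr 1
  have h2 := hK.selfAdjointRegular.realFc_const_mul (-1) hf
  simpa [IsSelfAdjointRegular.realFc] using h2

variable {φ : ℝ → ℝ} (hφ : IsLocalizing φ) {ρ : ℝ}

include hφ

theorem grading_mul_cutoff (hρ : 0 < ρ) : γ * hK.selfAdjointRegular.cutoff φ ρ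
    = hK.selfAdjointRegular.cutoff φ ρ * γ :=
  hK.grading_mul_realFc_of_even (hφ.isCc hρ) fun t => by rw [neg_div, hφ.even]

theorem grading_mul_defect (hρ : 0 < ρ) : γ * hK.selfAdjointRegular.defect φ ρ
    = hK.selfAdjointRegular.defect φ ρ * γ :=
  hK.grading_mul_realFc_of_even (hφ.isCc_sqrtDefect hρ)
    fun t => by rw [neg_div, hφ.even]

theorem isSelfAdjoint_localizer (hH : IsSelfAdjoint H) (hHγ : H * γ = γ * H) (hρ : 0 < ρ) (κ : ℝ) :
    IsSelfAdjoint (hK.selfAdjointRegular.localizer γ H φ κ ρ) := by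
  have h2 : 0 < 2 * ρ := by positivity
  have hP : IsSelfAdjoint (hK.selfAdjointRegular.cutoff φ ρ) :=
    hK.selfAdjointRegular.isSelfAdjoint_realFc _
  have hG : IsSelfAdjoint (hK.selfAdjointRegular.defect φ (2 * ρ)) :=
    hK.selfAdjointRegular.isSelfAdjoint_realFc _
  rw [IsSelfAdjoint, IsSelfAdjointRegular.localizer_eq _ hφ hρ]
  simp only [star_add, star_sub, star_mul, star_smul, star_one, hP.star_eq, hG.star_eq, hH.star_eq,
    hK.grading_selfAdjoint.star_eq, (hK.selfAdjointRegular.isSelfAdjoint_realFc _).star_eq]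
  congr 1
  · congr 1
    · rw [← mul_assoc H, hHγ]; simp only [mul_assoc]
    · simp
  · rw [mul_sub, sub_mul, hK.grading_mul_defect hφ h2, one_mul, mul_one]

/-- Adding `γ` removes the only non-compact part; every remaining term has a compactly supported
function of `D` as a factor. -/
theorem localizer_add_grading_mem (hρ : 0 < ρ) (κ : ℝ) :
    hK.selfAdjointRegular.localizer γ H φ κ ρ + γ ∈ (compactOperators A X).toSubmodule := by
  have h2 : 0 < 2 * ρ := by positivity
  have hR := hK.compact_resolvent
  rw [IsSelfAdjointRegular.localizer_eq _ hφ hρ]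
  have e : ∀ a b c : Adjointable A X, a + b - (1 - c) * γ + γ = a + b + c * γ := fun a b c => by
    noncomm_ring
  rw [e]
  refine Submodule.add_mem _ (Submodule.add_mem _ ?_ (Submodule.smul_mem _ _ ?_)) ?_
  · exact (compactOperators A X).mul_mem_left _
      (hK.selfAdjointRegular.realFc_mem_compactOperators hR (hφ.isCc hρ))
  · exact hK.selfAdjointRegular.realFc_mem_compactOperators hR
      (hφ.isCc_mul_sq h2)
  · exact (compactOperators A X).mul_mem_right _
      (hK.selfAdjointRegular.realFc_mem_compactOperators hR
        (hφ.isCc_sqrtDefect h2))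

theorem isUnit_localizer (hH : IsLipschitz D H) (hHs : IsSelfAdjoint H) (hHγ : H * γ = γ * H)
    (hHu : IsUnit H) {κ : ℝ} (hadm : IsAdmissible hH φ κ ρ) :
    IsUnit (hK.selfAdjointRegular.localizer γ H φ κ ρ) := by
  obtain ⟨hκ, hρ, hadm⟩ := hadm
  have h2 : 0 < 2 * ρ := by positivity
  let _ := CStarAlgebra.spectralOrder (Adjointable A X)
  let _ := CStarAlgebra.spectralOrderedRing (Adjointable A X)
  have hD := hK.selfAdjointRegular
  have hc1 := hφ.isCc hρ
  have hc2 := hφ.isCc h2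
  have hcB := hφ.isCc_mul_sq h2
  have hcG := hφ.isCc_sqrtDefect h2
  set C := (κ + localizingConst φ * ‖H‖ / ρ) * ‖hH.deriv‖ with hC_def
  set m := min ((‖Ring.inverse H‖⁻¹) ^ 2) (κ ^ 2 * ρ ^ 2 / 4) with hm
  set δ := min (m - C) (min 1 (κ ^ 2 * ρ ^ 2)) with hδ_def
  have hφ0 := hφ.localizingConst_nonneg
  have hC0 : 0 ≤ C := by positivity
  have hδ : 0 < δ := lt_min (by linarith) (lt_min one_pos (by positivity))
  have hδ1 : δ ≤ 1 := (min_le_right _ _).trans (min_le_left _ _)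
  -- `Φ_ρ · D Φ_{2ρ}² = D Φ_ρ`, so the abstract relation `hd` is the cutoff form of the commutator
  -- `[D, H]`.
  have hPB : hD.cutoff φ ρ * hD.realFc (fun t => t * φ (t / (2 * ρ)) ^ 2) = hD.dCutoff φ ρ := by
    rw [hD.dCutoff_eq, IsSelfAdjointRegular.cutoff, ← IsSelfAdjointRegular.realFc,
      ← hD.realFc_mul hc1 hcB]
    congr 1
    funext t
    have := hφ.mul_comp_two_mul hρ t
    calc _ = t * (φ (t / ρ) * φ (t / (2 * ρ)) * φ (t / (2 * ρ))) := by ring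
      _ = _ := by rw [this, this]
  have hPG : hD.cutoff φ ρ * hD.defect φ (2 * ρ) = hD.cutoff φ ρ := by
    rw [IsSelfAdjointRegular.cutoff, IsSelfAdjointRegular.defect, ← IsSelfAdjointRegular.realFc,
      ← hD.realFc_mul hc1 hcG]
    congr 1
    funext t
    exact hφ.mul_sqrtDefect hρ t
  have hPG' : hD.defect φ (2 * ρ) * hD.cutoff φ ρ = hD.cutoff φ ρ := by
    rw [IsSelfAdjointRegular.defect, IsSelfAdjointRegular.cutoff, ← IsSelfAdjointRegular.realFc,
      hD.realFc_commute hcG hc1]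
    exact hPG
  rw [IsSelfAdjointRegular.localizer_eq _ hφ hρ]
  refine _root_.isUnit_localizer (d := hH.deriv) (C := C) (δ := δ) (hD.isSelfAdjoint_realFc _)
    ?_ (hD.isSelfAdjoint_realFc _) ((IsSelfAdjoint.one _).sub (hD.isSelfAdjoint_realFc _)) hHs hHu
    hK.grading_selfAdjoint hK.grading_sq (hK.grading_mul_cutoff hφ hρ) hHγ ?_ ?_ ?_ ?_ ?_ ?_ ?_ hκ hδ
    ?_ ?_
  · refine hD.norm_fc_le zero_le_one fun t => ?_
    rw [Complex.norm_real, Real.norm_of_nonneg (hφ.mem_Icc _).1]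
    exact (hφ.mem_Icc _).2
  · refine hK.grading_mul_realFc_of_odd hcB fun t => ?_
    rw [neg_div, hφ.even, neg_mul]
  · rw [mul_sub, sub_mul, hK.grading_mul_defect hφ h2, one_mul, mul_one]
  · rw [mul_sub, hPG, mul_one, sub_self]
  · rw [sub_mul, hPG', one_mul, sub_self]
  · rw [mul_sub, sub_mul, one_mul, mul_one]
    congr 1
    exact hD.realFc_commute hcG hcB
  · exact hD.realFc_commute hc1 hcB
  · rw [hPB]
    exact hD.cutoff_mul_deriv_mul_cutoff hφ hρ hH
  -- The `2` from exchanging `P` and `H` cancels the `1/2` in the commutator estimate and gives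
  -- exactly the constant of admissibility.
  · have := hD.norm_commutator_cutoff_le hH hHs hφ hρ
    calc _ ≤ 2 * ‖H‖ * (localizingConst φ / 2 / ρ * ‖hH.deriv‖) + κ * ‖hH.deriv‖ := by gcongr
      _ = C := by rw [hC_def]; ring
  · set g := ‖Ring.inverse H‖⁻¹
    have h11 := IsCc.mul hc1.1 hc1
    have h1111 := IsCc.mul h11.1 h11
    have hBB := IsCc.mul hcB.1 hcB
    have h4 := hc2.comp (continuous_pow 4) (by simp)
    -- The symbol of the lower bound tends to `1` at infinity, so the calculus applies to `F`, which
    -- is `1` minus it and compactly supported. The bound reads `F ≤ 1 - δ`, with `δ ≤ 1` ensuring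
    -- `1 - δ ≥ 0`.
    set F : ℝ → ℝ := fun t => φ (t / (2 * ρ)) ^ 4
      - (g ^ 2 * (φ (t / ρ) * φ (t / ρ) * (φ (t / ρ) * φ (t / ρ)))
        - C * (φ (t / ρ) * φ (t / ρ))
        + κ ^ 2 * (t * φ (t / (2 * ρ)) ^ 2 * (t * φ (t / (2 * ρ)) ^ 2))) with hF
    have hinner := ((h1111.const_mul (g ^ 2)).sub (h11.const_mul C)).add (hBB.const_mul (κ ^ 2))
    have hFc : IsCc F := h4.sub hinner
    have hFle : ∀ t, F t ≤ 1 - δ := fun t => by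
      have := hφ.symbol_lower_bound (g := g) hκ hρ hC0 t
      simp only [hF]
      have e : φ (t / ρ) ^ 4 = φ (t / ρ) * φ (t / ρ) * (φ (t / ρ) * φ (t / ρ)) := by ring
      rw [e, sq (φ (t / ρ)), sq (t * φ (t / (2 * ρ)) ^ 2)] at this
      linarith
    have key := hD.fc_le_smul_one hFc.isC0 (sub_nonneg.2 hδ1) hFle
    have hFe : hD.realFc F = hD.realFc (fun t => φ (t / (2 * ρ)) ^ 4)
        - (g ^ 2 • (hD.cutoff φ ρ * hD.cutoff φ ρ * (hD.cutoff φ ρ * hD.cutoff φ ρ))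
          - C • (hD.cutoff φ ρ * hD.cutoff φ ρ)
          + κ ^ 2 • (hD.realFc (fun t => t * φ (t / (2 * ρ)) ^ 2)
            * hD.realFc (fun t => t * φ (t / (2 * ρ)) ^ 2))) := by
      rw [hF, hD.realFc_sub h4 hinner,
        hD.realFc_add ((h1111.const_mul (g ^ 2)).sub (h11.const_mul C)) (hBB.const_mul (κ ^ 2)),
        hD.realFc_sub (h1111.const_mul (g ^ 2)) (h11.const_mul C),
        hD.realFc_const_mul _ h1111, hD.realFc_const_mul _ h11, hD.realFc_const_mul _ hBB,
        hD.realFc_mul h11 h11, hD.realFc_mul hc1 hc1, hD.realFc_mul hcB hcB]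
      rfl
    rw [hD.one_sub_defect_mul_self hφ h2]
    change hD.realFc F ≤ _ at key
    rw [hFe, sub_smul, one_smul] at key
    rw [← sub_nonneg] at key ⊢
    convert! key using 1
    abel

end IsEvenUnboundedKasparovModule

end LocalizerInvertible

/-! ### Pairs `(-γ, T)` in relative K-theory -/

section RelativeKTheory

variable {L : Type*} [CStarAlgebra L] {J : CStarIdeal L}

theorem of_mem_relW_one {x : relDouble J} (hs : IsSelfAdjoint x) (hu : IsUnit x) :
    Matrix.of (fun _ _ : Fin 1 => x) ∈ relW J 1 := by
  constructor
  · refine Matrix.ext fun i j => ?_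
    exact hs
  · have e : Matrix.of (fun _ _ : Fin 1 => x) = Matrix.scalar (Fin 1) x := by
      refine Matrix.ext fun i j => ?_
      rw [Subsingleton.elim i j]
      simp
    rw [e]
    exact hu.map _

theorem neg_pair_mem_relDouble {γ T : L} (h : T + γ ∈ J.toSubmodule) : (-γ, T) ∈ relDouble J := by
  change -γ - T ∈ J.toSubmodule
  rw [← neg_mem_iff, neg_sub, sub_neg_eq_add]
  exact h

theorem isSelfAdjoint_neg_pair {γ T : L} (h : T + γ ∈ J.toSubmodule) (hγ : IsSelfAdjoint γ)
    (hT : IsSelfAdjoint T) :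
    IsSelfAdjoint (⟨(-γ, T), neg_pair_mem_relDouble h⟩ : relDouble J) := by
  refine Subtype.ext (Prod.ext ?_ ?_)
  · exact hγ.neg
  · exact hT

/-- The inverse pair must again lie in `D(L, J)`, and it does since `T⁻¹ + γ = γ(T + γ)T⁻¹`. -/
theorem isUnit_neg_pair {γ T : L} (h : T + γ ∈ J.toSubmodule) (hγ : γ * γ = 1) (hT : IsUnit T) :
    IsUnit (⟨(-γ, T), neg_pair_mem_relDouble h⟩ : relDouble J) := by
  obtain ⟨U, rfl⟩ := hT
  have h' : (↑U⁻¹ : L) + γ ∈ J.toSubmodule := by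
    have e : (↑U⁻¹ : L) + γ = γ * (↑U + γ) * ↑U⁻¹ := by
      rw [mul_add, hγ, add_mul, one_mul, mul_assoc, Units.mul_inv, mul_one, add_comm]
    rw [e]
    exact J.mul_mem_right _ (J.mul_mem_left _ h)
  have hγ' : -γ * -γ = 1 := by rw [neg_mul_neg, hγ]
  refine ⟨⟨⟨(-γ, ↑U), neg_pair_mem_relDouble h⟩, ⟨(-γ, ↑U⁻¹), neg_pair_mem_relDouble h'⟩, ?_, ?_⟩,
    rfl⟩
  · exact Subtype.ext (Prod.ext hγ' U.mul_inv)
  · exact Subtype.ext (Prod.ext hγ' U.inv_mul)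

/-- The element `(-γ, T)` of `W_1(L, J)`. -/
def negPair (J : CStarIdeal L) {γ T : L} (h : T + γ ∈ J.toSubmodule) (hγs : IsSelfAdjoint γ)
    (hγ : γ * γ = 1) (hTs : IsSelfAdjoint T) (hT : IsUnit T) : RelW J :=
  ⟨1, one_pos, Matrix.of fun _ _ => ⟨(-γ, T), neg_pair_mem_relDouble h⟩,
    of_mem_relW_one (isSelfAdjoint_neg_pair h hγs hTs) (isUnit_neg_pair h hγ hT)⟩

theorem relStabilize_zero {n : ℕ} (h : n + 0 = n) (M : Matrix (Fin n) (Fin n) (relDouble J))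
    (G : Matrix (Fin 0) (Fin 0) L) : relStabilize J h M G = M := by
  refine Matrix.ext fun i j => ?_
  have e : ∀ i : Fin n, (finSumFinEquiv.trans (finCongr h)).symm i = Sum.inl i := fun i => by
    rw [Equiv.symm_apply_eq]
    rfl
  simp only [relStabilize, Matrix.reindex_apply, Matrix.submatrix_apply, e, Matrix.fromBlocks_apply₁₁]

theorem stablyHomotopic_of_joinedIn {M N : Matrix (Fin 1) (Fin 1) (relDouble J)}
    (hM : M ∈ relW J 1) (hN : N ∈ relW J 1) (h : JoinedIn (relW J 1) M N) :
    StablyHomotopic J ⟨1, one_pos, M, hM⟩ ⟨1, one_pos, N, hN⟩ := by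
  refine ⟨1, 0, 0, rfl, rfl, 1, 1, .one _, isUnit_one, .one _, isUnit_one, ?_⟩
  rwa [relStabilize_zero, relStabilize_zero]

/-- A path in `W_1` suffices: the stabilising blocks are taken of size `0`. -/
theorem mk_negPair_eq_of_path {γ : L} {T : unitInterval → L} (hc : Continuous T)
    (h : ∀ s, T s + γ ∈ J.toSubmodule) (hγs : IsSelfAdjoint γ) (hγ : γ * γ = 1)
    (hTs : ∀ s, IsSelfAdjoint (T s)) (hT : ∀ s, IsUnit (T s)) :
    K0Inv.mk (negPair J (h 0) hγs hγ (hTs 0) (hT 0))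
      = K0Inv.mk (negPair J (h 1) hγs hγ (hTs 1) (hT 1)) := by
  refine Quot.sound (stablyHomotopic_of_joinedIn _ _ ?_)
  refine ⟨⟨⟨fun s => Matrix.of fun _ _ => ⟨(-γ, T s), neg_pair_mem_relDouble (h s)⟩, ?_⟩, rfl, rfl⟩,
    fun s => ?_⟩
  · refine continuous_matrix fun _ _ => ?_
    exact Continuous.subtype_mk (continuous_const.prodMk hc) _
  · exact of_mem_relW_one (isSelfAdjoint_neg_pair (h s) hγs (hTs s)) (isUnit_neg_pair (h s) hγ (hT s))

end RelativeKTheory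

/-! ### Norm continuity of `f(D)` in `f` and in `D` -/

section Continuity

variable {A X : Type*} [NonUnitalCStarAlgebra A] [PartialOrder A] [StarOrderedRing A]
  [SMul A X] [NormedAddCommGroup X] [NormedSpace ℂ X] [CStarModule A X] [CompleteSpace X]
  {D : X →ₗ.[ℂ] X}

namespace IsSelfAdjointRegular

/-- The supports lie in a common `[-M, M]`, where compactness turns joint continuity into uniform
convergence. -/
theorem continuous_realFc (hD : IsSelfAdjointRegular A D) {Z : Type*} [TopologicalSpace Z]
    {F : Z → ℝ → ℝ} (hF : Continuous (Function.uncurry F)) {M : ℝ}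
    (hM : ∀ z t, M ≤ |t| → F z t = 0) : Continuous fun z => hD.realFc (F z) := by
  have hFz : ∀ z, IsCc (F z) := fun z => by
    refine ⟨by fun_prop, ?_⟩
    refine HasCompactSupport.intro (isCompact_Icc (a := -M) (b := M)) fun t ht => hM z t ?_
    by_contra h
    exact ht (abs_le.1 (not_le.1 h).le)
  refine continuous_iff_continuousAt.2 fun z₀ => ?_
  refine continuousAt_cfc_fun ?_ (.of_forall fun z => hD.continuousOn_spectrum_cayley (hFz z).isC0)
  rw [Metric.tendstoUniformlyOn_iff]
  intro ε hε
  have h1 : ∀ᶠ z in 𝓝 z₀, ∀ t ∈ Set.Icc (-M) M, |F z₀ t - F z t| < ε := by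
    refine isCompact_Icc.eventually_forall_of_forall_eventually fun t _ => ?_
    have h2 : Continuous fun p : Z × ℝ => |F z₀ p.2 - F p.1 p.2| := by
      have : Continuous fun p : Z × ℝ => F z₀ p.2 := by fun_prop
      exact (this.sub hF).abs
    have h3 := h2.tendsto (z₀, t)
    simp only [sub_self, abs_zero] at h3
    exact h3.eventually (gt_mem_nhds hε)
  filter_upwards [h1] with z hz μ _
  simp only [onCircle]
  split_ifs
  · simpa using hε
  · rw [dist_eq_norm, ← Complex.ofReal_sub, Complex.norm_real, Real.norm_eq_abs]
    by_cases hμ : M ≤ |cayleyInv μ|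
    · rw [hM _ _ hμ, hM _ _ hμ]; simpa using hε
    · exact hz _ (abs_le.1 (not_le.1 hμ).le)

end IsSelfAdjointRegular

/-- The Cayley transforms vary continuously and all have spectrum in the circle, on which `f`
becomes one fixed continuous function. -/
theorem continuous_realFc_boundedPerturbation {Z : Type*} [TopologicalSpace Z]
    {T : Z → Adjointable A X} (hT : Continuous T)
    (h : ∀ z, IsSelfAdjointRegular A (boundedPerturbation D (T z))) {f : ℝ → ℝ} (hf : IsCc f) :
    Continuous fun z => (h z).realFc f := by
  have hc : Continuous fun z => (h z).cayley := by
    refine continuous_iff_continuousAt.2 fun z₀ => ?_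
    have h1 : Tendsto (fun z => 2 * ‖T z - T z₀‖) (𝓝 z₀) (𝓝 0) := by
      have : Continuous fun z => 2 * ‖T z - T z₀‖ := by fun_prop
      simpa using this.tendsto z₀
    rw [ContinuousAt, tendsto_iff_norm_sub_tendsto_zero]
    exact squeeze_zero (fun z => norm_nonneg _)
      (fun z => IsSelfAdjointRegular.norm_cayley_sub_le (h z) (h z₀)) h1
  exact Continuous.cfc' (isCompact_sphere (0 : ℂ) 1) _ hc (fun z => (h z).spectrum_cayley_subset)
    (continuousOn_onCircle hf.isC0.1 hf.isC0.2) (fun z => (h z).isStarNormal_cayley)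

end Continuity

/-! ### Existence and convexity of localizing functions -/

section LocalizingFunctions

open MeasureTheory FourierTransform

/-- A smooth compactly supported function is Schwartz, hence so is its Fourier transform, and `p
φ̂(p)` is integrable. -/
theorem isLocalizing_of_contDiff {φ : ℝ → ℝ} (h : ContDiff ℝ (⊤ : ℕ∞) φ)
    (h01 : ∀ x, φ x ∈ Set.Icc (0 : ℝ) 1) (heven : ∀ x, φ (-x) = φ x)
    (hsupp : tsupport φ ⊆ Set.Icc (-1) 1)
    (hone : ∀ x ∈ Set.Icc (-(1 / 2) : ℝ) (1 / 2), φ x = 1)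
    (hanti : ∀ x₀ x₁ : ℝ, 0 ≤ x₀ → x₀ ≤ x₁ → φ x₁ ≤ φ x₀) : IsLocalizing φ := by
  have hc : HasCompactSupport φ :=
    IsCompact.of_isClosed_subset isCompact_Icc (isClosed_tsupport φ) hsupp
  refine ⟨h.continuous, h.continuous.integrable_of_hasCompactSupport hc, h01, heven, hsupp, hone,
    hanti, ?_⟩
  have hcC : HasCompactSupport fun x => (φ x : ℂ) :=
    hc.comp_left (g := fun x : ℝ => (x : ℂ)) Complex.ofReal_zero
  have hC : ContDiff ℝ (⊤ : ℕ∞) fun x => (φ x : ℂ) := Complex.ofRealCLM.contDiff.comp h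
  let f : SchwartzMap ℝ ℂ := hcC.toSchwartzMap hC
  have hcoe : ⇑(𝓕 f : SchwartzMap ℝ ℂ) = 𝓕 (fun x => (φ x : ℂ)) := SchwartzMap.fourier_coe f
  have hi : Integrable fun q : ℝ => (q : ℂ) * 𝓕 (fun x => (φ x : ℂ)) q := by
    rw [← hcoe]
    have h1 := SchwartzMap.integrable_pow_mul volume (𝓕 f : SchwartzMap ℝ ℂ) 1
    have hm : Continuous fun q : ℝ => (q : ℂ) * (𝓕 f : SchwartzMap ℝ ℂ) q :=
      Complex.continuous_ofReal.mul (𝓕 f : SchwartzMap ℝ ℂ).continuous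
    refine h1.mono' hm.aestronglyMeasurable (.of_forall fun q => ?_)
    rw [norm_mul, Complex.norm_real, pow_one]
  have hpi : (2 * Real.pi) ≠ 0 := by positivity
  have h2 := (hi.comp_div hpi).const_mul
    ((2 * Real.pi : ℝ) * ((√(2 * Real.pi))⁻¹ : ℝ) : ℂ)
  refine h2.congr (.of_forall fun p => ?_)
  simp only [unitaryFourier_eq]
  have hpi' : (2 * Real.pi : ℂ) ≠ 0 := by exact_mod_cast hpi
  push_cast
  field_simp

theorem exists_isLocalizing : ∃ φ : ℝ → ℝ, IsLocalizing φ := by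
  -- The argument `(1 - x²)·4/3` equals `1` at `|x| = 1/2` and `0` at `|x| = 1`.
  refine ⟨fun x => Real.smoothTransition ((1 - x ^ 2) * (4 / 3)),
    isLocalizing_of_contDiff ?_ ?_ ?_ ?_ ?_ ?_⟩
  · exact Real.smoothTransition.contDiff.comp (by fun_prop)
  · exact fun x => ⟨Real.smoothTransition.nonneg _, Real.smoothTransition.le_one _⟩
  · exact fun x => by rw [neg_sq]
  · refine closure_minimal (fun x hx => ?_) isClosed_Icc
    rw [Set.mem_Icc, ← abs_le]
    by_contra h
    refine hx (Real.smoothTransition.zero_of_nonpos ?_)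
    have : 1 ≤ x ^ 2 := by rw [← sq_abs]; nlinarith [not_le.1 h]
    linarith
  · intro x hx
    refine Real.smoothTransition.one_of_one_le ?_
    have : x ^ 2 ≤ (1 / 2) ^ 2 := by
      rw [sq_le_sq, abs_of_pos (by norm_num : (0 : ℝ) < 1 / 2)]
      exact abs_le.2 hx
    linarith
  · intro x y hx hxy
    refine Real.smoothTransition.monotone ?_
    have : x ^ 2 ≤ y ^ 2 := by gcongr
    linarith

variable {φ₀ φ₁ : ℝ → ℝ}

theorem IsLocalizing.unitaryFourier_convexCombination (h₀ : IsLocalizing φ₀) (h₁ : IsLocalizing φ₁)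
    (s p : ℝ) : unitaryFourier (fun x => (1 - s) * φ₀ x + s * φ₁ x) p
      = (1 - s : ℝ) * unitaryFourier φ₀ p + (s : ℂ) * unitaryFourier φ₁ p := by
  have hint : ∀ {φ : ℝ → ℝ}, IsLocalizing φ →
      Integrable fun x : ℝ => (φ x : ℂ) * Complex.exp (-(I * x * p)) := fun {φ} hφ => by
    have hi : Integrable fun x => (φ x : ℂ) := hφ.integrable.ofReal
    refine hi.mono
      ((Complex.continuous_ofReal.comp hφ.continuous).mul (by fun_prop)).aestronglyMeasurable
      (.of_forall fun x => ?_)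
    have e : -(I * x * p) = ((-(x * p) : ℝ) : ℂ) * I := by push_cast; ring
    rw [norm_mul, e, Complex.norm_exp_ofReal_mul_I, mul_one]
  simp only [unitaryFourier]
  have e : ∀ x : ℝ, (((1 - s) * φ₀ x + s * φ₁ x : ℝ) : ℂ) * Complex.exp (-(I * x * p))
      = (1 - s : ℝ) * ((φ₀ x : ℂ) * Complex.exp (-(I * x * p)))
        + (s : ℂ) * ((φ₁ x : ℂ) * Complex.exp (-(I * x * p))) := fun x => by
    push_cast; ring
  simp_rw [e]
  rw [integral_add ((hint h₀).const_mul _) ((hint h₁).const_mul _), integral_const_mul,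
    integral_const_mul]
  ring

variable {s : ℝ} (hs : s ∈ Set.Icc (0 : ℝ) 1)

include hs

theorem IsLocalizing.convexCombination (h₀ : IsLocalizing φ₀) (h₁ : IsLocalizing φ₁) :
    IsLocalizing fun x => (1 - s) * φ₀ x + s * φ₁ x where
  continuous := (h₀.continuous.const_mul _).add (h₁.continuous.const_mul _)
  integrable := (h₀.integrable.const_mul _).add (h₁.integrable.const_mul _)
  mem_Icc x := by
    have a := h₀.mem_Icc x
    have b := h₁.mem_Icc x
    constructor
    · nlinarith [mul_nonneg (sub_nonneg.2 hs.2) a.1, mul_nonneg hs.1 b.1]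
    · nlinarith [mul_le_of_le_one_right (sub_nonneg.2 hs.2) a.2, mul_le_of_le_one_right hs.1 b.2]
  even x := by rw [h₀.even, h₁.even]
  tsupport_subset := by
    refine closure_minimal (fun x hx => ?_) isClosed_Icc
    by_contra h
    have a : φ₀ x = 0 := by
      by_contra h'; exact h (h₀.tsupport_subset (subset_tsupport _ h'))
    have b : φ₁ x = 0 := by
      by_contra h'; exact h (h₁.tsupport_subset (subset_tsupport _ h'))
    exact hx (by simp [a, b])
  eq_one x hx := by rw [h₀.eq_one x hx, h₁.eq_one x hx]; ring
  antitone x y hx hxy := by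
    have a := h₀.antitone x y hx hxy
    have b := h₁.antitone x y hx hxy
    have := sub_nonneg.2 hs.2
    have := hs.1
    gcongr
  integrable_fourier := by
    have a := (h₀.integrable_fourier.const_mul ((1 - s : ℝ) : ℂ)).add
      (h₁.integrable_fourier.const_mul (s : ℂ))
    refine a.congr (.of_forall fun p => ?_)
    simp only [Pi.add_apply, h₀.unitaryFourier_convexCombination h₁]
    ring

/-- The constant `c_φ` is a seminorm of `φ`, hence convex. -/
theorem IsLocalizing.localizingConst_convexCombination_le (h₀ : IsLocalizing φ₀)
    (h₁ : IsLocalizing φ₁) : localizingConst (fun x => (1 - s) * φ₀ x + s * φ₁ x)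
      ≤ max (localizingConst φ₀) (localizingConst φ₁) := by
  have hs' := sub_nonneg.2 hs.2
  have hle : ∫ p : ℝ, ‖(p : ℂ) * unitaryFourier (fun x => (1 - s) * φ₀ x + s * φ₁ x) p‖
      ≤ (1 - s) * (∫ p : ℝ, ‖(p : ℂ) * unitaryFourier φ₀ p‖)
        + s * ∫ p : ℝ, ‖(p : ℂ) * unitaryFourier φ₁ p‖ := by
    rw [← integral_const_mul, ← integral_const_mul,
      ← integral_add (h₀.integrable_fourier.norm.const_mul _) (h₁.integrable_fourier.norm.const_mul _)]
    refine integral_mono (h₀.convexCombination hs h₁).integrable_fourier.norm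
      ((h₀.integrable_fourier.norm.const_mul _).add (h₁.integrable_fourier.norm.const_mul _))
      fun p => ?_
    simp only [h₀.unitaryFourier_convexCombination h₁, mul_add]
    refine (norm_add_le _ _).trans (le_of_eq ?_)
    rw [mul_left_comm, norm_mul, mul_left_comm, norm_mul _ ((p : ℂ) * unitaryFourier φ₁ p),
      Complex.norm_real, Complex.norm_real, Real.norm_of_nonneg hs', Real.norm_of_nonneg hs.1]
  have h1 : localizingConst (fun x => (1 - s) * φ₀ x + s * φ₁ x)
      ≤ (1 - s) * localizingConst φ₀ + s * localizingConst φ₁ := by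
    simp only [localizingConst]
    rw [← mul_div_assoc, ← mul_div_assoc, ← add_div]
    gcongr
    linarith
  refine h1.trans ?_
  have a := mul_le_mul_of_nonneg_left (le_max_left (localizingConst φ₀) (localizingConst φ₁)) hs'
  have b := mul_le_mul_of_nonneg_left (le_max_right (localizingConst φ₀) (localizingConst φ₁)) hs.1
  linarith

end LocalizingFunctions

/-! ### The localizer class: independence of the choices, existence of admissible pairs -/

section LocalizerClass

variable {A X : Type*} [NonUnitalCStarAlgebra A] [PartialOrder A] [StarOrderedRing A]
  [SMul A X] [NormedAddCommGroup X] [NormedSpace ℂ X] [CStarModule A X] [CompleteSpace X]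
  {D : X →ₗ.[ℂ] X} {γ H : Adjointable A X}

/-- As `ρ → ∞` the left side tends to `κd` and `κ'²ρ²/4` to infinity, so `κ d < G` is the only real
constraint. Separate `κ` and `κ'` allow a whole interval `[κ', κ]` to be treated at once. -/
theorem exists_admissible_scale {κ κ' c d G : ℝ} (hκ' : 0 < κ') (hG : κ * d < G) :
    ∃ ρ₀ : ℝ, ∀ ρ, ρ₀ ≤ ρ → 0 < ρ ∧ (κ + c / ρ) * d < min G (κ' ^ 2 * ρ ^ 2 / 4) := by
  have h1 : Tendsto (fun ρ : ℝ => (κ + c / ρ) * d) atTop (𝓝 (κ * d)) := by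
    have : Tendsto (fun ρ : ℝ => c / ρ) atTop (𝓝 0) := tendsto_id.const_div_atTop c
    simpa using (this.const_add κ).mul_const d
  have h2 : Tendsto (fun ρ : ℝ => κ' ^ 2 * ρ ^ 2 / 4) atTop atTop :=
    ((tendsto_pow_atTop two_ne_zero).const_mul_atTop (by positivity)).atTop_div_const (by norm_num)
  have h3 := (h1.eventually (gt_mem_nhds hG)).and
    ((h2.eventually_gt_atTop G).and (eventually_gt_atTop 0))
  obtain ⟨ρ₀, h⟩ := eventually_atTop.1 h3
  refine ⟨ρ₀, fun ρ hρ => ?_⟩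
  obtain ⟨ha, hb, hc⟩ := h ρ hρ
  exact ⟨hc, lt_min ha (ha.trans hb)⟩

theorem isAdmissible_of_le {hH : IsLipschitz D H} {φ : ℝ → ℝ} {κ κ₁ κ' c d ρ : ℝ}
    (hφ : IsLocalizing φ) (hκ' : 0 < κ') (h1 : κ' ≤ κ) (h2 : κ ≤ κ₁) (hc : localizingConst φ ≤ c)
    (hd : ‖hH.deriv‖ ≤ d) (hρ : 0 < ρ)
    (h : (κ₁ + c * ‖H‖ / ρ) * d < min ((‖Ring.inverse H‖⁻¹) ^ 2) (κ' ^ 2 * ρ ^ 2 / 4)) :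
    IsAdmissible hH φ κ ρ := by
  have h0 := hφ.localizingConst_nonneg
  have hκ : 0 < κ := hκ'.trans_le h1
  have hc0 : 0 ≤ c := h0.trans hc
  refine ⟨hκ, hρ, lt_of_le_of_lt ?_ (h.trans_le ?_)⟩
  · have : 0 ≤ κ₁ + c * ‖H‖ / ρ := by have := hκ.trans_le h2; positivity
    gcongr
  · gcongr

theorem IsAdmissible.mono {hH : IsLipschitz D H} {φ : ℝ → ℝ} {κ ρ ρ' : ℝ} (hφ : IsLocalizing φ)
    (h : IsAdmissible hH φ κ ρ) (hρ : ρ ≤ ρ') : IsAdmissible hH φ κ ρ' := by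
  obtain ⟨hκ, hρ0, h⟩ := h
  have h0 := hφ.localizingConst_nonneg
  refine ⟨hκ, hρ0.trans_le hρ, lt_of_le_of_lt ?_ (h.trans_le ?_)⟩
  · gcongr
  · gcongr

theorem IsAdmissible.mul_norm_deriv_lt {hH : IsLipschitz D H} {φ : ℝ → ℝ} {κ ρ : ℝ}
    (hφ : IsLocalizing φ) (h : IsAdmissible hH φ κ ρ) :
    κ * ‖hH.deriv‖ < (‖Ring.inverse H‖⁻¹) ^ 2 := by
  obtain ⟨hκ, hρ0, h⟩ := h
  have h0 := hφ.localizingConst_nonneg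
  refine lt_of_le_of_lt ?_ (h.trans_le (min_le_left _ _))
  gcongr
  exact le_add_of_nonneg_right (by positivity)

/-- The class of `(-γ, L_{κ,ρ}(H, D, φ))`. -/
noncomputable def localizerClass (hK : IsEvenUnboundedKasparovModule A γ D) (hH : IsLipschitz D H)
    (hHs : IsSelfAdjoint H) (hHγ : H * γ = γ * H) (hHu : IsUnit H) {φ : ℝ → ℝ}
    (hφ : IsLocalizing φ) {κ ρ : ℝ} (ha : IsAdmissible hH φ κ ρ) : K0Inv (compactOperators A X) :=
  K0Inv.mk (negPair (compactOperators A X) (hK.localizer_add_grading_mem (H := H) hφ ha.2.1 κ)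
    hK.grading_selfAdjoint hK.grading_sq (hK.isSelfAdjoint_localizer hφ hHs hHγ ha.2.1 κ)
    (hK.isUnit_localizer hφ hH hHs hHγ hHu ha))

/-- Used at the ends of the path, to identify `D + 0·T` with `D` and `D + 1·T` with `D + T`. -/
theorem localizerClass_congr {D' : X →ₗ.[ℂ] X} (e : D = D')
    (hK : IsEvenUnboundedKasparovModule A γ D) (hK' : IsEvenUnboundedKasparovModule A γ D')
    (hH : IsLipschitz D H) (hH' : IsLipschitz D' H)
    (hHs : IsSelfAdjoint H) (hHγ : H * γ = γ * H) (hHu : IsUnit H) {φ : ℝ → ℝ}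
    (hφ : IsLocalizing φ) {κ ρ : ℝ} (ha : IsAdmissible hH φ κ ρ) (ha' : IsAdmissible hH' φ κ ρ) :
    localizerClass hK hH hHs hHγ hHu hφ ha = localizerClass hK' hH' hHs hHγ hHu hφ ha' := by
  subst e
  rfl

section Parameters

variable (hK : IsEvenUnboundedKasparovModule A γ D) (hH : IsLipschitz D H)
    (hHs : IsSelfAdjoint H) (hHγ : H * γ = γ * H) (hHu : IsUnit H)

include hK hHs hHγ hHu

theorem localizerClass_eq_of_path {φ : unitInterval → ℝ → ℝ} {κ ρ : unitInterval → ℝ}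
    (hφc : Continuous (Function.uncurry φ)) (hκ : Continuous κ) (hρ : Continuous ρ)
    (hφ : ∀ s, IsLocalizing (φ s)) (ha : ∀ s, IsAdmissible hH (φ s) (κ s) (ρ s)) :
    localizerClass hK hH hHs hHγ hHu (hφ 0) (ha 0)
      = localizerClass hK hH hHs hHγ hHu (hφ 1) (ha 1) := by
  refine mk_negPair_eq_of_path (T := fun s => hK.selfAdjointRegular.localizer γ H (φ s) (κ s) (ρ s))
    ?_ (fun s => hK.localizer_add_grading_mem (hφ s) (ha s).2.1 _)
    hK.grading_selfAdjoint hK.grading_sq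
    (fun s => hK.isSelfAdjoint_localizer (hφ s) hHs hHγ (ha s).2.1 _)
    (fun s => hK.isUnit_localizer (hφ s) hH hHs hHγ hHu (ha s))
  have hρ0 : ∀ s, ρ s ≠ 0 := fun s => (ha s).2.1.ne'
  have hρ2 : ∀ s, 2 * ρ s ≠ 0 := fun s => mul_ne_zero two_ne_zero (hρ0 s)
  -- A bound for `ρ` on the compact interval; all functions of `D` involved then vanish for `|t| ≥
  -- 2M`.
  obtain ⟨M, hM⟩ := (isCompact_univ (X := unitInterval)).bddAbove_image hρ.continuousOn
  have hM' : ∀ s, ρ s ≤ M := fun s => hM ⟨s, Set.mem_univ _, rfl⟩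
  have hq1 : Continuous fun p : unitInterval × ℝ => φ p.1 (p.2 / ρ p.1) := by
    have : Continuous fun p : unitInterval × ℝ => (p.1, p.2 / ρ p.1) :=
      continuous_fst.prodMk (continuous_snd.div₀ (hρ.comp continuous_fst) fun p => hρ0 p.1)
    exact hφc.comp this
  have hq2 : Continuous fun p : unitInterval × ℝ => φ p.1 (p.2 / (2 * ρ p.1)) := by
    have : Continuous fun p : unitInterval × ℝ => (p.1, p.2 / (2 * ρ p.1)) :=
      continuous_fst.prodMk
        (continuous_snd.div₀ ((hρ.comp continuous_fst).const_mul 2) fun p => hρ2 p.1)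
    exact hφc.comp this
  have hz1 : ∀ s t, 2 * M ≤ |t| → φ s (t / ρ s) = 0 := fun s t ht => by
    refine (hφ s).comp_div_eq_zero (ha s).2.1 ?_
    have := (ha s).2.1
    linarith [hM' s]
  have hz2 : ∀ s t, 2 * M ≤ |t| → φ s (t / (2 * ρ s)) = 0 := fun s t ht => by
    refine (hφ s).comp_div_eq_zero (by have := (ha s).2.1; positivity) ?_
    linarith [hM' s]
  have c1 : Continuous fun s => hK.selfAdjointRegular.cutoff (φ s) (ρ s) :=
    hK.selfAdjointRegular.continuous_realFc (F := fun s t => φ s (t / ρ s)) hq1 hz1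
  have c2 : Continuous fun s => hK.selfAdjointRegular.realFc fun t => t * φ s (t / (2 * ρ s)) ^ 2 :=
    hK.selfAdjointRegular.continuous_realFc (F := fun s t => t * φ s (t / (2 * ρ s)) ^ 2)
      (continuous_snd.mul (hq2.pow 2)) (M := 2 * M) fun s t ht => by simp [hz2 s t ht]
  have c3 : Continuous fun s => hK.selfAdjointRegular.defect (φ s) (2 * ρ s) :=
    hK.selfAdjointRegular.continuous_realFc (F := fun s t => sqrtDefect (φ s (t / (2 * ρ s))))
      (continuous_sqrtDefect.comp hq2) (M := 2 * M) fun s t ht => by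
        rw [hz2 s t ht, sqrtDefect_zero]
  have hκ' : Continuous fun s => (κ s : ℂ) := Complex.continuous_ofReal.comp hκ
  simp_rw [fun s => hK.selfAdjointRegular.localizer_eq (hφ s) (ha s).2.1 γ H (κ s)]
  fun_prop

theorem localizerClass_eq_of_le {φ : ℝ → ℝ} (hφ : IsLocalizing φ) {κ ρ ρ' : ℝ}
    (ha : IsAdmissible hH φ κ ρ) (hρ : ρ ≤ ρ') :
    localizerClass hK hH hHs hHγ hHu hφ ha
      = localizerClass hK hH hHs hHγ hHu hφ (ha.mono hφ hρ) := by
  have h := localizerClass_eq_of_path hK hH hHs hHγ hHu (φ := fun _ => φ) (κ := fun _ => κ)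
    (ρ := fun s => ρ + s * (ρ' - ρ)) (hφ.continuous.comp continuous_snd) continuous_const
    (by fun_prop) (fun _ => hφ)
    (fun s => ha.mono hφ (le_add_of_nonneg_right (mul_nonneg s.2.1 (sub_nonneg.2 hρ))))
  convert! h using 2 <;> simp

/-- Admissibility gives `κ₀‖d(H)‖ < g²` and `κ₁‖d(H)‖ < g²`, so some large `ρ` works for all `κ`
between them and all convex combinations of the two localizing functions. Both pairs are first moved
up to this `ρ`, then joined by a straight line. -/
theorem localizerClass_eq {φ₀ φ₁ : ℝ → ℝ} (h₀ : IsLocalizing φ₀) (h₁ : IsLocalizing φ₁)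
    {κ₀ κ₁ ρ₀ ρ₁ : ℝ} (ha₀ : IsAdmissible hH φ₀ κ₀ ρ₀) (ha₁ : IsAdmissible hH φ₁ κ₁ ρ₁) :
    localizerClass hK hH hHs hHγ hHu h₀ ha₀ = localizerClass hK hH hHs hHγ hHu h₁ ha₁ := by
  have hG : max κ₀ κ₁ * ‖hH.deriv‖ < (‖Ring.inverse H‖⁻¹) ^ 2 := by
    rcases max_choice κ₀ κ₁ with h | h <;> rw [h]
    · exact ha₀.mul_norm_deriv_lt h₀
    · exact ha₁.mul_norm_deriv_lt h₁
  obtain ⟨r, hr⟩ := exists_admissible_scale (c := max (localizingConst φ₀) (localizingConst φ₁) * ‖H‖)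
    (lt_min ha₀.1 ha₁.1) hG
  obtain ⟨hρ, hr⟩ := hr (max r (max ρ₀ ρ₁)) (le_max_left _ _)
  set ρ := max r (max ρ₀ ρ₁) with hρ_def
  have hρ₀ : ρ₀ ≤ ρ := (le_max_left _ _).trans (le_max_right _ _)
  have hρ₁ : ρ₁ ≤ ρ := (le_max_right _ _).trans (le_max_right _ _)
  rw [localizerClass_eq_of_le hK hH hHs hHγ hHu h₀ ha₀ hρ₀,
    localizerClass_eq_of_le hK hH hHs hHγ hHu h₁ ha₁ hρ₁]
  have hκ1 : ∀ s : unitInterval, min κ₀ κ₁ ≤ (1 - s) * κ₀ + s * κ₁ := fun s => by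
    have a := mul_le_mul_of_nonneg_left (min_le_left κ₀ κ₁) (sub_nonneg.2 s.2.2)
    have b := mul_le_mul_of_nonneg_left (min_le_right κ₀ κ₁) s.2.1
    linarith
  have hκ2 : ∀ s : unitInterval, (1 - s) * κ₀ + s * κ₁ ≤ max κ₀ κ₁ := fun s => by
    have a := mul_le_mul_of_nonneg_left (le_max_left κ₀ κ₁) (sub_nonneg.2 s.2.2)
    have b := mul_le_mul_of_nonneg_left (le_max_right κ₀ κ₁) s.2.1
    linarith
  have hc0 := h₀.continuous
  have hc1 := h₁.continuous
  have h := localizerClass_eq_of_path hK hH hHs hHγ hHu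
    (φ := fun s x => (1 - (s : ℝ)) * φ₀ x + s * φ₁ x)
    (κ := fun s => (1 - (s : ℝ)) * κ₀ + s * κ₁) (ρ := fun _ => ρ) (by fun_prop)
    (by fun_prop) continuous_const (fun s => h₀.convexCombination s.2 h₁)
    (fun s => isAdmissible_of_le (h₀.convexCombination s.2 h₁) (lt_min ha₀.1 ha₁.1) (hκ1 s) (hκ2 s)
      (h₀.localizingConst_convexCombination_le s.2 h₁) le_rfl hρ hr)
  convert! h using 2 <;> simp

end Parameters

theorem isSpectralLocalizerClass_localizerClass (hK : IsEvenUnboundedKasparovModule A γ D)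
    (hH : IsLipschitz D H) (hHs : IsSelfAdjoint H) (hHγ : H * γ = γ * H) (hHu : IsUnit H)
    {φ : ℝ → ℝ} (hφ : IsLocalizing φ) {κ ρ : ℝ} (ha : IsAdmissible hH φ κ ρ) :
    IsSpectralLocalizerClass γ hK.selfAdjointRegular hH
      (localizerClass hK hH hHs hHγ hHu hφ ha) := by
  refine ⟨⟨φ, κ, ρ, hφ, ha⟩, fun φ' κ' ρ' hφ' ha' => ⟨_, _,
    localizerClass_eq hK hH hHs hHγ hHu hφ' hφ ha' ha⟩⟩

/-- The class defined by choice is pinned down by existence and uniqueness. -/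
theorem spectralLocalizerClass_eq (hK : IsEvenUnboundedKasparovModule A γ D)
    (hH : IsLipschitz D H) (hHs : IsSelfAdjoint H) (hHγ : H * γ = γ * H) (hHu : IsUnit H)
    {φ : ℝ → ℝ} (hφ : IsLocalizing φ) {κ ρ : ℝ} (ha : IsAdmissible hH φ κ ρ) :
    spectralLocalizerClass γ hK.selfAdjointRegular hH = localizerClass hK hH hHs hHγ hHu hφ ha :=
  (Classical.epsilon_spec (p := IsSpectralLocalizerClass γ hK.selfAdjointRegular hH)
    ⟨_, isSpectralLocalizerClass_localizerClass hK hH hHs hHγ hHu hφ ha⟩).unique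
    (isSpectralLocalizerClass_localizerClass hK hH hHs hHγ hHu hφ ha)

/-- Invariance of the localizer class along the path `D + sT`. -/
theorem localizerClass_boundedPerturbation_eq (hK : IsEvenUnboundedKasparovModule A γ D)
    (hHs : IsSelfAdjoint H) (hHγ : H * γ = γ * H) (hHu : IsUnit H)
    {T : unitInterval → Adjointable A X} (hT : Continuous T)
    (hKT : ∀ s, IsEvenUnboundedKasparovModule A γ (boundedPerturbation D (T s)))
    (hHT : ∀ s, IsLipschitz (boundedPerturbation D (T s)) H) {φ : ℝ → ℝ}
    (hφ : IsLocalizing φ) {κ ρ : ℝ} (ha : ∀ s, IsAdmissible (hHT s) φ κ ρ) :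
    localizerClass (hKT 0) (hHT 0) hHs hHγ hHu hφ (ha 0)
      = localizerClass (hKT 1) (hHT 1) hHs hHγ hHu hφ (ha 1) := by
  have hρ := (ha 0).2.1
  have h2 : 0 < 2 * ρ := by positivity
  refine mk_negPair_eq_of_path
    (T := fun s => (hKT s).selfAdjointRegular.localizer γ H φ κ ρ)
    ?_ (fun s => (hKT s).localizer_add_grading_mem hφ hρ _)
    hK.grading_selfAdjoint hK.grading_sq
    (fun s => (hKT s).isSelfAdjoint_localizer hφ hHs hHγ hρ _)
    (fun s => (hKT s).isUnit_localizer hφ (hHT s) hHs hHγ hHu (ha s))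
  have c1 : Continuous fun s => (hKT s).selfAdjointRegular.cutoff φ ρ :=
    continuous_realFc_boundedPerturbation hT (fun s => (hKT s).selfAdjointRegular) (hφ.isCc hρ)
  have c2 : Continuous fun s => (hKT s).selfAdjointRegular.realFc fun t => t * φ (t / (2 * ρ)) ^ 2 :=
    continuous_realFc_boundedPerturbation hT (fun s => (hKT s).selfAdjointRegular)
      (hφ.isCc_mul_sq h2)
  have c3 : Continuous fun s => (hKT s).selfAdjointRegular.defect φ (2 * ρ) :=
    continuous_realFc_boundedPerturbation hT (fun s => (hKT s).selfAdjointRegular)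
      (hφ.isCc_sqrtDefect h2)
  simp_rw [fun s => (hKT s).selfAdjointRegular.localizer_eq hφ hρ γ H κ]
  fun_prop

/-- The place where `X ≠ 0` enters. On the zero module the gap `‖H⁻¹‖⁻¹` would evaluate to `0` and
no pair could be admissible. -/
theorem norm_inverse_pos [Nontrivial X] (hHu : IsUnit H) : 0 < ‖Ring.inverse H‖ := by
  rw [norm_pos_iff]
  intro h0
  have h1 := Ring.mul_inverse_cancel _ hHu
  rw [h0, mul_zero] at h1
  obtain ⟨x, hx⟩ := exists_ne (0 : X)
  exact hx (congrArg (fun S : Adjointable A X => S.op x) h1).symm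

/-- The order of quantifiers is the point: the pair depends on the bound `d` only and serves every
operator satisfying it. -/
theorem exists_admissible_of_norm_deriv_le [Nontrivial X] (hHu : IsUnit H) {φ : ℝ → ℝ}
    (hφ : IsLocalizing φ) {d : ℝ} (hd : 0 ≤ d) : ∃ κ ρ : ℝ, ∀ (D : X →ₗ.[ℂ] X)
      (hH : IsLipschitz D H), ‖hH.deriv‖ ≤ d → IsAdmissible hH φ κ ρ := by
  have hg : 0 < (‖Ring.inverse H‖⁻¹) ^ 2 := by
    have := norm_inverse_pos hHu
    positivity
  set G := (‖Ring.inverse H‖⁻¹) ^ 2 with hG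
  -- Dividing by `d + 1` rather than `d` covers `d = 0` and makes `κ d < G` strict.
  have hκ : 0 < G / (d + 1) := by positivity
  have hκd : G / (d + 1) * d < G := by
    rw [div_mul_eq_mul_div, div_lt_iff₀ (by positivity)]
    nlinarith
  obtain ⟨ρ, h⟩ := exists_admissible_scale (c := localizingConst φ * ‖H‖) hκ hκd
  obtain ⟨hρ, h⟩ := h ρ le_rfl
  exact ⟨G / (d + 1), ρ, fun D hH hle => isAdmissible_of_le hφ hκ le_rfl le_rfl le_rfl hle hρ h⟩

end LocalizerClass

/-! ### Invariance of the localizer class under odd bounded perturbations -/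

theorem propositionp {B X : Type*} [NonUnitalCStarAlgebra B] [PartialOrder B] [StarOrderedRing B]
    (hB : IsSigmaUnital B)
    [NormedAddCommGroup X] [NormedSpace ℂ X] [CompleteSpace X] [Nontrivial X]
    [SMul Bᵐᵒᵖ X] [CStarModule Bᵐᵒᵖ X]
    (γ : Adjointable Bᵐᵒᵖ X) (D : X →ₗ.[ℂ] X)
    (hD : IsEvenUnboundedKasparovModule Bᵐᵒᵖ γ D)
    (H : Adjointable Bᵐᵒᵖ X) (hHlip : IsLipschitz D H) (hHeven : H * γ = γ * H)
    (hHsa : IsSelfAdjoint H) (hHinv : IsUnit H)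
    (T : Adjointable Bᵐᵒᵖ X) (hTodd : T * γ = -(γ * T)) (hTsa : IsSelfAdjoint T) :
    ∃ (hDT : IsEvenUnboundedKasparovModule Bᵐᵒᵖ γ (boundedPerturbation D T))
      (hHlip' : IsLipschitz (boundedPerturbation D T) H),
      IsSpectralLocalizerClass γ hD.selfAdjointRegular hHlip
        (spectralLocalizerClass γ hD.selfAdjointRegular hHlip) ∧
      IsSpectralLocalizerClass γ hDT.selfAdjointRegular hHlip'
        (spectralLocalizerClass γ hDT.selfAdjointRegular hHlip') ∧
      spectralLocalizerClass γ hDT.selfAdjointRegular hHlip'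
        = spectralLocalizerClass γ hD.selfAdjointRegular hHlip := by
  have hDT := hD.boundedPerturbation hTodd hTsa
  have hHT := hHlip.boundedPerturbation T
  have hK : ∀ s : unitInterval,
      IsEvenUnboundedKasparovModule Bᵐᵒᵖ γ (boundedPerturbation D ((s : ℝ) • T)) := fun s => by
    refine hD.boundedPerturbation ?_ ((IsSelfAdjoint.all _).smul hTsa)
    rw [smul_mul_assoc, mul_smul_comm, hTodd, smul_neg]
  have hH : ∀ s : unitInterval, IsLipschitz (boundedPerturbation D ((s : ℝ) • T)) H :=
    fun s => hHlip.boundedPerturbation _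
  have hd : ∀ s : unitInterval, ‖(hH s).deriv‖ ≤ ‖hHlip.deriv‖ + ‖T * H - H * T‖ := fun s => by
    rw [hHlip.deriv_boundedPerturbation (hH s) (hK s).selfAdjointRegular, smul_mul_assoc,
      mul_smul_comm, ← smul_sub]
    refine (norm_add_le _ _).trans (add_le_add le_rfl ?_)
    rw [norm_smul, Real.norm_of_nonneg s.2.1]
    exact mul_le_of_le_one_left (norm_nonneg _) s.2.2
  obtain ⟨φ, hφ⟩ := exists_isLocalizing
  -- One pair for all `D + sT`, including both ends, since `hd` is uniform in `s`.
  obtain ⟨κ, ρ, hadm⟩ := exists_admissible_of_norm_deriv_le hHinv hφ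
    (add_nonneg (norm_nonneg hHlip.deriv) (norm_nonneg (T * H - H * T)))
  have ha := hadm D hHlip (le_add_of_nonneg_right (norm_nonneg _))
  have haT := hadm _ hHT (by
    rw [hHlip.deriv_boundedPerturbation hHT hDT.selfAdjointRegular]
    exact norm_add_le _ _)
  have has := fun s => hadm _ (hH s) (hd s)
  have e0 : boundedPerturbation D (((0 : unitInterval) : ℝ) • T) = D := by
    rw [Set.Icc.coe_zero, zero_smul, boundedPerturbation_zero]
  have e1 : boundedPerturbation D (((1 : unitInterval) : ℝ) • T) = boundedPerturbation D T := by
    rw [Set.Icc.coe_one, one_smul]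
  have hpath := localizerClass_boundedPerturbation_eq hD hHsa hHeven hHinv
    (T := fun s : unitInterval => (s : ℝ) • T) (by fun_prop) hK hH hφ has
  rw [localizerClass_congr e0 (hK 0) hD (hH 0) hHlip hHsa hHeven hHinv hφ (has 0) ha,
    localizerClass_congr e1 (hK 1) hDT (hH 1) hHT hHsa hHeven hHinv hφ (has 1) haT] at hpath
  have k := spectralLocalizerClass_eq hD hHlip hHsa hHeven hHinv hφ ha
  have kT := spectralLocalizerClass_eq hDT hHT hHsa hHeven hHinv hφ haT
  refine ⟨hDT, hHT, ?_, ?_, ?_⟩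
  · rw [k]
    exact isSpectralLocalizerClass_localizerClass hD hHlip hHsa hHeven hHinv hφ ha
  · rw [kT]
    exact isSpectralLocalizerClass_localizerClass hDT hHT hHsa hHeven hHinv hφ haT
  · rw [k, kT, hpath]
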